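/- Let $n,d\ge 0$ be integers. A mold of degree $n$ and rank $d$ on a scheme $X$ is a subsheaf of $\mathcal{O}_X$-algebras $\mathcal{A}\subseteq M_n(\mathcal{O}_X)$ such that $\mathcal{A}$ is locally free of rank $d$ and $M_n(\mathcal{O}_X)/\mathcal{A}$ is locally free (of finite, not necessarily constant, rank). For a morphism $f:Y\to X$, the pullback $\mathcal{A}_Y\subseteq M_n(\mathcal{O}_Y)$ is the image of $f^*\mathcal{A}$, which is again a mold of degree $n$ and rank $d$. Let $\mathrm{Mold}_{n,d}$ be the scheme representing the contravariant functor that sends a scheme $X$ to the set of molds of degree $n$ and rank $d$ on $X$ (such a scheme exists). Let $\mathrm{PGL}_n$ be the projective linear group scheme over $\mathbb{Z}$, i.e. the spectrum of the degree-zero part of $\mathbb{Z}[x_{ij}\mid 1\le i,j\le n][1/\det(x_{ij})]$. Let $S$ be a locally noetherian scheme and let $\mathcal{A}\subseteq M_n(\mathcal{O}_S)$ be a mold of degree $n$ and rank $d$ on $S$. For $x\in S$ with residue field $k(x)$, let $\mathcal{A}(x)=\mathcal{A}\otimes_{\mathcal{O}_S}k(x)\subseteq M_n(k(x))$. Put $\mathrm{PGL}_{n,S}=\mathrm{PGL}_n\otimes_{\mathbb{Z}}S$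 and let $$\phi_{\mathcal{A}}:\mathrm{PGL}_{n,S}\to \mathrm{Mold}_{n,d}\otimes_{\mathbb{Z}}S$$ be the $S$-morphism that sends a point $P\in\mathrm{PGL}_n(X)$, for an $S$-scheme $X$, to the mold $P^{-1}\mathcal{A}_XP$ on $X$. Then $\phi_{\mathcal{A}}$ is smooth if and only if for every $x\in S$ $$H^1\bigl(\mathcal{A}(x),\,M_n(k(x))/\mathcal{A}(x)\bigr)=0,$$ where $H^1(A,M)$ denotes the first Hochschild cohomology of the $k(x)$-algebra $A$ with coefficients in the $A$-bimodule $M$, i.e. the first cohomology of the complex $C^p(A,M)=\mathrm{Hom}_{k(x)}(A^{\otimes p},M)$ with the differential $$(df)(a_1,\dots,a_{p+1})=a_1f(a_2,\dots,a_{p+1})+\sum_{i=1}^{p}(-1)^if(\dots,a_ia_{i+1},\dots)+(-1)^{p+1}f(a_1,\dots,a_p)a_{p+1}.$$ -/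

import Mathlib

open CategoryTheory AlgebraicGeometry Opposite TopologicalSpace Limits
universe u

namespace Mold

section Basis
variable {n : ℕ} {ι R S T : Type*} [CommRing R] [CommRing S] [CommRing T]

/-- Base change of a basis. -/
noncomputable def basisMap [Fintype ι] (φ : R →+* S) (β : Module.Basis ι R (Matrix (Fin n) (Fin n) R)) :
    Module.Basis ι S (Matrix (Fin n) (Fin n) S) :=
  Module.Basis.ofEquivFun
    { toFun := fun m i => ∑ p, ∑ q, m p q * φ (β.repr (Matrix.single p q 1) i)
      invFun := fun c => ∑ i, c i • φ.mapMatrix (β i)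
      map_add' := fun m m' => by
        ext i; simp [add_mul, Finset.sum_add_distrib]
      map_smul' := fun r m => by
        ext i; simp [Finset.mul_sum, mul_assoc]
      left_inv := fun m => by
        have key : ∀ p q, ∑ i, φ (β.repr (Matrix.single p q 1) i) • φ.mapMatrix (β i)
            = Matrix.single p q 1 := by
          intro p q
          have := congrArg φ.mapMatrix (β.sum_repr (Matrix.single p q 1))
          rw [map_sum] at this
          convert this using 2 with i
          · ext a b; simp
          · ext a b; simp [Matrix.single_apply, apply_ite φ]
        calc _ = ∑ p, ∑ q, m p q • ∑ i, φ (β.repr (Matrix.single p q 1) i) • φ.mapMatrix (β i) := by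
              simp_rw [Finset.sum_smul, Finset.smul_sum, smul_smul]
              rw [Finset.sum_comm]
              refine Finset.sum_congr rfl fun p _ => ?_
              rw [Finset.sum_comm]
          _ = m := by
              simp_rw [key]
              conv_rhs => rw [Matrix.matrix_eq_sum_single m]
              simp [Matrix.smul_single]
      right_inv := fun c => by
        classical
        ext i
        have key : ∀ k, ∑ p, ∑ q, φ (β k p q) * φ (β.repr (Matrix.single p q 1) i)
            = if k = i then 1 else 0 := by
          intro k
          have h1 : β k = ∑ p, ∑ q, β k p q • Matrix.single p q 1 := by
            conv_lhs => rw [Matrix.matrix_eq_sum_single (β k)]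
            simp [Matrix.smul_single]
          have h2 := congrArg (fun m => β.repr m i) h1
          simp only [map_sum, map_smul, Finsupp.coe_finsetSum, Finset.sum_apply, Finsupp.smul_apply,
            smul_eq_mul, Module.Basis.repr_self, Finsupp.single_apply] at h2
          have h3 := congrArg φ h2
          simp only [map_sum, map_mul, apply_ite φ, map_one, map_zero] at h3
          exact h3.symm
        calc _ = ∑ k, c k * ∑ p, ∑ q, φ (β k p q) * φ (β.repr (Matrix.single p q 1) i) := by
              simp only [Matrix.sum_apply, Matrix.smul_apply, RingHom.mapMatrix_apply, Matrix.map_apply,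
                smul_eq_mul, Finset.sum_mul, Finset.mul_sum, mul_assoc]
              rw [Finset.sum_comm' (t' := Finset.univ) (s' := fun _ => Finset.univ) (by simp)]
              conv_lhs => enter [2, q]; rw [Finset.sum_comm]
              rw [Finset.sum_comm]
              refine Finset.sum_congr rfl fun k _ => ?_
              rw [Finset.sum_comm]
          _ = c i := by simp [key] }

variable [Fintype ι] (β : Module.Basis ι R (Matrix (Fin n) (Fin n) R))

@[simp] lemma basisMap_apply (φ : R →+* S) (i : ι) :
    basisMap φ β i = φ.mapMatrix (β i) := by
  classical
  rw [basisMap, Module.Basis.coe_ofEquivFun]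
  simp [Pi.single_apply]

lemma basisMap_repr (φ : R →+* S) (m : Matrix (Fin n) (Fin n) R) (i : ι) :
    (basisMap φ β).repr (φ.mapMatrix m) i = φ (β.repr m i) := by
  have h : φ.mapMatrix m = ∑ k, φ (β.repr m k) • basisMap φ β k := by
    conv_lhs => rw [← β.sum_repr m]
    rw [map_sum]
    refine Finset.sum_congr rfl fun k _ => ?_
    ext a b; simp
  rw [h, Module.Basis.repr_sum_self]

lemma basisMap_comp (φ : R →+* S) (ψ : S →+* T) :
    basisMap ψ (basisMap φ β) = basisMap (ψ.comp φ) β := by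
  ext i; simp

lemma basisMap_id : basisMap (RingHom.id R) β = β := by
  ext i; simp
end Basis
end Mold

/-- `n × n` matrices over the ring `Γ(X, U)`, i.e. sections over `U` of the sheaf `Mₙ(𝒪_X)`. -/
abbrev MatSec (n : ℕ) (X : Scheme.{u}) (U : X.Opens) : Type u :=
  Matrix (Fin n) (Fin n) Γ(X, U)

/-- Restriction of sections of `Mₙ(𝒪_X)`. -/
abbrev resMat {n : ℕ} {X : Scheme.{u}} {U V : X.Opens} (h : V ≤ U) :
    MatSec n X U →+* MatSec n X V :=
  (X.presheaf.map (homOfLE h).op).hom.mapMatrix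

/-- For `f : X ⟶ Y`, the map `Mₙ(𝒪_Y)(V) → Mₙ(𝒪_X)(W)` for `W ⊆ f⁻¹(V)`. -/
abbrev pullMat {n : ℕ} {X Y : Scheme.{u}} (f : X ⟶ Y) (V : Y.Opens) (W : X.Opens)
    (h : W ≤ f ⁻¹ᵁ V) : MatSec n Y V →+* MatSec n X W :=
  (f.appLE V W h).hom.mapMatrix

/-- A mold of degree `n` and rank `d` on a scheme `X`: a subsheaf of `𝒪_X`-algebras `A` of
`Mₙ(𝒪_X)` such that `A` is locally free of rank `d` and `Mₙ(𝒪_X)/A` is locally free. -/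
structure Mold (n d : ℕ) (X : Scheme.{u}) where
  /-- The sections of `A`, a unital `Γ(X, U)`-subalgebra of `Mₙ(Γ(X, U))` for each open `U`. -/
  sec : ∀ U : X.Opens, Subalgebra Γ(X, U) (MatSec n X U)
  /-- `A` is stable under restriction. -/
  res_mem : ∀ {U V : X.Opens} (h : V ≤ U) {m : MatSec n X U}, m ∈ sec U → resMat h m ∈ sec V
  /-- `A` is a subsheaf: membership is a local condition. -/
  local_mem : ∀ {U : X.Opens} {m : MatSec n X U},
    (∀ x ∈ U, ∃ (V : X.Opens) (h : V ≤ U), x ∈ V ∧ resMat h m ∈ sec V) → m ∈ sec U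
  /-- `A` is locally free of rank `d`: around each point there are sections `a₁, …, a_d` giving an
  isomorphism of sheaves `𝒪_U^d ≅ A|_U`. -/
  locallyFree : ∀ x : X, ∃ U : X.Opens, x ∈ U ∧ ∃ a : Fin d → MatSec n X U,
    ∀ (V : X.Opens) (h : V ≤ U),
      LinearIndependent Γ(X, V) (fun i => resMat h (a i)) ∧
      Submodule.span Γ(X, V) (Set.range fun i => resMat h (a i)) = Subalgebra.toSubmodule (sec V)
  /-- `Mₙ(𝒪_X)/A` is locally free: around each point there are sections `b₁, …, b_e` of `Mₙ(𝒪_X)`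
  whose classes give an isomorphism of sheaves `𝒪_U^e ≅ (Mₙ(𝒪_X)/A)|_U`. (Every local basis of
  the quotient sheaf lifts to `Mₙ(𝒪_X)` after shrinking `U`.) -/
  quotient_locallyFree : ∀ x : X, ∃ U : X.Opens, x ∈ U ∧ ∃ (e : ℕ) (b : Fin e → MatSec n X U),
    ∀ (V : X.Opens) (h : V ≤ U) (m : MatSec n X V),
      ∃! c : Fin e → Γ(X, V), m - ∑ j, c j • resMat h (b j) ∈ sec V

namespace Mold

variable {n d : ℕ} {X Y Z : Scheme.{u}}

section res
@[simp] lemma resMat_resMat {U V W : X.Opens} (h : V ≤ U) (h' : W ≤ V) (m : MatSec n X U) :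
    resMat h' (resMat h m) = resMat (h'.trans h) m := by
  ext i j
  simp only [RingHom.mapMatrix_apply, Matrix.map_apply]
  rw [← CommRingCat.comp_apply, ← Functor.map_comp, ← op_comp, homOfLE_comp]

@[simp] lemma resMat_self {U : X.Opens} (h : U ≤ U) (m : MatSec n X U) :
    resMat h m = m := by
  ext i j
  simp

@[simp] lemma resMat_pullMat (f : X ⟶ Y) {V : Y.Opens} {W W' : X.Opens} (h : W ≤ f ⁻¹ᵁ V)
    (h' : W' ≤ W) (m : MatSec n Y V) :
    resMat h' (pullMat f V W h m) = pullMat f V W' (h'.trans h) m := by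
  ext i j
  simp only [RingHom.mapMatrix_apply, Matrix.map_apply]
  rw [← CommRingCat.comp_apply, Scheme.Hom.appLE_map]

@[simp] lemma pullMat_resMat (f : X ⟶ Y) {V V' : Y.Opens} {W : X.Opens} (h : V' ≤ V)
    (h' : W ≤ f ⁻¹ᵁ V') (m : MatSec n Y V) :
    pullMat f V' W h' (resMat h m) = pullMat f V W (h'.trans (f.preimage_mono h)) m := by
  ext i j
  simp only [RingHom.mapMatrix_apply, Matrix.map_apply]
  rw [← CommRingCat.comp_apply, Scheme.Hom.map_appLE]

lemma pullMat_pullMat (f : X ⟶ Y) (g : Y ⟶ Z) {U : Z.Opens} {V : Y.Opens} {W : X.Opens}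
    (h : V ≤ g ⁻¹ᵁ U) (h' : W ≤ f ⁻¹ᵁ V) (m : MatSec n Z U) :
    pullMat f V W h' (pullMat g U V h m)
      = pullMat (f ≫ g) U W (h'.trans (f.preimage_mono h)) m := by
  ext i j
  simp only [RingHom.mapMatrix_apply, Matrix.map_apply]
  rw [← CommRingCat.comp_apply, Scheme.Hom.appLE_comp_appLE]

lemma appLE_id {U V : X.Opens} (h : V ≤ U) :
    (𝟙 X : X ⟶ X).appLE U V h = X.presheaf.map (homOfLE h).op := by
  simp only [Scheme.Hom.appLE, Scheme.Hom.id_app]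
  exact Category.id_comp _

/-- A section which vanishes locally is zero. -/
lemma section_eq_zero {U : X.Opens} (s : Γ(X, U))
    (h : ∀ x ∈ U, ∃ (V : X.Opens) (h : V ≤ U), x ∈ V ∧ (X.presheaf.map (homOfLE h).op).hom s = 0) :
    s = 0 := by
  choose! V hV hx h0 using h
  refine X.IsSheaf.section_ext fun x hx' => ⟨V x, hV x hx', hx x hx', ?_⟩
  rw [map_zero]; exact h0 x hx'

end res

variable {κ : Type} [Fintype κ]

/-- A basis of `Mₙ(Γ(X, U))` whose first `d` members span, over each `V ⊆ U`, the given sections. -/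
def IsFrame (sec : ∀ U : X.Opens, Subalgebra Γ(X, U) (MatSec n X U)) (U : X.Opens)
    (β : Module.Basis (Fin d ⊕ κ) Γ(X, U) (MatSec n X U)) : Prop :=
  ∀ (V : X.Opens) (h : V ≤ U) (m : MatSec n X V),
    m ∈ sec V ↔ ∀ j, (basisMap (X.presheaf.map (homOfLE h).op).hom β).repr m (Sum.inr j) = 0

end Mold

namespace Mold
variable {n d : ℕ} {X Y Z : Scheme.{u}} {κ : Type} [Fintype κ]

lemma IsFrame.restrict {sec : ∀ U : X.Opens, Subalgebra Γ(X, U) (MatSec n X U)} {U : X.Opens}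
    {β : Module.Basis (Fin d ⊕ κ) Γ(X, U) (MatSec n X U)} (hβ : IsFrame sec U β)
    {V : X.Opens} (h : V ≤ U) :
    IsFrame sec V (basisMap (X.presheaf.map (homOfLE h).op).hom β) := by
  intro W hW m
  rw [hβ W (hW.trans h) m, basisMap_comp]
  rw [← CommRingCat.hom_comp, ← Functor.map_comp, ← op_comp, homOfLE_comp]

lemma IsFrame.mem_iff {sec : ∀ U : X.Opens, Subalgebra Γ(X, U) (MatSec n X U)} {U : X.Opens}
    {β : Module.Basis (Fin d ⊕ κ) Γ(X, U) (MatSec n X U)} (hβ : IsFrame sec U β)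
    (m : MatSec n X U) : m ∈ sec U ↔ ∀ j, β.repr m (Sum.inr j) = 0 := by
  rw [hβ U le_rfl m]
  have : (X.presheaf.map (homOfLE (le_refl U)).op).hom = RingHom.id _ := by
    have : (homOfLE (le_refl U)) = 𝟙 U := rfl
    rw [this]; simp
  rw [this, basisMap_id]

lemma eq_sum_of_repr {R : Type*} [CommRing R] (β : Module.Basis (Fin d ⊕ κ) R (Matrix (Fin n) (Fin n) R))
    {m : Matrix (Fin n) (Fin n) R} (hm : ∀ j, β.repr m (Sum.inr j) = 0) :
    m = ∑ i, β.repr m (Sum.inl i) • β (Sum.inl i) := by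
  conv_lhs => rw [← β.sum_repr m, Fintype.sum_sum_type]
  simp [hm]

lemma repr_inl_inr {ι R : Type*} [CommRing R]
    (β : Module.Basis (Fin d ⊕ ι) R (Matrix (Fin n) (Fin n) R)) (i : Fin d) (j : ι) : β.repr (β (Sum.inl i)) (Sum.inr j) = 0 := by
  classical simp

lemma repr_sub_sum {R : Type*} [CommRing R] (β : Module.Basis (Fin d ⊕ κ) R (Matrix (Fin n) (Fin n) R))
    (m : Matrix (Fin n) (Fin n) R) (c : κ → R) (j : κ) :
    β.repr (m - ∑ j, c j • β (Sum.inr j)) (Sum.inr j) = β.repr m (Sum.inr j) - c j := by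
  classical simp [Finsupp.single_apply]

lemma exists_frame (A : Mold n d X) (x : X) : ∃ U : X.Opens, x ∈ U ∧ ∃ (e : ℕ)
    (β : Module.Basis (Fin d ⊕ Fin e) Γ(X, U) (MatSec n X U)), IsFrame A.sec U β := by
  obtain ⟨U₁, hx₁, a, ha⟩ := A.locallyFree x
  obtain ⟨U₂, hx₂, e, b, hb⟩ := A.quotient_locallyFree x
  have h₁ : U₁ ⊓ U₂ ≤ U₁ := inf_le_left
  have h₂ : U₁ ⊓ U₂ ≤ U₂ := inf_le_right
  have hsum : ∀ (V : X.Opens) (h : V ≤ U₁) (c : Fin d → Γ(X, V)),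
      ∑ i, c i • resMat h (a i) ∈ A.sec V := by
    intro V h c
    refine Subalgebra.sum_mem _ fun i _ => Subalgebra.smul_mem _ ?_ _
    have : resMat h (a i) ∈ Subalgebra.toSubmodule (A.sec V) := by
      rw [← (ha V h).2]; exact Submodule.subset_span ⟨i, rfl⟩
    exact this
  have hli : LinearIndependent Γ(X, U₁ ⊓ U₂)
      (Sum.elim (fun i => resMat h₁ (a i)) (fun j => resMat h₂ (b j))) := by
    rw [Fintype.linearIndependent_iff]
    intro g hg
    rw [Fintype.sum_sum_type] at hg
    simp only [Sum.elim_inl, Sum.elim_inr] at hg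
    have hz : ∀ j, g (Sum.inr j) = 0 := by
      have h0 := (hb _ h₂ (∑ i, g (Sum.inl i) • resMat h₁ (a i))).unique
        (y₁ := fun j => - g (Sum.inr j)) (y₂ := 0) ?_ ?_
      · intro j; simpa using congrFun h0 j
      · simp only [neg_smul, Finset.sum_neg_distrib, sub_neg_eq_add]
        rw [hg]; exact zero_mem _
      · simpa using hsum _ h₁ _
    simp only [hz, zero_smul, Finset.sum_const_zero, add_zero] at hg
    have := Fintype.linearIndependent_iff.1 (ha _ h₁).1 _ hg
    rintro (i | j)
    · exact this i
    · exact hz j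
  have hsp : ⊤ ≤ Submodule.span Γ(X, U₁ ⊓ U₂) (Set.range
      (Sum.elim (fun i => resMat h₁ (a i)) (fun j => resMat h₂ (b j)))) := by
    intro m _
    obtain ⟨c, hc, -⟩ := hb _ h₂ m
    have hc' : m - ∑ j, c j • resMat h₂ (b j) ∈ Submodule.span Γ(X, U₁ ⊓ U₂)
        (Set.range fun i => resMat h₁ (a i)) := by rw [(ha _ h₁).2]; exact hc
    rw [← sub_add_cancel m (∑ j, c j • resMat h₂ (b j))]
    refine Submodule.add_mem _ (Submodule.span_mono ?_ hc') (Submodule.sum_mem _ fun j _ =>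
      Submodule.smul_mem _ _ (Submodule.subset_span ⟨Sum.inr j, rfl⟩))
    rintro _ ⟨i, rfl⟩
    exact ⟨Sum.inl i, rfl⟩
  refine ⟨U₁ ⊓ U₂, ⟨hx₁, hx₂⟩, e, Module.Basis.mk hli hsp, ?_⟩
  · intro V h m
    set β := Module.Basis.mk hli hsp
    set γ := basisMap (X.presheaf.map (homOfLE h).op).hom β with hγ
    have hl : ∀ i, γ (Sum.inl i) = resMat (h.trans h₁) (a i) := by
      intro i; rw [hγ, basisMap_apply, Module.Basis.mk_apply]; exact resMat_resMat h₁ h _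
    have hr : ∀ j, γ (Sum.inr j) = resMat (h.trans h₂) (b j) := by
      intro i; rw [hγ, basisMap_apply, Module.Basis.mk_apply]; exact resMat_resMat h₂ h _
    constructor
    · intro hm
      have h0 := (hb V (h.trans h₂) m).unique
        (y₁ := fun j => γ.repr m (Sum.inr j)) (y₂ := 0) ?_ (by simpa using hm)
      · intro j; simpa using congrFun h0 j
      · have : m - ∑ j, γ.repr m (Sum.inr j) • resMat (h.trans h₂) (b j)
            = ∑ i, γ.repr m (Sum.inl i) • resMat (h.trans h₁) (a i) := by
          conv_lhs => enter [1]; rw [← γ.sum_repr m, Fintype.sum_sum_type]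
          simp [hl, hr]
        rw [this]; exact hsum _ _ _
    · intro hm
      rw [eq_sum_of_repr γ hm]
      simp only [hl]
      exact hsum _ _ _

/-- Construct a mold from frames. -/
def ofFrames (sec : ∀ U : X.Opens, Subalgebra Γ(X, U) (MatSec n X U))
    (res_mem : ∀ {U V : X.Opens} (h : V ≤ U) {m : MatSec n X U}, m ∈ sec U → resMat h m ∈ sec V)
    (local_mem : ∀ {U : X.Opens} {m : MatSec n X U},
      (∀ x ∈ U, ∃ (V : X.Opens) (h : V ≤ U), x ∈ V ∧ resMat h m ∈ sec V) → m ∈ sec U)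
    (frame : ∀ x : X, ∃ U : X.Opens, x ∈ U ∧ ∃ (e : ℕ)
      (β : Module.Basis (Fin d ⊕ Fin e) Γ(X, U) (MatSec n X U)), IsFrame sec U β) :
    Mold n d X where
  sec := sec
  res_mem := res_mem
  local_mem := local_mem
  locallyFree x := by
    obtain ⟨U, hx, e, β, hβ⟩ := frame x
    refine ⟨U, hx, fun i => β (Sum.inl i), fun V h => ?_⟩
    have hl : ∀ i, resMat h (β (Sum.inl i)) =
      basisMap (X.presheaf.map (homOfLE h).op).hom β (Sum.inl i) := fun i => by simp
    simp only [hl]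
    refine ⟨(Module.Basis.linearIndependent _).comp _ Sum.inl_injective, ?_⟩
    apply le_antisymm
    · rw [Submodule.span_le]
      rintro _ ⟨i, rfl⟩
      exact (hβ V h _).2 fun j => repr_inl_inr _ _ _
    · intro m hm
      rw [eq_sum_of_repr _ ((hβ V h m).1 hm)]
      exact Submodule.sum_mem _ fun i _ => Submodule.smul_mem _ _ (Submodule.subset_span ⟨i, rfl⟩)
  quotient_locallyFree x := by
    obtain ⟨U, hx, e, β, hβ⟩ := frame x
    refine ⟨U, hx, e, fun j => β (Sum.inr j), fun V h m => ?_⟩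
    have hr : ∀ j, resMat h (β (Sum.inr j)) =
      basisMap (X.presheaf.map (homOfLE h).op).hom β (Sum.inr j) := fun i => by simp
    simp only [hr]
    set γ := basisMap (X.presheaf.map (homOfLE h).op).hom β
    refine ⟨fun j => γ.repr m (Sum.inr j), (hβ V h _).2 fun j => ?_, fun c hc => funext fun j => ?_⟩
    · exact (repr_sub_sum γ m _ j).trans (sub_self _)
    · have := (hβ V h _).1 hc j
      rw [repr_sub_sum, sub_eq_zero] at this
      exact this.symm

lemma ext_sec {A B : Mold n d X} (h : ∀ U m, m ∈ A.sec U ↔ m ∈ B.sec U) : A = B := by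
  have : A.sec = B.sec := by
    funext U; ext m; exact h U m
  cases A; cases B; cases this; rfl

lemma ext_local {A B : Mold n d X}
    (h : ∀ x : X, ∃ U : X.Opens, x ∈ U ∧ ∀ V ≤ U, ∀ m, m ∈ A.sec V ↔ m ∈ B.sec V) : A = B := by
  refine ext_sec fun U m => ⟨fun hm => B.local_mem fun x hx => ?_, fun hm => A.local_mem fun x hx => ?_⟩
  all_goals
    obtain ⟨W, hxW, hW⟩ := h x
    refine ⟨U ⊓ W, inf_le_left, ⟨hx, hxW⟩, ?_⟩
  · exact (hW _ inf_le_right _).1 (A.res_mem _ hm)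
  · exact (hW _ inf_le_right _).2 (B.res_mem _ hm)

lemma ext_frame {A B : Mold n d X}
    (h : ∀ x : X, ∃ U : X.Opens, x ∈ U ∧ ∃ (e : ℕ)
      (β : Module.Basis (Fin d ⊕ Fin e) Γ(X, U) (MatSec n X U)),
        IsFrame A.sec U β ∧ IsFrame B.sec U β) : A = B := by
  refine ext_local fun x => ?_
  obtain ⟨U, hx, e, β, hA, hB⟩ := h x
  exact ⟨U, hx, fun V hV m => by rw [hA V hV, hB V hV]⟩

section pullback

lemma span_pullMat_res (f : X ⟶ Y) (A : Mold n d Y) {V V' : Y.Opens} {W W' : X.Opens}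
    (h : W ≤ f ⁻¹ᵁ V) (h' : W' ≤ f ⁻¹ᵁ V') (hV : V' ≤ V) (hW : W' ≤ W) {m : MatSec n X W}
    (hm : m ∈ Submodule.span Γ(X, W) (pullMat f V W h '' (A.sec V : Set (MatSec n Y V)))) :
    resMat hW m ∈ Submodule.span Γ(X, W') (pullMat f V' W' h' '' (A.sec V' : Set (MatSec n Y V'))) := by
  induction hm using Submodule.span_induction with
  | mem m hm =>
    obtain ⟨s, hs, rfl⟩ := hm
    refine Submodule.subset_span ⟨resMat hV s, A.res_mem hV hs, ?_⟩
    rw [pullMat_resMat, resMat_pullMat]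
  | zero => rw [map_zero]; exact zero_mem _
  | add m m' _ _ h1 h2 => rw [map_add]; exact add_mem h1 h2
  | smul r m _ h1 =>
    have : resMat hW (r • m) = (X.presheaf.map (homOfLE hW).op).hom r • resMat hW m := by
      ext i j; simp
    rw [this]; exact Submodule.smul_mem _ _ h1

/-- The sections of the image of `f^*A → Mₙ(𝒪_X)`: matrices which locally are linear combinations
of pulled back sections of `A`. -/
def pullSec (f : X ⟶ Y) (A : Mold n d Y) (U : X.Opens) : Subalgebra Γ(X, U) (MatSec n X U) where
  carrier := {m | ∀ x ∈ U, ∃ (V : Y.Opens) (W : X.Opens) (hW : W ≤ U) (h : W ≤ f ⁻¹ᵁ V), x ∈ W ∧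
    resMat hW m ∈ Submodule.span Γ(X, W) (pullMat f V W h '' (A.sec V : Set (MatSec n Y V)))}
  mul_mem' := by
    intro m m' hm hm' x hx
    obtain ⟨V, W, hW, h, hxW, hmem⟩ := hm x hx
    obtain ⟨V', W', hW', h', hxW', hmem'⟩ := hm' x hx
    have hVW : W ⊓ W' ≤ f ⁻¹ᵁ (V ⊓ V') := inf_le_inf h h'
    refine ⟨V ⊓ V', W ⊓ W', inf_le_left.trans hW, hVW, ⟨hxW, hxW'⟩, ?_⟩
    have h1 := span_pullMat_res f A h hVW inf_le_left inf_le_left hmem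
    have h2 := span_pullMat_res f A h' hVW inf_le_right inf_le_right hmem'
    rw [resMat_resMat] at h1 h2
    rw [map_mul]
    have := Submodule.mul_mem_mul h1 h2
    rw [Submodule.span_mul_span] at this
    refine Submodule.span_mono ?_ this
    rintro _ ⟨_, ⟨s, hs, rfl⟩, _, ⟨t, ht, rfl⟩, rfl⟩
    exact ⟨s * t, mul_mem hs ht, map_mul _ _ _⟩
  add_mem' := by
    intro m m' hm hm' x hx
    obtain ⟨V, W, hW, h, hxW, hmem⟩ := hm x hx
    obtain ⟨V', W', hW', h', hxW', hmem'⟩ := hm' x hx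
    have hVW : W ⊓ W' ≤ f ⁻¹ᵁ (V ⊓ V') := inf_le_inf h h'
    refine ⟨V ⊓ V', W ⊓ W', inf_le_left.trans hW, hVW, ⟨hxW, hxW'⟩, ?_⟩
    have h1 := span_pullMat_res f A h hVW inf_le_left inf_le_left hmem
    have h2 := span_pullMat_res f A h' hVW inf_le_right inf_le_right hmem'
    rw [resMat_resMat] at h1 h2
    rw [map_add]
    exact add_mem h1 h2
  algebraMap_mem' := by
    intro r x hx
    refine ⟨⊤, U, le_rfl, le_top, hx, ?_⟩
    rw [resMat_self, Algebra.algebraMap_eq_smul_one]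
    exact Submodule.smul_mem _ _ (Submodule.subset_span ⟨1, one_mem _, map_one _⟩)

lemma mem_pullSec_of_mem (f : X ⟶ Y) (A : Mold n d Y) {V : Y.Opens} {W : X.Opens}
    (h : W ≤ f ⁻¹ᵁ V) {m : MatSec n Y V} (hm : m ∈ A.sec V) : pullMat f V W h m ∈ pullSec f A W :=
  fun _ hx => ⟨V, W, le_rfl, h, hx, by
    rw [resMat_self]; exact Submodule.subset_span ⟨m, hm, rfl⟩⟩

lemma pullSec_res_mem (f : X ⟶ Y) (A : Mold n d Y) {U V : X.Opens} (h : V ≤ U) {m : MatSec n X U}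
    (hm : m ∈ pullSec f A U) : resMat h m ∈ pullSec f A V := by
  intro x hx
  obtain ⟨V', W, hW, h', hxW, hmem⟩ := hm x (h hx)
  have hle : W ⊓ V ≤ f ⁻¹ᵁ V' := inf_le_left.trans h'
  refine ⟨V', W ⊓ V, inf_le_right, hle, ⟨hxW, hx⟩, ?_⟩
  have := span_pullMat_res f A h' hle le_rfl inf_le_left hmem
  rwa [resMat_resMat] at this ⊢

lemma pullSec_local_mem (f : X ⟶ Y) (A : Mold n d Y) {U : X.Opens} {m : MatSec n X U}
    (hm : ∀ x ∈ U, ∃ (V : X.Opens) (h : V ≤ U), x ∈ V ∧ resMat h m ∈ pullSec f A V) :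
    m ∈ pullSec f A U := by
  intro x hx
  obtain ⟨V, h, hxV, hV⟩ := hm x hx
  obtain ⟨V', W, hW, h', hxW, hmem⟩ := hV x hxV
  exact ⟨V', W, hW.trans h, h', hxW, by rwa [resMat_resMat] at hmem⟩

lemma isFrame_pullSec (f : X ⟶ Y) (A : Mold n d Y) {V : Y.Opens} {W : X.Opens} (h : W ≤ f ⁻¹ᵁ V)
    {β : Module.Basis (Fin d ⊕ κ) Γ(Y, V) (MatSec n Y V)} (hβ : IsFrame A.sec V β) :
    IsFrame (pullSec f A) W (basisMap (f.appLE V W h).hom β) := by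
  intro W' hW' m
  have hW'V : W' ≤ f ⁻¹ᵁ V := hW'.trans h
  rw [basisMap_comp, ← CommRingCat.hom_comp, Scheme.Hom.appLE_map]
  set γ := basisMap (f.appLE V W' hW'V).hom β with hγ
  have hmem : ∀ i, γ (Sum.inl i) ∈ pullSec f A W' := fun i => by
    rw [hγ, basisMap_apply]
    exact mem_pullSec_of_mem f A hW'V ((hβ.mem_iff _).2 fun j => by simp)
  constructor
  · intro hm j
    refine section_eq_zero _ fun x hx => ?_
    obtain ⟨V₁, W₁, hW₁, h₁, hxW₁, hmem₁⟩ := hm x hx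
    refine ⟨W₁, hW₁, hxW₁, ?_⟩
    have hle : W₁ ≤ f ⁻¹ᵁ (V₁ ⊓ V) := le_inf h₁ (hW₁.trans hW'V)
    have h2 := span_pullMat_res f A h₁ hle inf_le_left le_rfl hmem₁
    rw [resMat_resMat] at h2
    rw [← basisMap_repr, hγ, basisMap_comp, ← CommRingCat.hom_comp, Scheme.Hom.appLE_map]
    change (basisMap _ β).repr (resMat _ m) _ = 0
    generalize resMat hW₁ m = m' at h2 ⊢
    induction h2 using Submodule.span_induction with
    | mem m hm =>
      obtain ⟨s, hs, rfl⟩ := hm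
      have h3 := (hβ _ inf_le_right s).1 hs j
      have h4 := congrArg (f.appLE (V₁ ⊓ V) W₁ hle).hom h3
      rw [← basisMap_repr, basisMap_comp, ← CommRingCat.hom_comp, Scheme.Hom.map_appLE, map_zero] at h4
      exact h4
    | zero => simp
    | add m m' _ _ h1 h2 => rw [map_add, Finsupp.add_apply, h1, h2, add_zero]
    | smul r m _ h1 => rw [map_smul, Finsupp.smul_apply, h1, smul_zero]
  · intro hm
    rw [eq_sum_of_repr γ hm]
    exact Subalgebra.sum_mem _ fun i _ => Subalgebra.smul_mem _ (hmem i) _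

/-- The pullback `f^*A ⊆ Mₙ(𝒪_X)` of a mold along a morphism of schemes `f : X ⟶ Y`. -/
def pull (f : X ⟶ Y) (A : Mold n d Y) : Mold n d X :=
  ofFrames (pullSec f A) (pullSec_res_mem f A) (pullSec_local_mem f A) fun x => by
    obtain ⟨V, hx, e, β, hβ⟩ := A.exists_frame (f x)
    exact ⟨f ⁻¹ᵁ V, hx, e, _, isFrame_pullSec f A le_rfl hβ⟩

lemma isFrame_pull (f : X ⟶ Y) (A : Mold n d Y) {V : Y.Opens} {W : X.Opens} (h : W ≤ f ⁻¹ᵁ V)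
    {β : Module.Basis (Fin d ⊕ κ) Γ(Y, V) (MatSec n Y V)} (hβ : IsFrame A.sec V β) :
    IsFrame (pull f A).sec W (basisMap (f.appLE V W h).hom β) :=
  isFrame_pullSec f A h hβ

lemma pull_mem (f : X ⟶ Y) (A : Mold n d Y) {V : Y.Opens} {W : X.Opens}
    (h : W ≤ f ⁻¹ᵁ V) {m : MatSec n Y V} (hm : m ∈ A.sec V) :
    pullMat f V W h m ∈ (pull f A).sec W :=
  mem_pullSec_of_mem f A h hm

lemma pull_id (A : Mold n d X) : pull (𝟙 X) A = A := by
  refine ext_frame fun x => ?_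
  obtain ⟨V, hx, e, β, hβ⟩ := A.exists_frame x
  refine ⟨V, hx, e, β, ?_, hβ⟩
  have := isFrame_pull (𝟙 X) A (W := V) le_rfl hβ
  rwa [show (𝟙 X : X ⟶ X).appLE V V le_rfl = 𝟙 _ from by
    rw [appLE_id]; exact X.presheaf.map_id _, CommRingCat.hom_id, basisMap_id] at this

lemma pull_comp (f : X ⟶ Y) (g : Y ⟶ Z) (A : Mold n d Z) :
    pull (f ≫ g) A = pull f (pull g A) := by
  refine ext_frame fun x => ?_
  obtain ⟨V, hx, e, β, hβ⟩ := A.exists_frame (g (f x))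
  refine ⟨f ⁻¹ᵁ (g ⁻¹ᵁ V), hx, e, _, isFrame_pull (f ≫ g) A le_rfl hβ, ?_⟩
  have := isFrame_pull f (pull g A) (W := f ⁻¹ᵁ (g ⁻¹ᵁ V)) le_rfl
    (isFrame_pull g A (W := g ⁻¹ᵁ V) le_rfl hβ)
  rwa [basisMap_comp, ← CommRingCat.hom_comp, Scheme.Hom.appLE_comp_appLE] at this

end pullback

end Mold

/-- The contravariant functor sending a scheme `X` to the set of molds of degree `n` and rank `d` on
`X`, and a morphism to pullback of molds. -/
def moldFunctor (n d : ℕ) : Scheme.{u}ᵒᵖ ⥤ Type u where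
  obj X := Mold n d X.unop
  map f := ↾ fun A => A.pull f.unop
  map_id X := by ext A; exact Mold.pull_id A
  map_comp f g := by ext A; exact Mold.pull_comp _ _ A

namespace Mold
variable {n d : ℕ} {X Y Z : Scheme.{u}} {κ : Type} [Fintype κ]

lemma appLE_injective (f : X ⟶ Y) [IsOpenImmersion f] {V : Y.Opens} (hV : V ≤ f.opensRange) :
    Function.Injective (f.appLE V (f ⁻¹ᵁ V) le_rfl).hom := by
  have := f.isIso_app V hV
  rw [Scheme.Hom.appLE_eq_app]
  exact (ConcreteCategory.bijective_of_isIso (f.app V)).1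

lemma pull_mem_iff (f : X ⟶ Y) [IsOpenImmersion f] (A : Mold n d Y) {V : Y.Opens}
    (hV : V ≤ f.opensRange) (m : MatSec n Y V) :
    pullMat f V (f ⁻¹ᵁ V) le_rfl m ∈ (pull f A).sec (f ⁻¹ᵁ V) ↔ m ∈ A.sec V := by
  refine ⟨fun hm => A.local_mem fun y hy => ?_, pull_mem f A le_rfl⟩
  obtain ⟨N, hyN, e, β, hβ⟩ := A.exists_frame y
  refine ⟨V ⊓ N, inf_le_left, ⟨hy, hyN⟩, ?_⟩
  have hfr := isFrame_pull f A (W := f ⁻¹ᵁ (V ⊓ N)) (f.preimage_mono inf_le_right) hβ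
  have hm' := (pull f A).res_mem (f.preimage_mono inf_le_left : f ⁻¹ᵁ (V ⊓ N) ≤ _) hm
  rw [hfr.mem_iff, resMat_pullMat] at hm'
  rw [hβ _ inf_le_right]
  intro j
  apply appLE_injective f (inf_le_left.trans hV : V ⊓ N ≤ _)
  rw [map_zero, ← basisMap_repr, basisMap_comp, ← CommRingCat.hom_comp, Scheme.Hom.map_appLE]
  have := pullMat_resMat f (inf_le_left : V ⊓ N ≤ V) (W := f ⁻¹ᵁ (V ⊓ N)) le_rfl m
  exact (congrArg (fun z => (basisMap _ β).repr z (Sum.inr j)) this).trans (hm' j)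

lemma mapMatrix_algebraMap {R S : Type*} [CommRing R] [CommRing S] (φ : R →+* S) (r : R) :
    φ.mapMatrix (algebraMap R (Matrix (Fin n) (Fin n) R) r) = algebraMap S _ (φ r) := by
  ext a b
  simp only [RingHom.mapMatrix_apply, Matrix.map_apply, Matrix.algebraMap_matrix_apply]
  split_ifs <;> simp

section glue
variable {ι : Type*} {U : ι → Scheme.{u}} (f : ∀ i, U i ⟶ X) (A : ∀ i, Mold n d (U i))

/-- Sections of `Mₙ(𝒪_X)` whose restriction to each `U i` belongs to `A i`. -/
def glueSec (V : X.Opens) : Subalgebra Γ(X, V) (MatSec n X V) where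
  carrier := {m | ∀ i, pullMat (f i) V (f i ⁻¹ᵁ V) le_rfl m ∈ (A i).sec (f i ⁻¹ᵁ V)}
  mul_mem' h h' i := by rw [map_mul]; exact mul_mem (h i) (h' i)
  add_mem' h h' i := by rw [map_add]; exact add_mem (h i) (h' i)
  algebraMap_mem' r i := by
    rw [mapMatrix_algebraMap]; exact Subalgebra.algebraMap_mem _ _

lemma isFrame_glueSec [∀ i, IsOpenImmersion (f i)]
    (hA : ∀ i j, pull (pullback.fst (f i) (f j)) (A i) = pull (pullback.snd (f i) (f j)) (A j))
    (i : ι) {U' : (U i).Opens}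
    {β : Module.Basis (Fin d ⊕ κ) Γ(U i, U') (MatSec n (U i) U')} (hβ : IsFrame (A i).sec U' β) :
    IsFrame (glueSec f A) (f i ''ᵁ U') (basisMap ((f i).appIso U').inv.hom β) := by
  intro V hV m
  set γ := basisMap (X.presheaf.map (homOfLE hV).op).hom (basisMap ((f i).appIso U').inv.hom β) with hγ
  have hVU : f i ⁻¹ᵁ V ≤ U' := ((f i).preimage_mono hV).trans ((f i).preimage_image_eq U').le
  have hγβ : basisMap ((f i).appLE V (f i ⁻¹ᵁ V) le_rfl).hom γ
      = basisMap ((U i).presheaf.map (homOfLE hVU).op).hom β := by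
    rw [hγ, basisMap_comp, basisMap_comp, ← CommRingCat.hom_comp, ← CommRingCat.hom_comp,
      Scheme.Hom.map_appLE, Scheme.Hom.appIso_inv_appLE]
  have hinj := appLE_injective (f i) (hV.trans ((f i).image_le_opensRange U'))
  have hi : pullMat (f i) V (f i ⁻¹ᵁ V) le_rfl m ∈ (A i).sec (f i ⁻¹ᵁ V) ↔
      ∀ j, γ.repr m (Sum.inr j) = 0 := by
    rw [hβ _ hVU, ← hγβ]
    refine forall_congr' fun j => ?_
    rw [basisMap_repr]
    exact map_eq_zero_iff _ hinj
  rw [← hi]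
  refine ⟨fun h => h i, fun h j => ?_⟩
  refine (A j).local_mem fun y hy => ?_
  set p := pullback.fst (f i) (f j) with hp
  set q := pullback.snd (f i) (f j) with hq
  have hpq : p ≫ f i = q ≫ f j := pullback.condition
  have hyq : y ∈ q.opensRange := by
    have := (Scheme.Hom.opensRange_pullbackSnd (f i) (f j)).ge
    refine this ?_
    exact (f i).image_le_opensRange U' (hV hy)
  refine ⟨f j ⁻¹ᵁ V ⊓ q.opensRange, inf_le_left, ⟨hy, hyq⟩, ?_⟩
  rw [← pull_mem_iff q (A j) inf_le_right, ← hA i j, pullMat_resMat, pullMat_pullMat]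
  have hle : q ⁻¹ᵁ (f j ⁻¹ᵁ V ⊓ q.opensRange) ≤ p ⁻¹ᵁ (f i ⁻¹ᵁ V) := by
    refine (q.preimage_mono inf_le_left).trans ?_
    rw [← Scheme.Hom.comp_preimage, ← Scheme.Hom.comp_preimage, hpq]
  have := pull_mem p (A i) hle h
  rw [pullMat_pullMat] at this
  convert this using 3
  simp only [hpq]

/-- Gluing of molds along an open covering. -/
def glue [∀ i, IsOpenImmersion (f i)]
    (hA : ∀ i j, pull (pullback.fst (f i) (f j)) (A i) = pull (pullback.snd (f i) (f j)) (A j))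
    (hf : ∀ x : X, ∃ i, x ∈ (f i).opensRange) : Mold n d X :=
  ofFrames (glueSec f A)
    (fun {V W} h m hm i => by
      have := (A i).res_mem ((f i).preimage_mono h) (hm i)
      rw [resMat_pullMat] at this
      rwa [pullMat_resMat])
    (fun {V m} hm i => (A i).local_mem fun y hy => by
      obtain ⟨W, hW, hyW, hmW⟩ := hm (f i y) hy
      refine ⟨f i ⁻¹ᵁ W, (f i).preimage_mono hW, hyW, ?_⟩
      have := hmW i
      rw [pullMat_resMat] at this
      rwa [resMat_pullMat])
    (fun x => by
      obtain ⟨i, y, rfl⟩ := hf x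
      obtain ⟨U', hy, e, β, hβ⟩ := (A i).exists_frame y
      exact ⟨f i ''ᵁ U', ⟨y, hy, rfl⟩, e, _, isFrame_glueSec f A hA i hβ⟩)

lemma pull_glue [∀ i, IsOpenImmersion (f i)]
    (hA : ∀ i j, pull (pullback.fst (f i) (f j)) (A i) = pull (pullback.snd (f i) (f j)) (A j))
    (hf : ∀ x : X, ∃ i, x ∈ (f i).opensRange) (i : ι) : pull (f i) (glue f A hA hf) = A i := by
  refine ext_frame fun y => ?_
  obtain ⟨U', hy, e, β, hβ⟩ := (A i).exists_frame y
  refine ⟨U', hy, e, β, ?_, hβ⟩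
  have := isFrame_pull (f i) (glue f A hA hf) (W := U') ((f i).preimage_image_eq U').ge
    (isFrame_glueSec f A hA i hβ)
  rw [basisMap_comp, ← CommRingCat.hom_comp, Scheme.Hom.appIso_inv_appLE] at this
  rwa [show (U i).presheaf.map (homOfLE (le_refl U')).op = 𝟙 _ from (U i).presheaf.map_id _,
    CommRingCat.hom_id, basisMap_id] at this

lemma ext_cover [∀ i, IsOpenImmersion (f i)] (hf : ∀ x : X, ∃ i, x ∈ (f i).opensRange)
    {B C : Mold n d X} (h : ∀ i, pull (f i) B = pull (f i) C) : B = C := by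
  refine ext_local fun x => ?_
  obtain ⟨i, hi⟩ := hf x
  exact ⟨(f i).opensRange, hi, fun V hV m => by
    rw [← pull_mem_iff (f i) B hV, ← pull_mem_iff (f i) C hV, h i]⟩

end glue
end Mold

lemma moldFunctor_isSheaf (n d : ℕ) :
    Presheaf.IsSheaf Scheme.zariskiTopology (moldFunctor.{u} n d) := by
  rw [isSheaf_iff_isSheaf_of_type, Scheme.zariskiTopology,
    Precoverage.isSheaf_toGrothendieck_iff_of_isStableUnderBaseChange]
  rintro Y S hS x hx
  obtain ⟨(𝓤 : Scheme.OpenCover Y), rfl⟩ := Scheme.exists_cover_of_mem_pretopology hS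
  have hf : ∀ y : Y, ∃ i, y ∈ (𝓤.f i).opensRange := fun y => by
    obtain ⟨i, z, hz⟩ := 𝓤.exists_eq y
    exact ⟨i, z, hz⟩
  refine ⟨Mold.glue 𝓤.f (fun i => x (𝓤.f i) (.mk i)) (fun i j => ?_) hf, ?_, ?_⟩
  · apply hx
    exact Limits.pullback.condition
  · rintro Z e ⟨j⟩
    exact Mold.pull_glue 𝓤.f _ _ hf j
  · intro B hB
    refine Mold.ext_cover 𝓤.f hf fun i => ?_
    exact (hB (𝓤.f i) (.mk i)).trans
      (Mold.pull_glue 𝓤.f (fun i => x (𝓤.f i) (.mk i)) _ hf i).symm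

namespace Mold
variable {n d : ℕ}

section algebra
variable {R S : Type*} [CommRing R] [CommRing S] (I : Fin d ↪ Fin n × Fin n)

/-- `a` is a basis of a subalgebra of `Mₙ(R)`, normalised with respect to the coordinates in `I`. -/
structure IsChart (a : Fin d → Matrix (Fin n) (Fin n) R) : Prop where
  norm : ∀ i j, a i (I j).1 (I j).2 = if i = j then 1 else 0
  one : (1 : Matrix (Fin n) (Fin n) R) =
    ∑ k, (1 : Matrix (Fin n) (Fin n) R) (I k).1 (I k).2 • a k
  mul : ∀ i j, a i * a j = ∑ k, (a i * a j) (I k).1 (I k).2 • a k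

variable {I} {a : Fin d → Matrix (Fin n) (Fin n) R}

lemma mapMatrix_smul (φ : R →+* S) (r : R) (m : Matrix (Fin n) (Fin n) R) :
    φ.mapMatrix (r • m) = φ r • φ.mapMatrix m := by
  ext; simp

lemma IsChart.map (h : IsChart I a) (φ : R →+* S) : IsChart I (fun i => φ.mapMatrix (a i)) where
  norm i j := by simp [h.norm, apply_ite φ]
  one := by
    have := congrArg φ.mapMatrix h.one
    rw [map_one, map_sum] at this
    simp_rw [mapMatrix_smul] at this
    conv_lhs => rw [this]
    refine Finset.sum_congr rfl fun k _ => ?_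
    congr 1
    simp [Matrix.one_apply, apply_ite φ]
  mul i j := by
    have := congrArg φ.mapMatrix (h.mul i j)
    rw [map_mul, map_sum] at this
    simp_rw [mapMatrix_smul] at this
    conv_lhs => rw [this]
    refine Finset.sum_congr rfl fun k _ => ?_
    congr 1
    rw [← map_mul]; rfl

/-- The subalgebra spanned by a chart tuple. -/
def IsChart.subalg (h : IsChart I a) : Subalgebra R (Matrix (Fin n) (Fin n) R) where
  carrier := {m | m = ∑ k, m (I k).1 (I k).2 • a k}
  mul_mem' := by
    intro x y hx hy
    have : ∀ c : Fin d → R, ∀ m, m = ∑ k, c k • a k → m = ∑ k, m (I k).1 (I k).2 • a k := by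
      intro c m hm
      have hc : ∀ k, m (I k).1 (I k).2 = c k := by
        intro k; rw [hm]; simp [Matrix.sum_apply, h.norm]
      simp_rw [hc]; exact hm
    refine this (fun k => ∑ i, ∑ j, (x (I i).1 (I i).2 * y (I j).1 (I j).2) *
      (a i * a j) (I k).1 (I k).2) _ ?_
    conv_lhs => rw [show x = _ from hx, show y = _ from hy]
    simp_rw [Finset.sum_mul_sum, Finset.sum_smul]
    rw [Finset.sum_comm (s := Finset.univ (α := Fin d))]
    conv_rhs => rw [Finset.sum_comm]
    conv_lhs => rw [Finset.sum_comm]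
    refine Finset.sum_congr rfl fun i _ => ?_
    conv_rhs => rw [Finset.sum_comm]
    refine Finset.sum_congr rfl fun j _ => ?_
    rw [smul_mul_smul_comm, h.mul i j, Finset.smul_sum]
    simp_rw [smul_smul]
    rw [← h.mul i j]
  add_mem' := by
    intro x y hx hy
    change x + y = _
    conv_lhs => rw [show x = _ from hx, show y = _ from hy]
    simp [add_smul, Finset.sum_add_distrib]
  algebraMap_mem' := by
    intro r
    change algebraMap R _ r = _
    rw [Algebra.algebraMap_eq_smul_one]
    conv_lhs => rw [h.one]
    simp [Finset.smul_sum, smul_smul]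

lemma IsChart.mem_subalg (h : IsChart I a) (m : Matrix (Fin n) (Fin n) R) :
    m ∈ h.subalg ↔ m = ∑ k, m (I k).1 (I k).2 • a k := Iff.rfl

lemma IsChart.self_mem (h : IsChart I a) (i : Fin d) : a i ∈ h.subalg := by
  rw [mem_subalg]; simp [h.norm]

variable (I) in
/-- The complementary coordinates. -/
noncomputable def coEquiv : Fin (Fintype.card {p : Fin n × Fin n // p ∉ Set.range I}) ≃
    {p : Fin n × Fin n // p ∉ Set.range I} :=
  (Fintype.equivFin _).symm

/-- The basis of `Mₙ(R)` consisting of `a` and the remaining elementary matrices. -/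
noncomputable def chartBasis (h : IsChart I a) :
    Module.Basis (Fin d ⊕ Fin (Fintype.card {p : Fin n × Fin n // p ∉ Set.range I})) R
      (Matrix (Fin n) (Fin n) R) :=
  Module.Basis.ofEquivFun
    { toFun := fun m => Sum.elim (fun k => m (I k).1 (I k).2)
        (fun j => m (coEquiv I j).1.1 (coEquiv I j).1.2 -
          ∑ k, m (I k).1 (I k).2 * a k (coEquiv I j).1.1 (coEquiv I j).1.2)
      invFun := fun c => ∑ k, c (Sum.inl k) • a k +
        ∑ j, c (Sum.inr j) • Matrix.single (coEquiv I j).1.1 (coEquiv I j).1.2 1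
      map_add' := fun m m' => by
        ext (k | j)
        · simp
        · simp [add_mul, Finset.sum_add_distrib]; ring
      map_smul' := fun r m => by
        ext (k | j)
        · simp
        · simp [mul_sub, Finset.mul_sum, mul_assoc]
      left_inv := fun m => by
        ext p q
        by_cases hpq : (p, q) ∈ Set.range I
        · obtain ⟨k, hk⟩ := hpq
          obtain rfl : (I k).1 = p := by rw [hk]
          obtain rfl : (I k).2 = q := by rw [hk]
          have : ∀ j, Matrix.single (coEquiv I j).1.1 (coEquiv I j).1.2 (1 : R) (I k).1 (I k).2 = 0 := by
            intro j
            rw [Matrix.single_apply, if_neg]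
            rintro ⟨h1, h2⟩
            exact (coEquiv I j).2 ⟨k, (Prod.ext h1 h2).symm⟩
          simp [Matrix.sum_apply, h.norm, this, -Matrix.smul_single]
        · obtain ⟨j, hj⟩ := (coEquiv I).surjective ⟨(p, q), hpq⟩
          have : ∀ j', Matrix.single (coEquiv I j').1.1 (coEquiv I j').1.2 (1 : R) p q
              = if j' = j then 1 else 0 := by
            intro j'
            rw [Matrix.single_apply]
            congr 1
            rw [← (coEquiv I).injective.eq_iff, hj, Subtype.ext_iff, Prod.ext_iff]
          simp only [Matrix.add_apply, Matrix.sum_apply, Matrix.smul_apply, Sum.elim_inl, Sum.elim_inr,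
            this, smul_eq_mul, mul_ite, mul_one, mul_zero, Finset.sum_ite_eq', Finset.mem_univ,
            if_true, hj]
          ring
      right_inv := fun c => by
        have hI : ∀ j k, Matrix.single (coEquiv I j).1.1 (coEquiv I j).1.2 (1 : R) (I k).1 (I k).2 = 0 := by
          intro j k
          rw [Matrix.single_apply, if_neg]
          rintro ⟨h1, h2⟩
          exact (coEquiv I j).2 ⟨k, (Prod.ext h1 h2).symm⟩
        have hJ : ∀ j' j, Matrix.single (coEquiv I j').1.1 (coEquiv I j').1.2 (1 : R)
            (coEquiv I j).1.1 (coEquiv I j).1.2 = if j' = j then 1 else 0 := by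
          intro j' j
          rw [Matrix.single_apply]
          congr 1
          rw [← (coEquiv I).injective.eq_iff, Subtype.ext_iff, Prod.ext_iff]
        ext (k | j)
        · simp [Matrix.sum_apply, h.norm, hI, -Matrix.smul_single]
        · simp [Matrix.sum_apply, h.norm, hI, hJ, -Matrix.smul_single] }

lemma chartBasis_inl (h : IsChart I a) (k : Fin d) : chartBasis h (Sum.inl k) = a k := by
  rw [chartBasis, Module.Basis.coe_ofEquivFun]
  simp [Pi.single_apply]

lemma chartBasis_inr (h : IsChart I a) (j) : chartBasis h (Sum.inr j) =
    Matrix.single (coEquiv I j).1.1 (coEquiv I j).1.2 1 := by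
  rw [chartBasis, Module.Basis.coe_ofEquivFun]
  simp [Pi.single_apply, -Matrix.smul_single]

lemma mem_subalg_iff_repr (h : IsChart I a) (m : Matrix (Fin n) (Fin n) R) :
    m ∈ h.subalg ↔ ∀ j, (chartBasis h).repr m (Sum.inr j) = 0 := by
  constructor
  · intro hm j
    rw [show m = ∑ k, _ from hm]
    simp only [← chartBasis_inl h, map_sum, map_smul, Finsupp.coe_finsetSum, Finset.sum_apply,
      Finsupp.smul_apply, repr_inl_inr, smul_zero, Finset.sum_const_zero]
  · intro hm
    rw [eq_sum_of_repr _ hm]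
    refine Subalgebra.sum_mem _ fun i _ => Subalgebra.smul_mem _ ?_ _
    rw [chartBasis_inl]; exact h.self_mem i

lemma basisMap_chartBasis (h : IsChart I a) (φ : R →+* S) :
    basisMap φ (chartBasis h) = chartBasis (h.map φ) := by
  refine Module.Basis.eq_of_apply_eq ?_
  rintro (k | j)
  · rw [basisMap_apply, chartBasis_inl, chartBasis_inl]
  · rw [basisMap_apply, chartBasis_inr, chartBasis_inr]
    ext; simp [Matrix.single_apply, apply_ite φ]

end algebra

section geometry
variable {X Y : Scheme.{u}} {I : Fin d ↪ Fin n × Fin n}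

lemma chart_local {U : X.Opens} {a : Fin d → MatSec n X U}
    (h : ∀ x ∈ U, ∃ (V : X.Opens) (hV : V ≤ U), x ∈ V ∧ IsChart I (fun i => resMat hV (a i))) :
    IsChart I a := by
  have key : ∀ m m' : MatSec n X U, (∀ (V : X.Opens) (hV : V ≤ U),
      IsChart I (fun i => resMat hV (a i)) → resMat hV m = resMat hV m') → m = m' := by
    intro m m' hm
    ext p q
    rw [← sub_eq_zero]
    refine section_eq_zero _ fun x hx => ?_
    obtain ⟨V, hV, hxV, hc⟩ := h x hx
    refine ⟨V, hV, hxV, ?_⟩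
    rw [map_sub, sub_eq_zero]
    exact congrFun (congrFun (hm V hV hc) p) q
  refine ⟨fun i j => ?_, key _ _ fun V hV hc => ?_, fun i j => key _ _ fun V hV hc => ?_⟩
  · rw [← sub_eq_zero]
    refine section_eq_zero _ fun x hx => ?_
    obtain ⟨V, hV, hxV, hc⟩ := h x hx
    refine ⟨V, hV, hxV, ?_⟩
    rw [map_sub, sub_eq_zero]
    refine (hc.norm i j).trans ?_
    split_ifs <;> simp
  · rw [map_one, map_sum]
    simp_rw [mapMatrix_smul]
    refine hc.one.trans (Finset.sum_congr rfl fun k _ => ?_)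
    congr 1
    rw [Matrix.one_apply, Matrix.one_apply]
    split_ifs <;> simp
  · rw [map_mul, map_sum]
    simp_rw [mapMatrix_smul]
    refine (hc.mul i j).trans (Finset.sum_congr rfl fun k _ => ?_)
    congr 1
    rw [← map_mul]; rfl

/-- The mold with a given global normalised basis. -/
def ofChart (a : Fin d → MatSec n X ⊤) (h : IsChart I a) : Mold n d X :=
  ofFrames (fun V => (h.map (X.presheaf.map (homOfLE (le_top : V ≤ ⊤)).op).hom).subalg)
    (fun {U V} hVU m hm => by
      rw [IsChart.mem_subalg] at hm ⊢
      have := congrArg (resMat hVU) hm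
      rw [map_sum] at this
      simp_rw [mapMatrix_smul] at this
      refine this.trans (Finset.sum_congr rfl fun k _ => ?_)
      congr 1
      exact resMat_resMat _ _ _)
    (fun {U m} hm => by
      rw [IsChart.mem_subalg]
      ext p q
      rw [← sub_eq_zero]
      refine section_eq_zero _ fun x hx => ?_
      obtain ⟨V, hV, hxV, hc⟩ := hm x hx
      refine ⟨V, hV, hxV, ?_⟩
      rw [map_sub, sub_eq_zero]
      rw [IsChart.mem_subalg] at hc
      refine (congrFun (congrFun hc p) q).trans ?_
      change _ = (resMat hV (∑ k, m (I k).1 (I k).2 • resMat le_top (a k))) p q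
      rw [map_sum]
      simp_rw [mapMatrix_smul, resMat_resMat]
      rfl)
    (fun x => ⟨⊤, trivial, _, chartBasis h, fun V hV m => by
      rw [basisMap_chartBasis]
      exact mem_subalg_iff_repr _ m⟩)

lemma ofChart_mem (a : Fin d → MatSec n X ⊤) (h : IsChart I a) (V : X.Opens) (m : MatSec n X V) :
    m ∈ (ofChart a h).sec V ↔ m = ∑ k, m (I k).1 (I k).2 • resMat le_top (a k) := Iff.rfl

lemma isFrame_ofChart (a : Fin d → MatSec n X ⊤) (h : IsChart I a) :
    IsFrame (ofChart a h).sec ⊤ (chartBasis h) := fun V hV m => by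
  rw [basisMap_chartBasis]
  exact mem_subalg_iff_repr _ m

lemma pull_ofChart (f : X ⟶ Y) (a : Fin d → MatSec n Y ⊤) (h : IsChart I a) :
    pull f (ofChart a h) = ofChart (fun i => pullMat f ⊤ ⊤ le_top (a i)) (h.map _) := by
  refine ext_frame fun x => ⟨⊤, trivial, _, _, isFrame_pull f _ le_top (isFrame_ofChart a h), ?_⟩
  rw [basisMap_chartBasis]
  exact isFrame_ofChart _ _

lemma ofChart_injective {a b : Fin d → MatSec n X ⊤} (ha : IsChart I a) (hb : IsChart I b)
    (h : ofChart a ha = ofChart b hb) : a = b := by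
  funext i
  have : a i ∈ (ofChart b hb).sec ⊤ := by
    rw [← h, ofChart_mem]
    simp only [resMat_self, ha.norm]
    simp
  rw [ofChart_mem] at this
  simp only [resMat_self, ha.norm] at this
  simpa using this

end geometry
end Mold

namespace Mold
variable {n d : ℕ}

section ring
variable {R S : Type u} [CommRing R] [CommRing S] (I : Fin d ↪ Fin n × Fin n)

/-- Evaluation of polynomials in the entries of `d` matrices. -/
noncomputable def tupleEval (a : Fin d → Matrix (Fin n) (Fin n) R) :
    MvPolynomial (Fin d × Fin n × Fin n) (ULift.{u} ℤ) →+* R :=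
  MvPolynomial.eval₂Hom ((Int.castRingHom R).comp ULift.ringEquiv.toRingHom)
    (fun t => a t.1 t.2.1 t.2.2)

lemma ulift_int_hom_ext (f g : ULift.{u} ℤ →+* R) : f = g := by
  have : f.comp ULift.ringEquiv.symm.toRingHom = g.comp ULift.ringEquiv.symm.toRingHom :=
    RingHom.ext_int _ _
  ext x
  exact congrArg (fun h => h x.down) this

lemma tuple_hom_ext {f g : MvPolynomial (Fin d × Fin n × Fin n) (ULift.{u} ℤ) →+* R}
    (h : ∀ t, f (MvPolynomial.X t) = g (MvPolynomial.X t)) : f = g :=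
  MvPolynomial.ringHom_ext' (ulift_int_hom_ext _ _) h

/-- The polynomials vanishing at all chart tuples. -/
noncomputable def chartIdeal : Ideal (MvPolynomial (Fin d × Fin n × Fin n) (ULift.{u} ℤ)) where
  carrier := {p | ∀ (R : CommRingCat.{u}) (a : Fin d → Matrix (Fin n) (Fin n) R),
    IsChart I a → tupleEval a p = 0}
  add_mem' h h' R a ha := by rw [map_add, h R a ha, h' R a ha, add_zero]
  zero_mem' R a ha := map_zero _
  smul_mem' c p h R a ha := by rw [smul_eq_mul, map_mul, h R a ha, mul_zero]

/-- The coordinate ring of a chart. -/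
def ChartRing : Type u :=
  MvPolynomial (Fin d × Fin n × Fin n) (ULift.{u} ℤ) ⧸ chartIdeal.{u} I

noncomputable instance : CommRing (ChartRing.{u} I) :=
  inferInstanceAs (CommRing (MvPolynomial (Fin d × Fin n × Fin n) (ULift.{u} ℤ) ⧸ chartIdeal.{u} I))

noncomputable def chartMk : MvPolynomial (Fin d × Fin n × Fin n) (ULift.{u} ℤ) →+* ChartRing.{u} I :=
  Ideal.Quotient.mk (chartIdeal.{u} I)

lemma chartMk_eq {p q : MvPolynomial (Fin d × Fin n × Fin n) (ULift.{u} ℤ)} (h : p - q ∈ chartIdeal.{u} I) :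
    chartMk I p = chartMk I q := Ideal.Quotient.eq.2 h

noncomputable def genericPoly (i : Fin d) :
    Matrix (Fin n) (Fin n) (MvPolynomial (Fin d × Fin n × Fin n) (ULift.{u} ℤ)) :=
  Matrix.of fun p q => MvPolynomial.X (i, p, q)

noncomputable def genericTuple (i : Fin d) : Matrix (Fin n) (Fin n) (ChartRing.{u} I) :=
  (chartMk I).mapMatrix (genericPoly i)

lemma tupleEval_genericPoly (a : Fin d → Matrix (Fin n) (Fin n) R) (i : Fin d) :
    (tupleEval a).mapMatrix (genericPoly i) = a i := by
  ext p q
  simp [tupleEval, genericPoly]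

lemma isChart_of_relations {Q : Type u} [CommRing Q]
    (π : MvPolynomial (Fin d × Fin n × Fin n) (ULift.{u} ℤ) →+* Q)
    (key : ∀ p q : MvPolynomial (Fin d × Fin n × Fin n) (ULift.{u} ℤ),
      (∀ (R : CommRingCat.{u}) (a : Fin d → Matrix (Fin n) (Fin n) R), IsChart I a →
        tupleEval a p = tupleEval a q) → π p = π q) :
    IsChart I (fun i => π.mapMatrix (genericPoly.{u} i)) := by
  have keyM : ∀ p q : Matrix (Fin n) (Fin n) (MvPolynomial (Fin d × Fin n × Fin n) (ULift.{u} ℤ)),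
      (∀ (R : CommRingCat.{u}) (a : Fin d → Matrix (Fin n) (Fin n) R), IsChart I a →
        (tupleEval a).mapMatrix p = (tupleEval a).mapMatrix q) →
      π.mapMatrix p = π.mapMatrix q := by
    intro p q h
    ext i j
    exact key _ _ fun R a ha => congrFun (congrFun (h R a ha) i) j
  refine ⟨fun i j => ?_, ?_, fun i j => ?_⟩
  · have := key (genericPoly i (I j).1 (I j).2) (if i = j then 1 else 0) fun R a ha => by
      have h := congrFun (congrFun (tupleEval_genericPoly a i) (I j).1) (I j).2
      refine h.trans ?_
      rw [ha.norm]; split_ifs <;> simp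
    refine Eq.trans this ?_
    split_ifs <;> simp
  · have := keyM 1 (∑ k, (1 : Matrix (Fin n) (Fin n) (MvPolynomial (Fin d × Fin n × Fin n) (ULift.{u} ℤ))) (I k).1 (I k).2 • genericPoly k)
      fun R a ha => by
        rw [map_one, map_sum]
        simp_rw [mapMatrix_smul, tupleEval_genericPoly]
        refine ha.one.trans (Finset.sum_congr rfl fun k _ => ?_)
        rw [Matrix.one_apply, Matrix.one_apply, apply_ite (tupleEval a), map_one, map_zero]
    rw [map_one, map_sum] at this
    simp_rw [mapMatrix_smul] at this
    refine this.trans (Finset.sum_congr rfl fun k _ => ?_)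
    rw [Matrix.one_apply, Matrix.one_apply, apply_ite π, map_one, map_zero]
  · have := keyM (genericPoly i * genericPoly j)
      (∑ k, (genericPoly i * genericPoly j : Matrix (Fin n) (Fin n) (MvPolynomial (Fin d × Fin n × Fin n) (ULift.{u} ℤ))) (I k).1 (I k).2 •
        genericPoly k)
      fun R a ha => by
        rw [map_mul, map_sum]
        simp_rw [mapMatrix_smul, tupleEval_genericPoly]
        refine (ha.mul i j).trans (Finset.sum_congr rfl fun k _ => ?_)
        congr 1
        conv_lhs => rw [← tupleEval_genericPoly a i, ← tupleEval_genericPoly a j, ← map_mul]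
        rfl
    rw [map_mul, map_sum] at this
    simp_rw [mapMatrix_smul] at this
    refine this.trans (Finset.sum_congr rfl fun k _ => ?_)
    congr 1
    rw [← map_mul]; rfl

lemma isChart_genericTuple : IsChart I (genericTuple.{u} (n := n) I) := by
  refine isChart_of_relations I (chartMk I) fun p q h => chartMk_eq I ?_
  intro R a ha
  rw [map_sub, h R a ha, sub_self]

variable {I}

noncomputable def chartLift {a : Fin d → Matrix (Fin n) (Fin n) R} (h : IsChart I a) :
    ChartRing.{u} I →+* R :=
  Ideal.Quotient.lift _ (tupleEval a) fun _ hp => hp (CommRingCat.of R) a h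

lemma chartLift_genericTuple {a : Fin d → Matrix (Fin n) (Fin n) R} (h : IsChart I a) (i : Fin d) :
    (chartLift h).mapMatrix (genericTuple I i) = a i := by
  rw [← tupleEval_genericPoly a i]
  rfl

lemma chartRing_hom_ext {f g : ChartRing.{u} I →+* R}
    (h : ∀ i, f.mapMatrix (genericTuple I i) = g.mapMatrix (genericTuple I i)) : f = g := by
  refine Ideal.Quotient.ringHom_ext (tuple_hom_ext fun t => ?_)
  exact congrFun (congrFun (h t.1) t.2.1) t.2.2

end ring

section scheme
variable {X Y : Scheme.{u}} (I : Fin d ↪ Fin n × Fin n)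

/-- An affine chart of the moduli scheme of molds. -/
noncomputable abbrev chartScheme : Scheme.{u} := Spec (CommRingCat.of (ChartRing.{u} I))

noncomputable def univTuple (i : Fin d) : MatSec n (chartScheme.{u} I) ⊤ :=
  (Scheme.ΓSpecIso (CommRingCat.of (ChartRing.{u} I))).inv.hom.mapMatrix (genericTuple I i)

lemma isChart_univTuple : IsChart I (univTuple.{u} I) := (isChart_genericTuple I).map _

variable {I}

noncomputable def chartHom {a : Fin d → MatSec n X ⊤} (h : IsChart I a) : X ⟶ chartScheme.{u} I :=
  X.toSpecΓ ≫ Spec.map (CommRingCat.ofHom (chartLift h))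

lemma pullMat_chartHom {a : Fin d → MatSec n X ⊤} (h : IsChart I a) (i : Fin d) :
    pullMat (chartHom h) ⊤ ⊤ le_top (univTuple I i) = a i := by
  rw [← chartLift_genericTuple h i]
  have : (Scheme.ΓSpecIso (CommRingCat.of (ChartRing.{u} I))).inv ≫ (chartHom h).appLE ⊤ ⊤ le_top
      = CommRingCat.ofHom (chartLift h) := by
    have : (chartHom h).appLE ⊤ ⊤ le_top = (chartHom h).appTop := (Scheme.Hom.app_eq_appLE _).symm
    rw [this, chartHom, Scheme.Hom.comp_appTop]
    simp
  have h2 := congrArg (fun f => f.hom.mapMatrix (genericTuple I i)) this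
  exact h2

lemma chartScheme_hom_ext {u v : X ⟶ chartScheme.{u} I}
    (h : ∀ i, pullMat u ⊤ ⊤ le_top (univTuple I i) = pullMat v ⊤ ⊤ le_top (univTuple I i)) :
    u = v := by
  have : IsAffine (chartScheme.{u} I) := inferInstanceAs (IsAffine (Spec _))
  refine ext_of_isAffine ?_
  rw [← cancel_epi (Scheme.ΓSpecIso (CommRingCat.of (ChartRing.{u} I))).inv]
  ext1
  refine chartRing_hom_ext fun i => ?_
  have h1 : u.appTop = u.appLE ⊤ ⊤ le_top := Scheme.Hom.app_eq_appLE _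
  have h2 : v.appTop = v.appLE ⊤ ⊤ le_top := Scheme.Hom.app_eq_appLE _
  rw [h1, h2]
  exact h i

variable (I) in
/-- The universal mold on a chart. -/
noncomputable def univChart : Mold n d (chartScheme.{u} I) := ofChart _ (isChart_univTuple I)

lemma pull_chartHom {a : Fin d → MatSec n X ⊤} (h : IsChart I a) :
    pull (chartHom h) (univChart I) = ofChart a h := by
  rw [univChart, pull_ofChart]
  congr 1
  funext i
  exact pullMat_chartHom h i

lemma chart_mono {u v : X ⟶ chartScheme.{u} I} (h : pull u (univChart I) = pull v (univChart I)) :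
    u = v := by
  rw [univChart, pull_ofChart, pull_ofChart] at h
  exact chartScheme_hom_ext fun i => congrFun (ofChart_injective _ _ h) i

end scheme

section locus
variable {X Y : Scheme.{u}} (I : Fin d ↪ Fin n × Fin n)

/-- `a` is a normalised frame of `A` over `U`. -/
structure IsGood (A : Mold n d X) (U : X.Opens) (a : Fin d → MatSec n X U) : Prop where
  chart : IsChart I a
  mem_iff : ∀ (V : X.Opens) (h : V ≤ U) (m : MatSec n X V),
    m ∈ A.sec V ↔ m = ∑ k, m (I k).1 (I k).2 • resMat h (a k)

variable {I} {A : Mold n d X}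

lemma IsGood.self_mem {U : X.Opens} {a : Fin d → MatSec n X U} (h : IsGood I A U a) (i : Fin d) :
    a i ∈ A.sec U := by
  rw [h.mem_iff U le_rfl]
  simp [h.chart.norm]

lemma IsGood.unique {U U' V : X.Opens} {a : Fin d → MatSec n X U} {a' : Fin d → MatSec n X U'}
    (h : IsGood I A U a) (h' : IsGood I A U' a') (hV : V ≤ U) (hV' : V ≤ U') (i : Fin d) :
    resMat hV (a i) = resMat hV' (a' i) := by
  have h1 := (h'.mem_iff V hV' _).1 (A.res_mem hV (h.self_mem i))
  rw [h1]
  have h2 : ∀ k, resMat hV (a i) (I k).1 (I k).2 = if i = k then 1 else 0 := fun k => by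
    simp [h.chart.norm, apply_ite (X.presheaf.map (homOfLE hV).op).hom]
  simp [h2]

lemma IsGood.isFrame {U : X.Opens} {a : Fin d → MatSec n X U} (h : IsGood I A U a) :
    IsFrame A.sec U (chartBasis h.chart) := by
  intro V hV m
  rw [basisMap_chartBasis, h.mem_iff V hV]
  exact mem_subalg_iff_repr _ m

lemma isGood_of_span {U : X.Opens} (a : Fin d → MatSec n X U)
    (norm : ∀ i j, a i (I j).1 (I j).2 = if i = j then 1 else 0) (ha : ∀ i, a i ∈ A.sec U)
    (span : ∀ (V : X.Opens) (h : V ≤ U) (m : MatSec n X V), m ∈ A.sec V →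
      ∃ c : Fin d → Γ(X, V), m = ∑ k, c k • resMat h (a k)) : IsGood I A U a := by
  have mem_iff : ∀ (V : X.Opens) (h : V ≤ U) (m : MatSec n X V),
      m ∈ A.sec V ↔ m = ∑ k, m (I k).1 (I k).2 • resMat h (a k) := by
    intro V h m
    constructor
    · intro hm
      obtain ⟨c, hc⟩ := span V h m hm
      have : ∀ k, m (I k).1 (I k).2 = c k := fun k => by
        rw [hc]
        simp [Matrix.sum_apply, norm, apply_ite (X.presheaf.map (homOfLE h).op).hom]
      simp_rw [this]; exact hc
    · intro hm
      rw [hm]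
      exact Subalgebra.sum_mem _ fun i _ => Subalgebra.smul_mem _ (A.res_mem h (ha i)) _
  refine ⟨⟨norm, ?_, fun i j => ?_⟩, mem_iff⟩
  · have := (mem_iff U le_rfl 1).1 (one_mem _)
    simpa only [resMat_self] using this
  · have := (mem_iff U le_rfl _).1 (mul_mem (ha i) (ha j))
    simpa only [resMat_self] using this

/-- The `I`-minor of a frame. -/
noncomputable def minor {R : Type*} [CommRing R] {κ : Type} (I : Fin d ↪ Fin n × Fin n)
    (β : Module.Basis (Fin d ⊕ κ) R (Matrix (Fin n) (Fin n) R)) : Matrix (Fin d) (Fin d) R :=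
  Matrix.of fun i j => β (Sum.inl i) (I j).1 (I j).2

lemma exists_isGood {κ : Type} [Fintype κ] {U : X.Opens}
    {β : Module.Basis (Fin d ⊕ κ) Γ(X, U) (MatSec n X U)} (hβ : IsFrame A.sec U β)
    (hdet : IsUnit (minor I β).det) : ∃ a, IsGood I A U a := by
  have hmem : ∀ i, β (Sum.inl i) ∈ A.sec U := fun i => (hβ.mem_iff _).2 fun j => repr_inl_inr _ _ _
  set N := minor I β with hN
  have hNN : N⁻¹ * N = 1 := Matrix.nonsing_inv_mul _ hdet
  have hNN' : N * N⁻¹ = 1 := Matrix.mul_nonsing_inv _ hdet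
  let a : Fin d → MatSec n X U := fun i => ∑ k, N⁻¹ i k • β (Sum.inl k)
  have hba : ∀ i, β (Sum.inl i) = ∑ k, N i k • a k := by
    intro i
    simp only [a, Finset.smul_sum, smul_smul]
    rw [Finset.sum_comm]
    simp_rw [← Finset.sum_smul, ← Matrix.mul_apply, hNN', Matrix.one_apply]
    simp
  refine ⟨a, isGood_of_span a (fun i j => ?_) (fun i => ?_) fun V h m hm => ?_⟩
  · have := congrFun (congrFun hNN i) j
    rw [Matrix.one_apply, Matrix.mul_apply] at this
    rw [← this]
    simp [a, Matrix.sum_apply, hN, minor]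
  · exact Subalgebra.sum_mem _ fun k _ => Subalgebra.smul_mem _ (hmem k) _
  · have h1 := eq_sum_of_repr _ ((hβ V h m).1 hm)
    refine ⟨fun k => ∑ i, (basisMap (X.presheaf.map (homOfLE h).op).hom β).repr m (Sum.inl i) *
      (X.presheaf.map (homOfLE h).op).hom (N i k), h1.trans ?_⟩
    simp_rw [Finset.sum_smul]
    rw [Finset.sum_comm]
    refine Finset.sum_congr rfl fun i _ => ?_
    rw [basisMap_apply, hba, map_sum, Finset.smul_sum]
    simp_rw [mapMatrix_smul, smul_smul]

variable (I A) in
/-- The open locus on which `A` has a normalised frame. -/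
def chartLocus : X.Opens := ⨆ s : {U : X.Opens // ∃ a, IsGood I A U a}, s.1

lemma exists_isGood_chartLocus : ∃ a, IsGood I A (chartLocus I A) a := by
  choose a ha using fun s : {U : X.Opens // ∃ a, IsGood I A U a} => s.2
  have hle : ∀ s : {U : X.Opens // ∃ a, IsGood I A U a}, s.1 ≤ chartLocus I A :=
    fun s => le_iSup (fun s : {U : X.Opens // ∃ a, IsGood I A U a} => s.1) s
  have hglue : ∀ (i : Fin d) (p q : Fin n), ∃ t : Γ(X, chartLocus I A),
      ∀ s, (X.presheaf.map (homOfLE (hle s)).op).hom t = a s i p q := by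
    intro i p q
    obtain ⟨t, ht, -⟩ := X.sheaf.existsUnique_gluing
      (fun s : {U : X.Opens // ∃ a, IsGood I A U a} => s.1) (fun s => a s i p q) (by
        intro s s'
        exact congrFun (congrFun ((ha s).unique (ha s') inf_le_left inf_le_right i) p) q)
    exact ⟨t, ht⟩
  choose b hb using hglue
  have hba : ∀ s i, resMat (hle s) (Matrix.of (b i)) = a s i := fun s i => by
    ext p q; exact hb i p q s
  have hcov : ∀ x ∈ chartLocus I A, ∃ s : {U : X.Opens // ∃ a, IsGood I A U a}, x ∈ s.1 :=
    fun x hx => by simpa [chartLocus] using hx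
  refine ⟨fun i => Matrix.of (b i), chart_local fun x hx => ?_, fun V h m => ⟨fun hm => ?_, fun hm => ?_⟩⟩
  · obtain ⟨s, hs⟩ := hcov x hx
    refine ⟨s.1, hle s, hs, ?_⟩
    simp_rw [hba]
    exact (ha s).chart
  · ext p q
    rw [← sub_eq_zero]
    refine section_eq_zero _ fun x hx => ?_
    obtain ⟨s, hs⟩ := hcov x (h hx)
    refine ⟨V ⊓ s.1, inf_le_left, ⟨hx, hs⟩, ?_⟩
    rw [map_sub, sub_eq_zero]
    have h1 := ((ha s).mem_iff _ inf_le_right _).1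
      (A.res_mem (inf_le_left : V ⊓ s.1 ≤ V) hm)
    refine (congrFun (congrFun h1 p) q).trans ?_
    change _ = (resMat (inf_le_left : V ⊓ s.1 ≤ V) (∑ k, m (I k).1 (I k).2 • resMat h _)) p q
    rw [map_sum]
    simp_rw [mapMatrix_smul, ← hba, resMat_resMat]
    rfl
  · rw [hm]
    refine Subalgebra.sum_mem _ fun i _ => Subalgebra.smul_mem _ ?_ _
    refine A.local_mem fun x hx => ?_
    obtain ⟨s, hs⟩ := hcov x (h hx)
    refine ⟨V ⊓ s.1, inf_le_left, ⟨hx, hs⟩, ?_⟩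
    rw [resMat_resMat]
    have := A.res_mem (inf_le_right : V ⊓ s.1 ≤ s.1) ((ha s).self_mem i)
    rwa [← hba, resMat_resMat] at this

lemma mem_chartLocus_of_mem_basicOpen {κ : Type} [Fintype κ] {U : X.Opens}
    {β : Module.Basis (Fin d ⊕ κ) Γ(X, U) (MatSec n X U)} (hβ : IsFrame A.sec U β) {x : X}
    (hx : x ∈ X.basicOpen (minor I β).det) : x ∈ chartLocus I A := by
  have hle : X.basicOpen (minor I β).det ≤ U := X.basicOpen_le _
  have hfr := hβ.restrict hle
  have hm : minor I (basisMap (X.presheaf.map (homOfLE hle).op).hom β)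
      = (X.presheaf.map (homOfLE hle).op).hom.mapMatrix (minor I β) := by
    ext i j
    change (basisMap _ β) (Sum.inl i) _ _ = _
    rw [basisMap_apply]; rfl
  obtain ⟨a, ha⟩ := exists_isGood (I := I) hfr (by
    rw [hm, ← RingHom.map_det]
    exact RingedSpace.isUnit_res_basicOpen _ _)
  exact (le_iSup (fun s : {U : X.Opens // ∃ a, IsGood I A U a} => s.1) ⟨_, a, ha⟩) hx

lemma mem_chartLocus_of_pull {T : Scheme.{u}} (v : T ⟶ X) {b : Fin d → MatSec n T ⊤}
    (hb : IsChart I b) (h : pull v A = ofChart b hb) (t : T) : v t ∈ chartLocus I A := by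
  obtain ⟨U, hx, e, β, hβ⟩ := A.exists_frame (v t)
  set W := v ⁻¹ᵁ U with hW
  have hfr := isFrame_pull v A (W := W) le_rfl hβ
  rw [h] at hfr
  set φ := (v.appLE U W le_rfl).hom with hφ
  have hbm : ∀ i, resMat (le_top : W ≤ ⊤) (b i) ∈ (ofChart b hb).sec W := fun i =>
    (ofChart b hb).res_mem _ (by rw [ofChart_mem]; simp [hb.norm])
  have hexp := fun i => eq_sum_of_repr _ ((hfr.mem_iff _).1 (hbm i))
  set c : Matrix (Fin d) (Fin d) Γ(T, W) := Matrix.of fun i k =>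
    (basisMap φ β).repr (resMat (le_top : W ≤ ⊤) (b i)) (Sum.inl k) with hc
  have hmul : c * φ.mapMatrix (minor I β) = 1 := by
    ext i j
    have h1 := congrFun (congrFun (hexp i) (I j).1) (I j).2
    have h2 : resMat (le_top : W ≤ ⊤) (b i) (I j).1 (I j).2 = (1 : Matrix (Fin d) (Fin d) Γ(T, W)) i j := by
      simp [hb.norm, Matrix.one_apply, apply_ite (T.presheaf.map (homOfLE (le_top : W ≤ ⊤)).op).hom]
    rw [h2] at h1
    rw [h1, Matrix.mul_apply, Matrix.sum_apply]
    refine Finset.sum_congr rfl fun k _ => ?_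
    rw [basisMap_apply]
    rfl
  have hunit : IsUnit (φ (minor I β).det) := by
    rw [RingHom.map_det]
    have := congrArg Matrix.det hmul
    rw [Matrix.det_mul, Matrix.det_one] at this
    exact IsUnit.of_mul_eq_one _ (by rw [mul_comm]; exact this)
  have hmem : v t ∈ X.basicOpen (minor I β).det := by
    have h1 : T.basicOpen (φ (minor I β).det) = W := T.basicOpen_of_isUnit hunit
    have h2 := Scheme.basicOpen_appLE v W U le_rfl (minor I β).det
    have h3 : t ∈ T.basicOpen (φ (minor I β).det) := by rw [h1]; exact hx
    have h4 : t ∈ W ⊓ v ⁻¹ᵁ X.basicOpen (minor I β).det := by rw [← h2]; exact h3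
    exact h4.2
  exact mem_chartLocus_of_mem_basicOpen hβ hmem

end locus
end Mold

namespace Mold
variable {n d : ℕ}

/-- The inclusion of a chart into the functor of molds. -/
noncomputable def chartIncl (I : Fin d ↪ Fin n × Fin n) :
    yoneda.obj (chartScheme.{u} I) ⟶ moldFunctor n d :=
  yonedaEquiv.symm (univChart I)

lemma chartIncl_app (I : Fin d ↪ Fin n × Fin n) {T : Scheme.{u}} (t : T ⟶ chartScheme.{u} I) :
    (chartIncl I).app (op T) t = pull t (univChart I) := rfl

lemma exists_chartHom (I : Fin d ↪ Fin n × Fin n) {X : Scheme.{u}} (A : Mold n d X) :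
    ∃ φ : (chartLocus I A).toScheme ⟶ chartScheme.{u} I,
      pull φ (univChart I) = pull (chartLocus I A).ι A := by
  obtain ⟨a, ha⟩ := exists_isGood_chartLocus (I := I) (A := A)
  set L := chartLocus I A with hL
  have hle : (⊤ : L.toScheme.Opens) ≤ L.ι ⁻¹ᵁ L := by simp
  refine ⟨chartHom (ha.chart.map (L.ι.appLE L ⊤ hle).hom), ?_⟩
  rw [pull_chartHom]
  refine ext_frame fun x => ⟨⊤, trivial, _, _, isFrame_ofChart _ _, ?_⟩
  rw [← basisMap_chartBasis ha.chart]
  exact isFrame_pull L.ι A hle ha.isFrame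

lemma chartIncl_isOpenImmersion (I : Fin d ↪ Fin n × Fin n) :
    MorphismProperty.presheaf @IsOpenImmersion (chartIncl.{u} I) := by
  refine MorphismProperty.relative.of_exists fun X g => ?_
  set A : Mold n d X := yonedaEquiv g with hA
  have hg : ∀ {T : Scheme.{u}} (t : T ⟶ X), g.app (op T) t = pull t A := by
    intro T t
    have : g = yonedaEquiv.symm A := by rw [hA, Equiv.symm_apply_apply]
    rw [this]; rfl
  have hex := exists_chartHom I A
  set L := chartLocus I A with hL
  obtain ⟨φ, hφ⟩ := hex
  refine ⟨L.toScheme, yoneda.map φ, L.ι, ?_, inferInstance⟩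
  refine IsPullback.of_forall_isPullback_app fun T => ?_
  obtain ⟨T⟩ := T
  rw [Types.isPullback_iff]
  refine ⟨?_, ?_, ?_⟩
  · ext t
    change pull (t ≫ φ) (univChart I) = g.app _ (t ≫ L.ι)
    rw [hg, pull_comp, pull_comp, hφ]
  · rintro t t' ⟨-, h⟩
    exact (cancel_mono L.ι).1 h
  · rintro u (v : T ⟶ X) (h : pull u (univChart I) = g.app _ v)
    rw [hg] at h
    have hv : Set.range v ⊆ Set.range L.ι := by
      rw [Scheme.Opens.range_ι]
      rintro _ ⟨t, rfl⟩
      rw [univChart, pull_ofChart] at h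
      exact mem_chartLocus_of_pull v _ h.symm t
    refine ⟨IsOpenImmersion.lift L.ι v hv, ?_, IsOpenImmersion.lift_fac _ _ _⟩
    refine chart_mono ?_
    change pull (_ ≫ φ) (univChart I) = _
    rw [pull_comp, hφ, ← pull_comp, IsOpenImmersion.lift_fac, h]

lemma exists_minor_ne_zero {K : Type*} [Field K] (a : Fin d → Matrix (Fin n) (Fin n) K)
    (ha : LinearIndependent K a) :
    ∃ I : Fin d ↪ Fin n × Fin n, (Matrix.of fun i j => a i (I j).1 (I j).2).det ≠ 0 := by
  let N : Matrix (Fin d) (Fin n × Fin n) K := Matrix.of fun i p => a i p.1 p.2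
  have hN : LinearIndependent K N.row := by
    let l : Matrix (Fin n) (Fin n) K →ₗ[K] (Fin n × Fin n → K) :=
      { toFun := fun m p => m p.1 p.2
        map_add' := fun _ _ => rfl
        map_smul' := fun _ _ => rfl }
    refine ha.map' l (LinearMap.ker_eq_bot.2 fun m m' h => ?_)
    ext p q
    exact congrFun h (p, q)
  have hr : Module.finrank K (Submodule.span K (Set.range N.col)) = d := by
    rw [← Matrix.rank_eq_finrank_span_cols, hN.rank_matrix, Fintype.card_fin]
  have hex := Submodule.exists_fun_fin_finrank_span_eq K (Set.range N.col)
  rw [hr] at hex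
  obtain ⟨f, hf, -, hli⟩ := hex
  choose J hJ using hf
  have hJinj : Function.Injective J := fun i j hij =>
    hli.injective ((hJ i).symm.trans ((congrArg N.col hij).trans (hJ j)))
  refine ⟨⟨J, hJinj⟩, ?_⟩
  rw [← isUnit_iff_ne_zero, ← Matrix.isUnit_iff_isUnit_det,
    ← Matrix.linearIndependent_cols_iff_isUnit]
  have : (Matrix.of fun i j => a i (J j).1 (J j).2).col = f := by
    funext j
    exact hJ j
  rw [← this] at hli
  exact hli

lemma exists_mem_chartLocus {X : Scheme.{u}} (A : Mold n d X) (x : X) :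
    ∃ I : Fin d ↪ Fin n × Fin n, x ∈ chartLocus I A := by
  obtain ⟨U, hx, e, β, hβ⟩ := A.exists_frame x
  set ev := (X.evaluation U x hx).hom with hev
  obtain ⟨I, hI⟩ := exists_minor_ne_zero (fun i => basisMap ev β (Sum.inl i))
    ((Module.Basis.linearIndependent _).comp _ Sum.inl_injective)
  refine ⟨I, mem_chartLocus_of_mem_basicOpen hβ ?_⟩
  rw [← X.evaluation_ne_zero_iff_mem_basicOpen x hx]
  change ev _ ≠ 0
  rw [RingHom.map_det]
  have : ev.mapMatrix (minor I β) =
      Matrix.of fun i j => basisMap ev β (Sum.inl i) (I j).1 (I j).2 := by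
    ext i j
    change ev (β (Sum.inl i) (I j).1 (I j).2) = basisMap ev β (Sum.inl i) _ _
    rw [basisMap_apply]; rfl
  rw [this]
  exact hI

end Mold

/-- The functor of molds is representable by a scheme. -/
instance moldFunctor_isRepresentable (n d : ℕ) : (moldFunctor.{u} n d).IsRepresentable := by
  let F : Sheaf Scheme.zariskiTopology.{u} (Type u) := ⟨moldFunctor n d, moldFunctor_isSheaf n d⟩
  let f : (I : ULift.{u} (Fin d ↪ Fin n × Fin n)) → (yoneda.obj (Mold.chartScheme.{u} I.down) ⟶ F.1) :=
    fun I => Mold.chartIncl I.down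
  have : Presheaf.IsLocallySurjective Scheme.zariskiTopology (Sigma.desc f) := by
    refine ⟨fun {X} (A : Mold n d X) => ?_⟩
    have hU : IsOpenCover (fun I : Fin d ↪ Fin n × Fin n => Mold.chartLocus I A) := by
      refine IsOpenCover.mk (top_le_iff.1 fun x _ => ?_)
      rw [Opens.mem_iSup]
      exact Mold.exists_mem_chartLocus A x
    refine Scheme.zariskiTopology.superset_covering ?_
      (X.openCoverOfIsOpenCover _ hU).mem_grothendieckTopology
    rw [Sieve.generate_le_iff]
    rintro _ _ ⟨I⟩
    obtain ⟨φ, hφ⟩ := Mold.exists_chartHom I A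
    have h1 := congrArg (fun t => t.app (op (Mold.chartLocus I A).toScheme) φ) (Sigma.ι_desc f ⟨I⟩)
    exact ⟨_, h1.trans hφ⟩
  exact Scheme.LocalRepresentability.isRepresentable (F := F) (f := f)
    fun I => Mold.chartIncl_isOpenImmersion I.down

/-- The moduli scheme `Mold_{n,d}` over `ℤ`: the scheme representing the functor of molds of degree
`n` and rank `d`, which exists by `moldFunctor_isRepresentable`. -/
noncomputable def MoldScheme (n d : ℕ) : Scheme.{u} := (moldFunctor.{u} n d).reprX

/-- Morphisms `X ⟶ Mold_{n,d}` are the same as molds of degree `n` and rank `d` on `X`, naturally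
in `X` with respect to `Mold.pull`. -/
noncomputable def moldRepresentableBy (n d : ℕ) :
    (moldFunctor.{u} n d).RepresentableBy (MoldScheme.{u} n d) :=
  (moldFunctor.{u} n d).representableBy

/-- The morphism `X ⟶ Mold_{n,d}` classifying a mold on `X`. -/
noncomputable def Mold.classify {n d : ℕ} {X : Scheme.{u}} (A : Mold n d X) :
    X ⟶ MoldScheme.{u} n d :=
  (moldRepresentableBy n d).homEquiv.symm A

lemma Mold.comp_classify {n d : ℕ} {X Y : Scheme.{u}} (f : X ⟶ Y) (A : Mold n d Y) :
    f ≫ A.classify = (A.pull f).classify :=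
  (moldRepresentableBy n d).comp_homEquiv_symm A f

namespace PGL
attribute [local instance] MvPolynomial.gradedAlgebra
variable (n : ℕ)

/-- The polynomial ring `ℤ[x_ij]`, `1 ≤ i, j ≤ n`. -/
abbrev Poly : Type u := MvPolynomial (Fin n × Fin n) (ULift.{u} ℤ)

/-- The generic `n × n` matrix `(x_ij)`. -/
noncomputable abbrev generic : Matrix (Fin n) (Fin n) (Poly.{u} n) :=
  Matrix.mvPolynomialX (Fin n) (Fin n) (ULift.{u} ℤ)

/-- The coordinate ring of `PGLₙ`: the degree zero part of `ℤ[x_ij][1 / det (x_ij)]`. -/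
abbrev CoordRing : Type u :=
  HomogeneousLocalization.Away
    (MvPolynomial.homogeneousSubmodule (Fin n × Fin n) (ULift.{u} ℤ)) (generic.{u} n).det

variable {n}

lemma isHomogeneous_det {m : ℕ} {σ R : Type*} [CommRing R]
    (M : Matrix (Fin m) (Fin m) (MvPolynomial σ R)) (h : ∀ i j, (M i j).IsHomogeneous 1) :
    M.det.IsHomogeneous m := by
  rw [Matrix.det_apply]
  refine MvPolynomial.IsHomogeneous.sum _ _ _ fun s _ => ?_
  have := MvPolynomial.IsHomogeneous.prod Finset.univ (fun i => M (s i) i) (fun _ => 1)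
    fun i _ => h (s i) i
  simp only [Finset.sum_const, Finset.card_univ, Fintype.card_fin, smul_eq_mul, mul_one] at this
  rw [← MvPolynomial.mem_homogeneousSubmodule] at this ⊢
  rw [Units.smul_def]
  exact zsmul_mem this _

lemma generic_isHomogeneous (i j : Fin n) : (generic.{u} n i j).IsHomogeneous 1 := by
  rw [generic, Matrix.mvPolynomialX_apply]
  exact MvPolynomial.isHomogeneous_X _ _

lemma det_mem : (generic.{u} n).det ∈
    MvPolynomial.homogeneousSubmodule (Fin n × Fin n) (ULift.{u} ℤ) n :=
  isHomogeneous_det _ generic_isHomogeneous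

lemma entry_mem (i k l j : Fin n) : generic.{u} n i k * (generic.{u} n).adjugate l j ∈
    MvPolynomial.homogeneousSubmodule (Fin n × Fin n) (ULift.{u} ℤ) (1 • n) := by
  obtain _ | m := n
  · exact i.elim0
  · rw [Matrix.adjugate_fin_succ_eq_det_submatrix, one_smul]
    rw [show MvPolynomial.homogeneousSubmodule (Fin (m + 1) × Fin (m + 1)) (ULift.{u} ℤ) (m + 1) =
      MvPolynomial.homogeneousSubmodule _ _ (1 + m) by rw [add_comm]]
    refine (generic_isHomogeneous i k).mul ?_
    have := isHomogeneous_det ((generic.{u} (m + 1)).submatrix j.succAbove l.succAbove)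
      fun _ _ => generic_isHomogeneous _ _
    have h2 := (MvPolynomial.isHomogeneous_one (Fin (m+1) × Fin (m+1)) (ULift.{u} ℤ)).neg.pow
      (j + l : ℕ)
    simpa using h2.mul this

/-- The element `x_ik · (x⁻¹)_lj` of the coordinate ring of `PGLₙ`. -/
noncomputable def entry (i k l j : Fin n) : CoordRing.{u} n :=
  HomogeneousLocalization.Away.mk _ det_mem 1 (generic.{u} n i k * (generic.{u} n).adjugate l j)
    (entry_mem i k l j)

/-- `det (x_ij)`, as an element of the multiplicative set it generates. -/
noncomputable def detElt : Submonoid.powers (generic.{u} n).det :=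
  ⟨(generic.{u} n).det, Submonoid.mem_powers _⟩

/-- The generic matrix over `ℤ[x_ij][1 / det]`. -/
noncomputable def locMat : Matrix (Fin n) (Fin n) (Localization.Away (generic.{u} n).det) :=
  (generic.{u} n).map (algebraMap _ _)

/-- The inverse of the generic matrix. -/
noncomputable def locInv : Matrix (Fin n) (Fin n) (Localization.Away (generic.{u} n).det) :=
  Localization.mk 1 (detElt.{u} (n := n)) •
    (generic.{u} n).adjugate.map (algebraMap _ _)

lemma mk_mul_det : Localization.mk 1 (detElt.{u} (n := n)) *
    algebraMap (Poly.{u} n) (Localization.Away (generic.{u} n).det) (generic.{u} n).det = 1 := by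
  rw [← Localization.mk_one_eq_algebraMap, Localization.mk_mul]
  rw [one_mul, mul_one]
  exact Localization.mk_self (detElt.{u} (n := n))

lemma locMat_mul_locInv : locMat.{u} * locInv.{u} (n := n) = 1 := by
  rw [locMat, locInv, Matrix.mul_smul, ← Matrix.map_mul, Matrix.mul_adjugate]
  ext i j
  have := mk_mul_det.{u} (n := n)
  by_cases h : i = j
  · subst h; simpa using this
  · simp [h]

lemma locInv_mul_locMat : locInv.{u} (n := n) * locMat.{u} = 1 :=
  mul_eq_one_comm.1 locMat_mul_locInv

lemma val_entry (i k l j : Fin n) : (entry.{u} i k l j).val = locMat.{u} i k * locInv.{u} l j := by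
  rw [entry, HomogeneousLocalization.Away.val_mk, locMat, locInv]
  simp only [Matrix.map_apply, Matrix.smul_apply, smul_eq_mul]
  rw [← Localization.mk_one_eq_algebraMap, ← Localization.mk_one_eq_algebraMap,
    Localization.mk_mul, Localization.mk_mul]
  simp only [one_mul, mul_one, pow_one]
  rfl

lemma entry_mul (i k l k' l' m : Fin n) :
    ∑ j, entry.{u} i k l j * entry.{u} j k' l' m = if l = k' then entry.{u} i k l' m else 0 := by
  apply HomogeneousLocalization.val_injective
  have h := congrFun (congrFun (locInv_mul_locMat.{u} (n := n)) l) k'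
  rw [Matrix.mul_apply, Matrix.one_apply] at h
  have h2 : ∑ j, (entry.{u} i k l j).val * (entry.{u} j k' l' m).val
      = locMat.{u} i k * (∑ j, locInv.{u} l j * locMat.{u} j k') * locInv.{u} l' m := by
    simp_rw [val_entry, Finset.mul_sum, Finset.sum_mul, mul_assoc]
  simp only [← HomogeneousLocalization.algebraMap_apply, map_sum, map_mul, apply_ite (algebraMap _ _)] at h2 ⊢
  rw [h2, h]
  split_ifs <;> simp [val_entry]

lemma entry_self (i j : Fin n) : ∑ k, entry.{u} i k k j = if i = j then 1 else 0 := by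
  apply HomogeneousLocalization.val_injective
  have h := congrFun (congrFun (locMat_mul_locInv.{u} (n := n)) i) j
  rw [Matrix.mul_apply, Matrix.one_apply] at h
  simp_rw [← val_entry] at h
  simp only [← HomogeneousLocalization.algebraMap_apply] at h ⊢
  rw [map_sum, h, apply_ite (algebraMap _ _), map_one, map_zero]

lemma entry_conj_inv (i j a b : Fin n) :
    ∑ k, ∑ l, entry.{u} i k l j * entry.{u} b l k a = if i = a ∧ b = j then 1 else 0 := by
  apply HomogeneousLocalization.val_injective
  have h := congrFun (congrFun (locMat_mul_locInv.{u} (n := n)) i) a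
  have h' := congrFun (congrFun (locMat_mul_locInv.{u} (n := n)) b) j
  rw [Matrix.mul_apply, Matrix.one_apply] at h h'
  have h2 : ∑ k, ∑ l, (entry.{u} i k l j).val * (entry.{u} b l k a).val
      = (∑ k, locMat.{u} i k * locInv.{u} k a) * (∑ l, locMat.{u} b l * locInv.{u} l j) := by
    simp_rw [val_entry, Finset.sum_mul_sum]
    refine Finset.sum_congr rfl fun k _ => Finset.sum_congr rfl fun l _ => ?_
    ring
  simp only [← HomogeneousLocalization.algebraMap_apply, map_sum, map_mul] at h2 ⊢
  rw [h2, h, h', apply_ite (algebraMap _ _), map_one, map_zero, ite_and]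
  split_ifs <;> simp

lemma entry_inv_conj (i j a b : Fin n) :
    ∑ k, ∑ l, entry.{u} k a b l * entry.{u} l j i k = if i = a ∧ b = j then 1 else 0 := by
  apply HomogeneousLocalization.val_injective
  have h := congrFun (congrFun (locInv_mul_locMat.{u} (n := n)) i) a
  have h' := congrFun (congrFun (locInv_mul_locMat.{u} (n := n)) b) j
  rw [Matrix.mul_apply, Matrix.one_apply] at h h'
  have h2 : ∑ k, ∑ l, (entry.{u} k a b l).val * (entry.{u} l j i k).val
      = (∑ k, locInv.{u} i k * locMat.{u} k a) * (∑ l, locInv.{u} b l * locMat.{u} l j) := by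
    simp_rw [val_entry, Finset.sum_mul_sum]
    refine Finset.sum_congr rfl fun k _ => Finset.sum_congr rfl fun l _ => ?_
    ring
  simp only [← HomogeneousLocalization.algebraMap_apply, map_sum, map_mul] at h2 ⊢
  rw [h2, h, h', apply_ite (algebraMap _ _), map_one, map_zero, ite_and]
  split_ifs <;> simp

section conj
variable {R S : Type*} [CommRing R] [CommRing S]

/-- For a point `P` of `PGLₙ` with values in `R`, i.e. a ring homomorphism `ψ` from the coordinate
ring to `R`, conjugation `m ↦ P m P⁻¹`, whose `(i, j)` entry is `∑ P_ik m_kl (P⁻¹)_lj`. Its inverse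
is `m ↦ P⁻¹ m P`. -/
noncomputable def conjLinearEquiv (ψ : CoordRing.{u} n →+* R) :
    Matrix (Fin n) (Fin n) R ≃ₗ[R] Matrix (Fin n) (Fin n) R where
  toFun m := Matrix.of fun i j => ∑ k, ∑ l, m k l * ψ (entry i k l j)
  map_add' m m' := by
    ext i j; simp [add_mul, Finset.sum_add_distrib]
  map_smul' r m := by
    ext i j; simp [Finset.mul_sum, mul_assoc]
  invFun m := Matrix.of fun i j => ∑ k, ∑ l, m k l * ψ (entry l j i k)
  left_inv m := by
    ext i j
    have key : ∀ a b, ∑ k, ∑ l, ψ (entry k a b l) * ψ (entry l j i k)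
        = if i = a ∧ b = j then 1 else 0 := fun a b => by
      have := congrArg ψ (entry_inv_conj i j a b)
      simpa only [map_sum, map_mul, apply_ite ψ, map_one, map_zero] using this
    calc _ = ∑ a, ∑ b, m a b * ∑ k, ∑ l, ψ (entry k a b l) * ψ (entry l j i k) := by
          simp only [Matrix.of_apply, Finset.sum_mul, Finset.mul_sum, mul_assoc]
          conv_lhs => enter [2, k]; rw [Finset.sum_comm]
          rw [Finset.sum_comm]
          refine Finset.sum_congr rfl fun a _ => ?_
          conv_lhs => enter [2, k]; rw [Finset.sum_comm]
          rw [Finset.sum_comm]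
      _ = m i j := by
          simp_rw [key, ite_and]
          simp
  right_inv m := by
    ext i j
    have key : ∀ a b, ∑ k, ∑ l, ψ (entry b l k a) * ψ (entry i k l j)
        = if i = a ∧ b = j then 1 else 0 := fun a b => by
      have := congrArg ψ (entry_conj_inv i j a b)
      simpa only [map_sum, map_mul, apply_ite ψ, map_one, map_zero, mul_comm] using this
    calc _ = ∑ a, ∑ b, m a b * ∑ k, ∑ l, ψ (entry b l k a) * ψ (entry i k l j) := by
          simp only [Matrix.of_apply, Finset.sum_mul, Finset.mul_sum, mul_assoc]
          conv_lhs => enter [2, k]; rw [Finset.sum_comm]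
          rw [Finset.sum_comm]
          refine Finset.sum_congr rfl fun a _ => ?_
          conv_lhs => enter [2, k]; rw [Finset.sum_comm]
          rw [Finset.sum_comm]
      _ = m i j := by
          simp_rw [key, ite_and]
          simp

lemma conjLinearEquiv_apply (ψ : CoordRing.{u} n →+* R) (m : Matrix (Fin n) (Fin n) R)
    (i j : Fin n) : conjLinearEquiv ψ m i j = ∑ k, ∑ l, m k l * ψ (entry i k l j) := rfl

lemma conjLinearEquiv_one (ψ : CoordRing.{u} n →+* R) : conjLinearEquiv ψ 1 = 1 := by
  ext i j
  have := congrArg ψ (entry_self i j)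
  rw [map_sum, apply_ite ψ, map_one, map_zero] at this
  simpa [Matrix.one_apply, conjLinearEquiv_apply] using this

lemma conjLinearEquiv_mul (ψ : CoordRing.{u} n →+* R) (m m' : Matrix (Fin n) (Fin n) R) :
    conjLinearEquiv ψ (m * m') = conjLinearEquiv ψ m * conjLinearEquiv ψ m' := by
  ext i j
  have key : ∀ k l k' l', ∑ b, ψ (entry i k l b) * ψ (entry b k' l' j)
      = if l = k' then ψ (entry i k l' j) else 0 := fun k l k' l' => by
    have := congrArg ψ (entry_mul i k l k' l' j)
    simpa only [map_sum, map_mul, apply_ite ψ, map_zero] using this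
  symm
  calc _ = ∑ k, ∑ l, ∑ k', ∑ l', m k l * m' k' l' *
        ∑ b, ψ (entry i k l b) * ψ (entry b k' l' j) := by
        simp only [Matrix.mul_apply, conjLinearEquiv_apply]
        have hb : ∀ b, (∑ k, ∑ l, m k l * ψ (entry i k l b)) *
            (∑ k', ∑ l', m' k' l' * ψ (entry b k' l' j)) = ∑ k, ∑ l, ∑ k', ∑ l',
              m k l * m' k' l' * (ψ (entry i k l b) * ψ (entry b k' l' j)) := by
          intro b
          rw [Finset.sum_mul]
          refine Finset.sum_congr rfl fun k _ => ?_
          rw [Finset.sum_mul]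
          refine Finset.sum_congr rfl fun l _ => ?_
          rw [Finset.mul_sum]
          refine Finset.sum_congr rfl fun k' _ => ?_
          rw [Finset.mul_sum]
          refine Finset.sum_congr rfl fun l' _ => ?_
          ring
        simp_rw [hb, Finset.mul_sum]
        rw [Finset.sum_comm]
        refine Finset.sum_congr rfl fun k _ => ?_
        rw [Finset.sum_comm]
        refine Finset.sum_congr rfl fun l _ => ?_
        rw [Finset.sum_comm]
        refine Finset.sum_congr rfl fun k' _ => ?_
        rw [Finset.sum_comm]
    _ = _ := by
        simp_rw [key, conjLinearEquiv_apply, Matrix.mul_apply, Finset.sum_mul]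
        refine Finset.sum_congr rfl fun k _ => ?_
        rw [Finset.sum_comm]
        conv_lhs => enter [2, l]; rw [Finset.sum_comm]
        simp only [mul_ite, mul_zero, Finset.sum_ite_eq', Finset.mem_univ, if_true]
        rw [Finset.sum_comm]

/-- Conjugation `m ↦ P m P⁻¹` as an automorphism of the algebra `Mₙ(R)`. -/
noncomputable def conjAlgEquiv (ψ : CoordRing.{u} n →+* R) :
    Matrix (Fin n) (Fin n) R ≃ₐ[R] Matrix (Fin n) (Fin n) R :=
  AlgEquiv.ofLinearEquiv (conjLinearEquiv ψ) (conjLinearEquiv_one ψ) (conjLinearEquiv_mul ψ)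

lemma mapMatrix_conjAlgEquiv (ψ : CoordRing.{u} n →+* R) (φ : R →+* S)
    (m : Matrix (Fin n) (Fin n) R) :
    φ.mapMatrix (conjAlgEquiv ψ m) = conjAlgEquiv (φ.comp ψ) (φ.mapMatrix m) := by
  ext i j
  change φ (∑ k, ∑ l, m k l * ψ (entry i k l j)) = ∑ k, ∑ l, φ (m k l) * φ (ψ (entry i k l j))
  simp only [map_sum, map_mul]

end conj

/-- The scheme `PGLₙ` over `ℤ`: the complement of `det = 0` in the projective space of
`n × n` matrices, i.e. the spectrum of the degree zero part of `ℤ[x_ij][1 / det]`. -/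
noncomputable abbrev scheme (n : ℕ) : Scheme.{u} := Spec (CommRingCat.of (CoordRing.{u} n))

section points
variable {X Y : Scheme.{u}}

/-- The ring homomorphism from the coordinate ring of `PGLₙ` to `Γ(X, U)` given by a morphism
`X ⟶ PGLₙ`. -/
noncomputable def sectionHom (P : X ⟶ scheme.{u} n) (U : X.Opens) : CoordRing.{u} n →+* Γ(X, U) :=
  ((Scheme.ΓSpecIso (CommRingCat.of (CoordRing.{u} n))).inv ≫ P.appLE ⊤ U le_top).hom

lemma sectionHom_res (P : X ⟶ scheme.{u} n) {U V : X.Opens} (h : V ≤ U) :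
    (X.presheaf.map (homOfLE h).op).hom.comp (sectionHom P U) = sectionHom P V := by
  have := congrArg (fun g => ((Scheme.ΓSpecIso (CommRingCat.of (CoordRing.{u} n))).inv ≫ g).hom)
    (Scheme.Hom.appLE_map P (le_top : U ≤ P ⁻¹ᵁ ⊤) (homOfLE h).op)
  exact this

lemma sectionHom_comp (f : X ⟶ Y) (P : Y ⟶ scheme.{u} n) (U : Y.Opens) (V : X.Opens)
    (h : V ≤ f ⁻¹ᵁ U) :
    (f.appLE U V h).hom.comp (sectionHom P U) = sectionHom (f ≫ P) V := by
  have := congrArg (fun g => ((Scheme.ΓSpecIso (CommRingCat.of (CoordRing.{u} n))).inv ≫ g).hom)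
    (Scheme.Hom.appLE_comp_appLE f P ⊤ U V (le_top : U ≤ P ⁻¹ᵁ ⊤) h)
  exact this

/-- For `P : X ⟶ PGLₙ`, the automorphism `m ↦ P m P⁻¹` of `Mₙ(𝒪_X)(U)`. -/
noncomputable def conjSec (P : X ⟶ scheme.{u} n) (U : X.Opens) :
    MatSec n X U ≃ₐ[Γ(X, U)] MatSec n X U :=
  conjAlgEquiv (sectionHom P U)

lemma conjSec_res (P : X ⟶ scheme.{u} n) {U V : X.Opens} (h : V ≤ U) (m : MatSec n X U) :
    resMat h (conjSec P U m) = conjSec P V (resMat h m) := by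
  rw [conjSec, conjSec, ← sectionHom_res P h]
  exact mapMatrix_conjAlgEquiv _ _ _

lemma conjSec_pull (f : X ⟶ Y) (P : Y ⟶ scheme.{u} n) (U : Y.Opens) (V : X.Opens)
    (h : V ≤ f ⁻¹ᵁ U) (m : MatSec n Y U) :
    pullMat f U V h (conjSec P U m) = conjSec (f ≫ P) V (pullMat f U V h m) := by
  rw [conjSec, conjSec, ← sectionHom_comp f P U V h]
  exact mapMatrix_conjAlgEquiv _ _ _

end points
end PGL

namespace Mold
variable {n d : ℕ} {X Y : Scheme.{u}} {κ : Type} [Fintype κ]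

/-- The sections `m` of `Mₙ(𝒪_X)` with `P m P⁻¹` in `A`, i.e. the sections of `P⁻¹ A P`. -/
noncomputable def conjSubalgebra (P : X ⟶ PGL.scheme.{u} n) (A : Mold n d X) (U : X.Opens) :
    Subalgebra Γ(X, U) (MatSec n X U) :=
  (A.sec U).comap (PGL.conjSec P U).toAlgHom

lemma mem_conjSubalgebra (P : X ⟶ PGL.scheme.{u} n) (A : Mold n d X) (U : X.Opens)
    (m : MatSec n X U) : m ∈ conjSubalgebra P A U ↔ PGL.conjSec P U m ∈ A.sec U := Iff.rfl

lemma isFrame_conj (P : X ⟶ PGL.scheme.{u} n) (A : Mold n d X) {U : X.Opens}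
    {β : Module.Basis (Fin d ⊕ κ) Γ(X, U) (MatSec n X U)} (hβ : IsFrame A.sec U β) :
    IsFrame (conjSubalgebra P A) U (β.map (PGL.conjSec P U).symm.toLinearEquiv) := by
  intro V h m
  rw [mem_conjSubalgebra, hβ V h]
  have : basisMap (X.presheaf.map (homOfLE h).op).hom (β.map (PGL.conjSec P U).symm.toLinearEquiv)
      = (basisMap (X.presheaf.map (homOfLE h).op).hom β).map
        (PGL.conjSec P V).symm.toLinearEquiv := by
    refine Module.Basis.eq_of_apply_eq fun i => ?_
    rw [basisMap_apply, Module.Basis.map_apply, Module.Basis.map_apply, basisMap_apply]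
    change resMat h ((PGL.conjSec P U).symm (β i)) = (PGL.conjSec P V).symm (resMat h (β i))
    rw [AlgEquiv.eq_symm_apply, ← PGL.conjSec_res, AlgEquiv.apply_symm_apply]
  rw [this]
  rfl

/-- For a mold `A` on `X` and `P : X ⟶ PGLₙ`, the mold `P⁻¹ A P`. -/
noncomputable def conj (P : X ⟶ PGL.scheme.{u} n) (A : Mold n d X) : Mold n d X :=
  ofFrames (conjSubalgebra P A)
    (fun {U V} h m hm => by
      rw [mem_conjSubalgebra] at hm ⊢
      rw [← PGL.conjSec_res]
      exact A.res_mem h hm)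
    (fun {U m} hm => A.local_mem fun x hx => by
      obtain ⟨V, h, hxV, hV⟩ := hm x hx
      refine ⟨V, h, hxV, ?_⟩
      rw [mem_conjSubalgebra, ← PGL.conjSec_res] at hV
      exact hV)
    (fun x => by
      obtain ⟨U, hx, e, β, hβ⟩ := A.exists_frame x
      exact ⟨U, hx, e, _, isFrame_conj P A hβ⟩)

lemma mem_conj (P : X ⟶ PGL.scheme.{u} n) (A : Mold n d X) (U : X.Opens) (m : MatSec n X U) :
    m ∈ (conj P A).sec U ↔ PGL.conjSec P U m ∈ A.sec U := Iff.rfl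

lemma pull_conj (f : X ⟶ Y) (P : Y ⟶ PGL.scheme.{u} n) (A : Mold n d Y) :
    pull f (conj P A) = conj (f ≫ P) (pull f A) := by
  refine ext_frame fun x => ?_
  obtain ⟨V, hx, e, β, hβ⟩ := A.exists_frame (f x)
  refine ⟨f ⁻¹ᵁ V, hx, e, _, isFrame_pull f (conj P A) le_rfl (isFrame_conj P A hβ), ?_⟩
  have h := isFrame_conj (f ≫ P) (pull f A) (isFrame_pull f A (W := f ⁻¹ᵁ V) le_rfl hβ)
  have hb : basisMap (f.appLE V (f ⁻¹ᵁ V) le_rfl).hom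
      (β.map (PGL.conjSec P V).symm.toLinearEquiv) =
      (basisMap (f.appLE V (f ⁻¹ᵁ V) le_rfl).hom β).map
        (PGL.conjSec (f ≫ P) (f ⁻¹ᵁ V)).symm.toLinearEquiv := by
    refine Module.Basis.eq_of_apply_eq fun i => ?_
    rw [basisMap_apply, Module.Basis.map_apply, Module.Basis.map_apply, basisMap_apply]
    change pullMat f V _ le_rfl ((PGL.conjSec P V).symm (β i)) =
      (PGL.conjSec (f ≫ P) _).symm (pullMat f V _ le_rfl (β i))
    rw [AlgEquiv.eq_symm_apply, ← PGL.conjSec_pull, AlgEquiv.apply_symm_apply]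
  rw [hb]
  exact h

end Mold

/-- `PGL_{n,S} = PGLₙ ⊗_ℤ S`. -/
noncomputable abbrev PGLOver (n : ℕ) (S : Scheme.{u}) : Scheme.{u} :=
  pullback (terminal.from (PGL.scheme.{u} n)) (terminal.from S)

/-- `Mold_{n,d} ⊗_ℤ S`. -/
noncomputable abbrev MoldOver (n d : ℕ) (S : Scheme.{u}) : Scheme.{u} :=
  pullback (terminal.from (MoldScheme.{u} n d)) (terminal.from S)

/-- The `S`-morphism `φ_A : PGL_{n,S} ⟶ Mold_{n,d} ⊗_ℤ S`, `P ↦ P⁻¹ A P`. It is given by the mold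
`P⁻¹ A P` for the universal point `P` of `PGLₙ` and the pullback of `A` to `PGL_{n,S}`. -/
noncomputable def orbitMap {n d : ℕ} {S : Scheme.{u}} (A : Mold n d S) :
    PGLOver n S ⟶ MoldOver n d S :=
  pullback.lift
    (Mold.classify (Mold.conj (pullback.fst _ _) (Mold.pull (pullback.snd _ _) A)))
    (pullback.snd _ _) (terminal.hom_ext _ _)

/-- On points with values in a scheme `X` over `S`, `orbitMap A` is `P ↦ P⁻¹ A_X P`. -/
lemma lift_orbitMap {n d : ℕ} {S X : Scheme.{u}} (A : Mold n d S) (s : X ⟶ S)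
    (P : X ⟶ PGL.scheme.{u} n) :
    pullback.lift P s (terminal.hom_ext _ _) ≫ orbitMap A =
      pullback.lift (Mold.classify (Mold.conj P (Mold.pull s A))) s (terminal.hom_ext _ _) := by
  ext1
  · rw [Category.assoc, orbitMap, pullback.lift_fst, pullback.lift_fst, Mold.comp_classify,
      Mold.pull_conj, ← Mold.pull_comp, pullback.lift_fst, pullback.lift_snd]
  · rw [Category.assoc, orbitMap, pullback.lift_snd, pullback.lift_snd, pullback.lift_snd]

namespace Hochschild
set_option linter.unusedSectionVars false
variable (R A M : Type*) [CommRing R] [Ring A] [Algebra R A] [AddCommGroup M] [Module R M]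
  [Module A M] [Module Aᵐᵒᵖ M] [IsScalarTower R A M] [IsScalarTower R Aᵐᵒᵖ M]

/-- Hochschild cochains `C^p(A, M) = Hom_R(A^{⊗ p}, M)` with values in an `A`-bimodule `M`. -/
abbrev Cochain (p : ℕ) : Type _ := MultilinearMap R (fun _ : Fin p => A) M

variable {R A M} {p : ℕ}

/-- The tuple `(a₀, …, a_i a_{i+1}, …, a_p)`. -/
def contract (i : Fin p) (a : Fin (p + 1) → A) : Fin p → A :=
  Fin.contractNth i.castSucc (· * ·) a

variable (R) in
lemma contract_update [DecidableEq (Fin (p + 1))] (i : Fin p) (a : Fin (p + 1) → A)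
    (j : Fin (p + 1)) : ∃ (k : Fin p) (L : A →ₗ[R] A), ∀ x,
      contract i (Function.update a j x) = Function.update (contract i a) k (L x) := by
  rcases lt_trichotomy (j : ℕ) i with h | h | h
  · refine ⟨⟨j, h.trans i.2⟩, LinearMap.id, fun x => funext fun t => ?_⟩
    simp only [contract, Fin.contractNth, Function.update_apply, Fin.ext_iff, Fin.val_castSucc,
      Fin.val_succ, LinearMap.id_apply]
    split_ifs <;> first | rfl | omega
  · refine ⟨i, LinearMap.mulRight R (a i.succ), fun x => funext fun t => ?_⟩
    simp only [contract, Fin.contractNth, Function.update_apply, Fin.ext_iff, Fin.val_castSucc,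
      Fin.val_succ, LinearMap.mulRight_apply]
    by_cases ht : t = i
    · subst ht; simp [h]
    · have ht' := Fin.val_ne_of_ne ht
      split_ifs <;> first | rfl | omega
  · by_cases h' : (j : ℕ) = i + 1
    · refine ⟨i, LinearMap.mulLeft R (a i.castSucc), fun x => funext fun t => ?_⟩
      simp only [contract, Fin.contractNth, Function.update_apply, Fin.ext_iff, Fin.val_castSucc,
        Fin.val_succ, LinearMap.mulLeft_apply]
      by_cases ht : t = i
      · subst ht; simp [h']
      · have ht' := Fin.val_ne_of_ne ht
        split_ifs <;> first | rfl | omega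
    · refine ⟨⟨j - 1, by omega⟩, LinearMap.id, fun x => funext fun t => ?_⟩
      simp only [contract, Fin.contractNth, Function.update_apply, Fin.ext_iff, Fin.val_castSucc,
        Fin.val_succ, LinearMap.id_apply]
      split_ifs <;> first | rfl | omega

/-- The cochain `(a₀, …, a_p) ↦ a₀ f(a₁, …, a_p)`. -/
def leftTerm (f : Cochain R A M p) : Cochain R A M (p + 1) :=
  LinearMap.uncurryLeft (M := fun _ : Fin (p + 1) => A)
    { toFun := fun x => (Algebra.lsmul R R M x).compMultilinearMap f
      map_add' := fun x y => by ext a; simp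
      map_smul' := fun r x => by ext a; simp }

/-- The cochain `(a₀, …, a_p) ↦ f(a₀, …, a_{p-1}) a_p`. -/
def rightTerm (f : Cochain R A M p) : Cochain R A M (p + 1) :=
  MultilinearMap.uncurryRight (M := fun _ : Fin (p + 1) => A)
    (((Algebra.lsmul R R M : Aᵐᵒᵖ →ₐ[R] Module.End R M).toLinearMap ∘ₗ
      (MulOpposite.opLinearEquiv R).toLinearMap).flip.compMultilinearMap f)

/-- The cochain `(a₀, …, a_p) ↦ f(a₀, …, a_i a_{i+1}, …, a_p)`. -/
def midTerm (i : Fin p) (f : Cochain R A M p) : Cochain R A M (p + 1) where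
  toFun a := f (contract i a)
  map_update_add' a j x y := by
    obtain ⟨k, L, h⟩ := contract_update R i a j
    rw [h, h, h, map_add, f.map_update_add]
  map_update_smul' a j r x := by
    obtain ⟨k, L, h⟩ := contract_update R i a j
    rw [h, h, map_smul, f.map_update_smul]

lemma leftTerm_apply (f : Cochain R A M p) (a : Fin (p + 1) → A) :
    leftTerm f a = a 0 • f (Fin.tail a) := rfl

lemma rightTerm_apply (f : Cochain R A M p) (a : Fin (p + 1) → A) :
    rightTerm f a = MulOpposite.op (a (Fin.last p)) • f (Fin.init a) := rfl

lemma midTerm_apply (i : Fin p) (f : Cochain R A M p) (a : Fin (p + 1) → A) :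
    midTerm i f a = f (contract i a) := rfl

variable (R A M p) in
/-- The Hochschild coboundary `d : C^p(A, M) → C^{p+1}(A, M)`,
`(df)(a₀, …, a_p) = a₀ f(a₁, …, a_p) + ∑_{0 ≤ i < p} (-1)^{i+1} f(a₀, …, a_i a_{i+1}, …, a_p)
+ (-1)^{p+1} f(a₀, …, a_{p-1}) a_p`. -/
def coboundary : Cochain R A M p →ₗ[R] Cochain R A M (p + 1) where
  toFun f := leftTerm f + ∑ i : Fin p, (-1 : R) ^ ((i : ℕ) + 1) • midTerm i f +
    (-1 : R) ^ (p + 1) • rightTerm f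
  map_add' f g := by
    ext a
    simp only [add_apply, sum_apply, smul_apply,
      leftTerm_apply, rightTerm_apply, midTerm_apply, smul_add, Finset.sum_add_distrib]
    abel
  map_smul' r f := by
    ext a
    simp only [add_apply, sum_apply, smul_apply,
      leftTerm_apply, rightTerm_apply, midTerm_apply, smul_add, Finset.smul_sum,
      RingHom.id_apply, smul_comm _ r]

variable (R A M) in
/-- The cocycles `Z^p(A, M)`. -/
def cocycles (p : ℕ) : Submodule R (Cochain R A M p) := LinearMap.ker (coboundary R A M p)

variable (R A M) in
/-- The coboundaries `B^p(A, M)`. -/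
def coboundaries : (p : ℕ) → Submodule R (Cochain R A M p)
  | 0 => ⊥
  | p + 1 => LinearMap.range (coboundary R A M p)

variable (R A M) in
/-- The Hochschild cohomology `H^p(A, M) = Z^p(A, M) / B^p(A, M)` of the `R`-algebra `A` with
coefficients in the `A`-bimodule `M`. -/
abbrev Cohomology (p : ℕ) : Type _ :=
  cocycles R A M p ⧸ (coboundaries R A M p).submoduleOf (cocycles R A M p)

end Hochschild

section quotient
variable {k B : Type*} [CommRing k] [Ring B] [Algebra k B] (A : Subalgebra k B)

/-- The `A`-bimodule `B / A`, for a subalgebra `A` of `B`. -/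
def BimodQuot : Type _ := B ⧸ Subalgebra.toSubmodule A

namespace BimodQuot

instance : AddCommGroup (BimodQuot A) :=
  inferInstanceAs (AddCommGroup (B ⧸ Subalgebra.toSubmodule A))

instance : Module k (BimodQuot A) :=
  inferInstanceAs (Module k (B ⧸ Subalgebra.toSubmodule A))

variable {A} in
/-- The class of an element of `B` in `B / A`. -/
def mk : B →ₗ[k] BimodQuot A := (Subalgebra.toSubmodule A).mkQ

lemma mk_surjective : Function.Surjective (mk (A := A)) := Submodule.mkQ_surjective _

lemma mk_eq_zero {b : B} : mk (A := A) b = 0 ↔ b ∈ A :=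
  Submodule.Quotient.mk_eq_zero (Subalgebra.toSubmodule A)

/-- Left multiplication `b ↦ a b` on `B / A`. -/
def leftMul : A →+* Module.End k (BimodQuot A) where
  toFun a := Submodule.mapQ (Subalgebra.toSubmodule A) (Subalgebra.toSubmodule A)
    (LinearMap.mulLeft k (a : B)) fun _ hx => A.mul_mem a.2 hx
  map_one' := LinearMap.ext fun x => by
    obtain ⟨b, rfl⟩ := mk_surjective A x
    exact congrArg mk (one_mul b)
  map_mul' a a' := LinearMap.ext fun x => by
    obtain ⟨b, rfl⟩ := mk_surjective A x
    exact congrArg mk (mul_assoc (a : B) a' b)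
  map_zero' := LinearMap.ext fun x => by
    obtain ⟨b, rfl⟩ := mk_surjective A x
    exact congrArg mk (zero_mul b)
  map_add' a a' := LinearMap.ext fun x => by
    obtain ⟨b, rfl⟩ := mk_surjective A x
    exact congrArg mk (add_mul (a : B) a' b)

/-- Right multiplication `b ↦ b a` on `B / A`. -/
def rightMul : Aᵐᵒᵖ →+* Module.End k (BimodQuot A) where
  toFun a := Submodule.mapQ (Subalgebra.toSubmodule A) (Subalgebra.toSubmodule A)
    (LinearMap.mulRight k (a.unop : B)) fun _ hx => A.mul_mem hx a.unop.2
  map_one' := LinearMap.ext fun x => by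
    obtain ⟨b, rfl⟩ := mk_surjective A x
    exact congrArg mk (mul_one b)
  map_mul' a a' := LinearMap.ext fun x => by
    obtain ⟨b, rfl⟩ := mk_surjective A x
    exact congrArg mk (mul_assoc b (a'.unop : B) a.unop).symm
  map_zero' := LinearMap.ext fun x => by
    obtain ⟨b, rfl⟩ := mk_surjective A x
    exact congrArg mk (mul_zero b)
  map_add' a a' := LinearMap.ext fun x => by
    obtain ⟨b, rfl⟩ := mk_surjective A x
    exact congrArg mk (mul_add b (a.unop : B) a'.unop)

instance : Module A (BimodQuot A) := Module.compHom _ (leftMul A)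

instance : Module Aᵐᵒᵖ (BimodQuot A) := Module.compHom _ (rightMul A)

lemma smul_mk (a : A) (b : B) : a • mk (A := A) b = mk ((a : B) * b) := rfl

lemma op_smul_mk (a : A) (b : B) : MulOpposite.op a • mk (A := A) b = mk (b * (a : B)) := rfl

instance : IsScalarTower k A (BimodQuot A) where
  smul_assoc r a x := by
    obtain ⟨b, rfl⟩ := mk_surjective A x
    rw [smul_mk, smul_mk, ← map_smul]
    exact congrArg mk (smul_mul_assoc r (a : B) b)

instance : IsScalarTower k Aᵐᵒᵖ (BimodQuot A) where
  smul_assoc r a x := by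
    obtain ⟨b, rfl⟩ := mk_surjective A x
    obtain ⟨a, rfl⟩ := MulOpposite.op_surjective a
    rw [← MulOpposite.op_smul, op_smul_mk, op_smul_mk, ← map_smul]
    exact congrArg mk (mul_smul_comm r b (a : B))

end BimodQuot
end quotient

namespace Mold
variable {n d : ℕ} {X : Scheme.{u}}

lemma evalMat_res {U V : X.Opens} (h : V ≤ U) {x : X} (hx : x ∈ V) (m : MatSec n X U) :
    (X.evaluation V x hx).hom.mapMatrix (resMat h m) =
      (X.evaluation U x (h hx)).hom.mapMatrix m := by
  have : X.presheaf.map (homOfLE h).op ≫ X.evaluation V x hx = X.evaluation U x (h hx) := by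
    rw [← Scheme.germ_residue, ← Scheme.germ_residue, ← Category.assoc, TopCat.Presheaf.germ_res]
  exact congrArg (fun f => f.hom.mapMatrix m) this

/-- The fibre `A(x) ⊆ Mₙ(k(x))` of a mold at a point, i.e. the image of `A ⊗ k(x)`: the
`k(x)`-subspace spanned by the values at `x` of the sections of `A` near `x`. -/
noncomputable def fiber (A : Mold n d X) (x : X) :
    Subalgebra (X.residueField x) (Matrix (Fin n) (Fin n) (X.residueField x)) :=
  (Submodule.span (X.residueField x)
    {m | ∃ (U : X.Opens) (hx : x ∈ U), ∃ s ∈ A.sec U,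
      (X.evaluation U x hx).hom.mapMatrix s = m}).toSubalgebra
    (Submodule.subset_span ⟨⊤, trivial, 1, one_mem _, map_one _⟩)
    (fun a b ha hb => by
      have := Submodule.mul_mem_mul ha hb
      rw [Submodule.span_mul_span] at this
      refine Submodule.span_mono ?_ this
      rintro _ ⟨_, ⟨U, hU, s, hs, rfl⟩, _, ⟨V, hV, t, ht, rfl⟩, rfl⟩
      refine ⟨U ⊓ V, ⟨hU, hV⟩, resMat inf_le_left s * resMat inf_le_right t,
        mul_mem (A.res_mem _ hs) (A.res_mem _ ht), ?_⟩
      rw [map_mul]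
      exact congrArg₂ (· * ·) (evalMat_res inf_le_left ⟨hU, hV⟩ s)
        (evalMat_res inf_le_right ⟨hU, hV⟩ t))

end Mold

/-! The morphism `orbitMap A` is locally of finite presentation, so it is smooth exactly when it has
the infinitesimal lifting property, and for this it is enough to test square zero thickenings of
spectra of local rings (`Smooth.hasLocalLifts`, `Smooth.of_hasLocalLifts`). In terms of molds
(`hasLocalLifts_orbitMap_iff`) the test reads as follows. Let `R → T` be a surjection of local rings
whose kernel `I` has square zero, let `Spec R → S` be a morphism, `B` a mold on `Spec R`, and `P` a
point of PGLₙ over `T` with `B_T = P⁻¹ A_T P`. Then `P` must lift to a point `Q` over `R` with `B =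
Q⁻¹ A_R Q`.

Suppose that the cohomology vanishes. Lift `P` to any invertible matrix over `R`. After conjugation
by it, `A_R` and `B` agree modulo `I`. A basis `a i` of `A_R` can be corrected to elements `a i + F
i` of `B`, with `F i` in a fixed complement of `A_R` and with entries in `I`. As `I ^ 2 = 0`,
closure of `B` under multiplication says that `a i ↦ F i` is a Hochschild 1-cocycle with values in
`Mₙ/A`. If `F i = a i * X - X * a i` modulo `A`, then `1 + X` conjugates `B` to `A_R`, and
multiplying the first lift by `1 + X` gives `Q` (`exists_conj_of_hasContraction`,
`exists_lift_of_hasContraction`).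

The hypothesis concerns cocycles over `k(x)`, whereas this cocycle has coefficients in an ideal of
`R`. To pass from one to the other, the complex is written with matrices `D₀`, `D₁` compatible with
base change. Exactness over `k(x)` gives `D₀ S₀ + S₁ D₁ = 1`. Arbitrary lifts of `S₀`, `S₁` to the
local ring of `S` at `x` make this expression invertible, and invertibility survives the map from
that ring to `R`. Cayley–Hamilton then solves the cocycle equation with coefficients in any ideal
(`Matrix.exists_mulVec_eq_of_homotopy`).

Conversely, let `F` be a cocycle over `K = k(x)`. The elements `a i + ε F i` span a mold over the
dual numbers `K[ε]` which reduces to `A(x)`. Lifting the identity of PGLₙ gives a matrix `1 + ε Y`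
carrying this mold to the constant one, and comparing coefficients of `ε` shows that `F` is the
coboundary of the class of `Y` (`exists_diffZero_of_lifts`). -/

section LinearAlgebra

/-! ### Three-term complexes and homotopies up to an invertible matrix -/

/-- A three-term complex over a field that is exact in the middle is split there. -/
lemma LinearMap.exists_homotopy_of_exact {K V W Z : Type*} [Field K] [AddCommGroup V] [Module K V]
    [AddCommGroup W] [Module K W] [AddCommGroup Z] [Module K Z] (f : V →ₗ[K] W) (g : W →ₗ[K] Z)
    (h : Function.Exact f g) :
    ∃ (s : W →ₗ[K] V) (t : Z →ₗ[K] W), f ∘ₗ s + t ∘ₗ g = LinearMap.id := by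
  obtain ⟨σ, hσ⟩ := f.rangeRestrict.exists_rightInverse_of_surjective f.range_rangeRestrict
  obtain ⟨π, hπ⟩ := (LinearMap.range f).subtype.exists_leftInverse_of_injective
    (Submodule.ker_subtype _)
  obtain ⟨ρ, hρ⟩ := g.rangeRestrict.exists_rightInverse_of_surjective g.range_rangeRestrict
  obtain ⟨r, hr⟩ := ρ.exists_extend
  have hf : ∀ w, f (σ (π w)) = π w := fun w => congrArg Subtype.val (LinearMap.congr_fun hσ (π w))
  have hg : ∀ w, g (r (g w)) = g w := fun w => by
    have h1 := LinearMap.congr_fun hr (g.rangeRestrict w)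
    have h2 := congrArg Subtype.val (LinearMap.congr_fun hρ (g.rangeRestrict w))
    change r (g w) = _ at h1
    rw [h1]
    exact h2
  have hz : ∀ w, g w = 0 → (π w : W) = w := fun w hw => by
    obtain ⟨v, rfl⟩ := (h w).1 hw
    exact congrArg Subtype.val (LinearMap.congr_fun hπ ⟨f v, v, rfl⟩)
  -- The vector `r (g w) - w` lies in `ker g = range f`, where `π` is the identity. So the
  -- projection `1 - π` takes the same value on `r (g w)` and on `w`, and `f s + t g = π + (1 - π)`.
  refine ⟨σ ∘ₗ π, (LinearMap.id - (LinearMap.range f).subtype ∘ₗ π) ∘ₗ r, LinearMap.ext fun w => ?_⟩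
  have := hz (r (g w) - w) (by rw [map_sub, hg, sub_self])
  rw [map_sub] at this
  simp only [LinearMap.add_apply, LinearMap.comp_apply, LinearMap.sub_apply, LinearMap.id_apply,
    hf, Submodule.subtype_apply]
  have h3 : r (g w) - (π (r (g w)) : W) = w - (π w : W) := by
    rw [Submodule.coe_sub] at this
    rw [← sub_eq_zero] at this ⊢
    rw [← neg_eq_zero, ← this]
    abel
  rw [h3]; abel

open Matrix in
/-- If a complex of free modules `R^a → R^b → R^c` admits a contracting homotopy in the middle up to
an invertible matrix, then its cocycles with coefficients in an ideal are coboundaries. -/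
lemma Matrix.exists_mulVec_eq_of_homotopy {R α β γ : Type*} [CommRing R] [Fintype α] [Fintype β]
    [Fintype γ] [DecidableEq β] {D₀ : Matrix β α R} {D₁ : Matrix γ β R} (hD : D₁ * D₀ = 0)
    {S₀ : Matrix α β R} {S₁ : Matrix β γ R} (hU : IsUnit (D₀ * S₀ + S₁ * D₁).det) (I : Ideal R)
    {f : β → R} (hfI : ∀ b, f b ∈ I) (hf : D₁ *ᵥ f = 0) :
    ∃ v : α → R, (∀ a, v a ∈ I) ∧ D₀ *ᵥ v = f := by
  set U := D₀ * S₀ + S₁ * D₁ with hUdef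
  -- The coboundaries of cochains with coefficients in `I`.
  let B : Submodule R (β → R) := (Submodule.pi Set.univ fun _ : α => I).map D₀.mulVecLin
  have hclS : ∀ g : β → R, (∀ i, g i ∈ I) → ∀ k, (S₀ *ᵥ g) k ∈ I := fun g hg k =>
    Submodule.sum_mem _ fun i _ => I.mul_mem_left _ (hg i)
  have hclU : ∀ g : β → R, (∀ i, g i ∈ I) → ∀ k, (U *ᵥ g) k ∈ I := fun g hg k =>
    Submodule.sum_mem _ fun i _ => I.mul_mem_left _ (hg i)
  have hstep : ∀ g : β → R, (∀ b, g b ∈ I) → D₁ *ᵥ g = 0 → U *ᵥ g ∈ B := fun g hg hg0 => by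
    refine ⟨S₀ *ᵥ g, fun a _ => hclS g hg a, ?_⟩
    rw [Matrix.mulVecLin_apply, hUdef, Matrix.add_mulVec, ← Matrix.mulVec_mulVec,
      ← Matrix.mulVec_mulVec, hg0, Matrix.mulVec_zero, add_zero]
  -- This identity makes `U` preserve cocycles. It gives nothing of the kind for `U⁻¹`, since `D₁ *
  -- S₁` need not be invertible.
  have hcomm : D₁ * U = (D₁ * S₁) * D₁ := by
    rw [hUdef, Matrix.mul_add, ← Matrix.mul_assoc, hD, Matrix.zero_mul, zero_add, Matrix.mul_assoc]
  have hpow : ∀ k : ℕ, (∀ b, ((U ^ k) *ᵥ f) b ∈ I) ∧ D₁ *ᵥ ((U ^ k) *ᵥ f) = 0 := by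
    intro k
    induction k with
    | zero => simpa using ⟨hfI, hf⟩
    | succ k ih =>
      rw [pow_succ', ← Matrix.mulVec_mulVec]
      refine ⟨hclU _ ih.1, ?_⟩
      rw [Matrix.mulVec_mulVec, hcomm, ← Matrix.mulVec_mulVec, ih.2, Matrix.mulVec_zero]
  have hq : ∀ q : Polynomial R, (Polynomial.aeval U (q * Polynomial.X)) *ᵥ f ∈ B := by
    intro q
    induction q using Polynomial.induction_on' with
    | add p q hp hq => rw [add_mul, map_add, Matrix.add_mulVec]; exact add_mem hp hq
    | monomial k r =>
      rw [map_mul, Polynomial.aeval_monomial, Polynomial.aeval_X, mul_assoc, ← pow_succ, pow_succ',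
        Algebra.algebraMap_eq_smul_one, smul_mul_assoc, one_mul, Matrix.smul_mulVec,
        ← Matrix.mulVec_mulVec]
      exact Submodule.smul_mem _ _ (hstep _ (hpow k).1 (hpow k).2)
  have hc : IsUnit (U.charpoly.coeff 0) := by
    rw [Matrix.det_eq_sign_charpoly_coeff] at hU
    exact isUnit_of_mul_isUnit_right hU
  -- Cayley–Hamilton replaces `U⁻¹` by a polynomial in `U`: a unit multiple of `f` is minus the
  -- value at `f` of a polynomial in `U` without constant term. Each of its terms has the form `U`
  -- applied to a cocycle, which is a coboundary because `S₁ D₁` kills cocycles.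
  have hCH := Matrix.aeval_self_charpoly U
  rw [← Polynomial.divX_mul_X_add U.charpoly, map_add, Polynomial.aeval_C,
    Algebra.algebraMap_eq_smul_one] at hCH
  have h1 := congrArg (fun M : Matrix β β R => M *ᵥ f) hCH
  simp only [Matrix.add_mulVec, Matrix.zero_mulVec, Matrix.smul_mulVec, Matrix.one_mulVec] at h1
  have h2 : U.charpoly.coeff 0 • f ∈ B := by
    rw [add_comm] at h1
    rw [eq_neg_of_add_eq_zero_left h1]
    exact neg_mem (hq _)
  obtain ⟨c, hc⟩ := hc
  have h3 : f ∈ B := by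
    have := B.smul_mem (↑c⁻¹ : R) h2
    rwa [← hc, smul_smul, Units.inv_mul, one_smul] at this
  obtain ⟨v, hv, hvf⟩ := h3
  exact ⟨v, fun a => hv a trivial, hvf⟩

/-- A contracting homotopy over the residue field lifts, up to an invertible matrix, along a
surjective local homomorphism. -/
lemma Matrix.exists_homotopy_lift {R K α β γ : Type*} [CommRing R] [CommRing K] [Fintype α]
    [Fintype β] [Fintype γ] [DecidableEq β] (φ : R →+* K) [IsLocalHom φ]
    (hφ : Function.Surjective φ) (D₀ : Matrix β α R) (D₁ : Matrix γ β R) {S₀ : Matrix α β K}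
    {S₁ : Matrix β γ K} (h : D₀.map φ * S₀ + S₁ * D₁.map φ = 1) :
    ∃ (T₀ : Matrix α β R) (T₁ : Matrix β γ R), IsUnit (D₀ * T₀ + T₁ * D₁).det := by
  -- Any set-theoretic section will do. The lifted matrices need satisfy no relation, for the
  -- determinant reduces to `1` and `φ` is local.
  choose ψ hψ using hφ
  refine ⟨S₀.map ψ, S₁.map ψ, ?_⟩
  have e₀ : (S₀.map ψ).map φ = S₀ := by ext; simp [hψ]
  have e₁ : (S₁.map ψ).map φ = S₁ := by ext; simp [hψ]
  apply isUnit_of_map_unit φ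
  rw [RingHom.map_det, RingHom.mapMatrix_apply, Matrix.map_add _ (map_add φ), Matrix.map_mul,
    Matrix.map_mul, e₀, e₁, h, Matrix.det_one]
  exact isUnit_one

end LinearAlgebra

/-! ### The Hochschild complex of `Mₙ/A` in coordinates -/

namespace Mold

section Complex
variable {n d : ℕ} {κ R S : Type*} [Fintype κ] [CommRing R] [CommRing S]
  (β : Module.Basis (Fin d ⊕ κ) R (Matrix (Fin n) (Fin n) R))

/-- The combination of the complementary members of a basis with given coefficients. -/
noncomputable def compl : (κ → R) →ₗ[R] Matrix (Fin n) (Fin n) R where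
  toFun v := ∑ j, v j • β (Sum.inr j)
  map_add' v w := by simp [add_smul, Finset.sum_add_distrib]
  map_smul' r v := by simp [Finset.smul_sum, mul_smul]

/-- The complementary coordinates of a matrix. -/
noncomputable def complRepr : Matrix (Fin n) (Fin n) R →ₗ[R] (κ → R) where
  toFun m j := β.repr m (Sum.inr j)
  map_add' m m' := by ext; simp
  map_smul' r m := by ext; simp

omit [Fintype κ] in
lemma complRepr_apply (m : Matrix (Fin n) (Fin n) R) (j : κ) :
    complRepr β m j = β.repr m (Sum.inr j) := rfl

omit [Fintype κ] in
lemma complRepr_inl (i : Fin d) : complRepr β (β (Sum.inl i)) = 0 :=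
  funext fun j => repr_inl_inr β i j

lemma complRepr_compl (v : κ → R) : complRepr β (compl β v) = v := by
  classical
  ext j
  simp [complRepr_apply, compl, Finsupp.single_apply]

lemma eq_sum_add_compl (m : Matrix (Fin n) (Fin n) R) :
    m = ∑ i, β.repr m (Sum.inl i) • β (Sum.inl i) + compl β (complRepr β m) := by
  conv_lhs => rw [← β.sum_repr m, Fintype.sum_sum_type]
  rfl

lemma mapMatrix_compl (φ : R →+* S) (v : κ → R) :
    φ.mapMatrix (compl β v) = compl (basisMap φ β) (fun j => φ (v j)) := by
  simp only [compl, LinearMap.coe_mk, AddHom.coe_mk, map_sum, mapMatrix_smul, basisMap_apply]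

lemma complRepr_mapMatrix (φ : R →+* S) (m : Matrix (Fin n) (Fin n) R) :
    complRepr (basisMap φ β) (φ.mapMatrix m) = fun j => φ (complRepr β m j) :=
  funext fun j => basisMap_repr β φ m (Sum.inr j)

/-- The first differential of the Hochschild complex of `Mₙ(R)/A` in coordinates, where `A` is
spanned by the first `d` members of the basis. -/
noncomputable def diffZero : (κ → R) →ₗ[R] (Fin d × κ → R) where
  toFun v p := complRepr β (β (Sum.inl p.1) * compl β v - compl β v * β (Sum.inl p.1)) p.2
  map_add' v w := by
    ext p; simp only [map_add, mul_add, add_mul, map_sub, Pi.add_apply, Pi.sub_apply]; ring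
  map_smul' r v := by
    ext p
    simp only [map_smul, Matrix.mul_smul, Matrix.smul_mul, ← smul_sub, RingHom.id_apply,
      Pi.smul_apply]

/-- The second differential of the Hochschild complex of `Mₙ(R)/A` in coordinates. -/
noncomputable def diffOne : (Fin d × κ → R) →ₗ[R] (Fin d × Fin d × κ → R) where
  toFun f p := complRepr β (β (Sum.inl p.1) * compl β (fun j => f (p.2.1, j))
    - ∑ k, β.repr (β (Sum.inl p.1) * β (Sum.inl p.2.1)) (Sum.inl k) • compl β (fun j => f (k, j))
    + compl β (fun j => f (p.1, j)) * β (Sum.inl p.2.1)) p.2.2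
  map_add' f g := by
    have : ∀ i, compl β (fun j => f (i, j) + g (i, j)) =
        compl β (fun j => f (i, j)) + compl β (fun j => g (i, j)) := fun i =>
      map_add (compl β) (fun j => f (i, j)) (fun j => g (i, j))
    ext p
    simp only [Pi.add_apply, this, mul_add, add_mul, map_sub, map_add, Pi.sub_apply, smul_add,
      Finset.sum_add_distrib]
    ring
  map_smul' r f := by
    have : ∀ i, compl β (fun j => r • f (i, j)) = r • compl β (fun j => f (i, j)) := fun i =>
      map_smul (compl β) r (fun j => f (i, j))
    ext p
    simp only [Pi.smul_apply, this, Matrix.mul_smul, Matrix.smul_mul, smul_comm _ r, ← Finset.smul_sum,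
      ← smul_sub, ← smul_add, map_smul, RingHom.id_apply]

lemma diffZero_apply (v : κ → R) (p : Fin d × κ) : diffZero β v p =
    complRepr β (β (Sum.inl p.1) * compl β v - compl β v * β (Sum.inl p.1)) p.2 := rfl

lemma diffOne_apply (f : Fin d × κ → R) (p : Fin d × Fin d × κ) : diffOne β f p =
    complRepr β (β (Sum.inl p.1) * compl β (fun j => f (p.2.1, j))
    - ∑ k, β.repr (β (Sum.inl p.1) * β (Sum.inl p.2.1)) (Sum.inl k) • compl β (fun j => f (k, j))
    + compl β (fun j => f (p.1, j)) * β (Sum.inl p.2.1)) p.2.2 := rfl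

/-- The differentials are built from products and coordinates in the basis, which commute with every
change of scalars. This lets one pair of matrices over the base serve its stalks, residue fields and
all local rings over it. -/
lemma diffZero_map (φ : R →+* S) (v : κ → R) :
    diffZero (basisMap φ β) (fun j => φ (v j)) = fun p => φ (diffZero β v p) := by
  ext p
  rw [diffZero_apply, diffZero_apply, ← mapMatrix_compl, basisMap_apply, ← map_mul, ← map_mul, ← map_sub, complRepr_mapMatrix]

lemma diffOne_map (φ : R →+* S) (f : Fin d × κ → R) :
    diffOne (basisMap φ β) (fun j => φ (f j)) = fun p => φ (diffOne β f p) := by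
  ext p
  rw [diffOne_apply, diffOne_apply]
  simp only [basisMap_apply, ← map_mul, basisMap_repr]
  have hc : ∀ i, compl (basisMap φ β) (fun j => φ (f (i, j))) =
      φ.mapMatrix (compl β fun j => f (i, j)) := fun i => (mapMatrix_compl β φ _).symm
  simp only [hc, ← mapMatrix_smul, ← map_mul, ← map_sub, ← map_add, ← map_sum]
  rw [complRepr_mapMatrix]

/-- The matrix of `diffZero`. -/
noncomputable def matZero [DecidableEq κ] : Matrix (Fin d × κ) κ R := LinearMap.toMatrix' (diffZero β)

/-- The matrix of `diffOne`. -/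
noncomputable def matOne [DecidableEq κ] : Matrix (Fin d × Fin d × κ) (Fin d × κ) R :=
  LinearMap.toMatrix' (diffOne β)

lemma matZero_map [DecidableEq κ] (φ : R →+* S) : matZero (basisMap φ β) = (matZero β).map φ := by
  ext p j
  have e : (Pi.single j 1 : κ → S) = fun i => φ ((Pi.single j 1 : κ → R) i) :=
    funext fun i => by simp [Pi.single_apply, apply_ite φ]
  rw [Matrix.map_apply, matZero, matZero, LinearMap.toMatrix'_apply, LinearMap.toMatrix'_apply, e]
  exact congrFun (diffZero_map β φ (Pi.single j 1)) p

lemma matOne_map [DecidableEq κ] (φ : R →+* S) : matOne (basisMap φ β) = (matOne β).map φ := by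
  ext p j
  have e : (Pi.single j 1 : Fin d × κ → S) = fun i => φ ((Pi.single j 1 : Fin d × κ → R) i) :=
    funext fun i => by simp [Pi.single_apply, apply_ite φ]
  rw [Matrix.map_apply, matOne, matOne, LinearMap.toMatrix'_apply, LinearMap.toMatrix'_apply, e]
  exact congrFun (diffOne_map β φ (Pi.single j 1)) p

/-- The first `d` members of `β` are a basis of the subalgebra `A`. -/
def IsAdapted (A : Subalgebra R (Matrix (Fin n) (Fin n) R)) : Prop :=
  ∀ m, m ∈ A ↔ complRepr β m = 0

variable {β} {A : Subalgebra R (Matrix (Fin n) (Fin n) R)}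

omit [Fintype κ] in
lemma IsAdapted.inl_mem (h : IsAdapted β A) (i : Fin d) : β (Sum.inl i) ∈ A :=
  (h _).2 (complRepr_inl β i)

lemma IsAdapted.eq_sum (h : IsAdapted β A) {m : Matrix (Fin n) (Fin n) R} (hm : m ∈ A) :
    m = ∑ i, β.repr m (Sum.inl i) • β (Sum.inl i) := by
  conv_lhs => rw [eq_sum_add_compl β m, (h m).1 hm, map_zero, add_zero]

/-- The part of `m` that is dropped lies in `A`, and stays there after multiplication by `a`. Thus
the bimodule structure of `Mₙ/A` can be computed on complementary representatives. -/
lemma IsAdapted.complRepr_mul_compl (h : IsAdapted β A) {a : Matrix (Fin n) (Fin n) R} (ha : a ∈ A)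
    (m : Matrix (Fin n) (Fin n) R) :
    complRepr β (a * compl β (complRepr β m)) = complRepr β (a * m) := by
  have : a * m = a * (∑ i, β.repr m (Sum.inl i) • β (Sum.inl i)) + a * compl β (complRepr β m) := by
    rw [← mul_add, ← eq_sum_add_compl]
  rw [this, map_add, (h _).1 (mul_mem ha (Subalgebra.sum_mem _ fun i _ =>
    Subalgebra.smul_mem _ (h.inl_mem i) _)), zero_add]

lemma IsAdapted.complRepr_compl_mul (h : IsAdapted β A) {a : Matrix (Fin n) (Fin n) R} (ha : a ∈ A)
    (m : Matrix (Fin n) (Fin n) R) :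
    complRepr β (compl β (complRepr β m) * a) = complRepr β (m * a) := by
  have : m * a = (∑ i, β.repr m (Sum.inl i) • β (Sum.inl i)) * a + compl β (complRepr β m) * a := by
    rw [← add_mul, ← eq_sum_add_compl]
  rw [this, map_add, (h _).1 (mul_mem (Subalgebra.sum_mem _ fun i _ =>
    Subalgebra.smul_mem _ (h.inl_mem i) _) ha), zero_add]

/-- Modulo `A` this is the fact that `a ↦ a V - V a` is a derivation. Multiplicative closure of `A`
enters twice: it allows the complementary representatives to be replaced by the commutators
themselves, and it expands `β (inl i) * β (inl i')` in the first `d` basis members only. -/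
lemma IsAdapted.diffOne_diffZero (h : IsAdapted β A) (v : κ → R) :
    diffOne β (diffZero β v) = 0 := by
  ext ⟨i, i', j⟩
  set V := compl β v
  have hd : ∀ i, (fun j => diffZero β v (i, j)) =
      complRepr β (β (Sum.inl i) * V - V * β (Sum.inl i)) := fun i => rfl
  change complRepr β _ j = 0
  simp only [hd]
  have hs : complRepr β (∑ k, β.repr (β (Sum.inl i) * β (Sum.inl i')) (Sum.inl k) •
      compl β (complRepr β (β (Sum.inl k) * V - V * β (Sum.inl k)))) =
      complRepr β ((β (Sum.inl i) * β (Sum.inl i')) * V - V * (β (Sum.inl i) * β (Sum.inl i'))) := by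
    conv_rhs => rw [h.eq_sum (mul_mem (h.inl_mem i) (h.inl_mem i')), Finset.sum_mul,
      Finset.mul_sum, ← Finset.sum_sub_distrib]
    simp only [map_sum, map_smul, complRepr_compl, Matrix.smul_mul, Matrix.mul_smul, ← smul_sub]
  rw [map_add, map_sub, h.complRepr_mul_compl (h.inl_mem i), h.complRepr_compl_mul (h.inl_mem i'),
    hs, ← map_sub, ← map_add]
  have : (β (Sum.inl i) * (β (Sum.inl i') * V - V * β (Sum.inl i')) -
      (β (Sum.inl i) * β (Sum.inl i') * V - V * (β (Sum.inl i) * β (Sum.inl i'))) +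
      (β (Sum.inl i) * V - V * β (Sum.inl i)) * β (Sum.inl i')) = 0 := by noncomm_ring
  rw [this, map_zero]; rfl

lemma IsAdapted.matOne_mul_matZero [DecidableEq κ] (h : IsAdapted β A) :
    matOne β * matZero β = 0 := by
  rw [matOne, matZero, ← LinearMap.toMatrix'_comp, ← map_zero LinearMap.toMatrix']
  congr 1
  exact LinearMap.ext h.diffOne_diffZero

/-- Cocycles with coefficients in any ideal are coboundaries. -/
def HasContraction [DecidableEq κ] (β : Module.Basis (Fin d ⊕ κ) R (Matrix (Fin n) (Fin n) R)) :
    Prop :=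
  ∃ (S₀ : Matrix κ (Fin d × κ) R) (S₁ : Matrix (Fin d × κ) (Fin d × Fin d × κ) R),
    IsUnit (matZero β * S₀ + S₁ * matOne β).det

/-- Exactness need not survive a change of scalars, but an identity between matrices with a unit
determinant does. This is the reason for the form of `HasContraction`. -/
lemma HasContraction.map [DecidableEq κ] (h : HasContraction β) (φ : R →+* S) :
    HasContraction (basisMap φ β) := by
  obtain ⟨S₀, S₁, h⟩ := h
  refine ⟨S₀.map φ, S₁.map φ, ?_⟩
  rw [matZero_map, matOne_map, ← Matrix.map_mul, ← Matrix.map_mul, ← Matrix.map_add _ (map_add φ),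
    ← RingHom.mapMatrix_apply, ← RingHom.map_det]
  exact h.map φ

/-- Over the field an exact complex splits. The splitting lifts entrywise, and the homotopy remains
invertible because `φ` is local. -/
lemma hasContraction_of_exact [DecidableEq κ] {K : Type*} [Field K] (φ : R →+* K) [IsLocalHom φ]
    (hφ : Function.Surjective φ)
    (h : Function.Exact (diffZero (basisMap φ β)) (diffOne (basisMap φ β))) :
    HasContraction β := by
  obtain ⟨s, t, hst⟩ := LinearMap.exists_homotopy_of_exact _ _ h
  refine Matrix.exists_homotopy_lift φ hφ _ _ (S₀ := LinearMap.toMatrix' s)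
    (S₁ := LinearMap.toMatrix' t) ?_
  rw [← matZero_map, ← matOne_map, matZero, matOne, ← LinearMap.toMatrix'_comp,
    ← LinearMap.toMatrix'_comp, ← map_add, hst, LinearMap.toMatrix'_id]

lemma HasContraction.exists_diffZero_eq [DecidableEq κ] (hc : HasContraction β)
    (h : IsAdapted β A) (I : Ideal R) {f : Fin d × κ → R} (hf : ∀ p, f p ∈ I)
    (h0 : diffOne β f = 0) : ∃ v : κ → R, (∀ j, v j ∈ I) ∧ diffZero β v = f := by
  obtain ⟨S₀, S₁, hU⟩ := hc
  obtain ⟨v, hv, hvf⟩ := Matrix.exists_mulVec_eq_of_homotopy h.matOne_mul_matZero hU I hf (by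
    rw [matOne, LinearMap.toMatrix'_mulVec, h0])
  exact ⟨v, hv, by rwa [matZero, LinearMap.toMatrix'_mulVec] at hvf⟩

end Complex
end Mold

/-! ### Deforming a subalgebra along a square zero ideal -/

namespace Mold

section Deformation
variable {n d : ℕ} {κ R : Type*} [Fintype κ] [CommRing R]
  {β : Module.Basis (Fin d ⊕ κ) R (Matrix (Fin n) (Fin n) R)}
  {B : Subalgebra R (Matrix (Fin n) (Fin n) R)}

/-- Over a local ring, `d` elements of a subalgebra with an adapted basis span it if they are
linearly independent over the residue field. -/
lemma IsAdapted.exists_eq_sum {K : Type*} [Field K] (φ : R →+* K) [IsLocalHom φ]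
    (h : IsAdapted β B) {b : Fin d → Matrix (Fin n) (Fin n) R} (hb : ∀ i, b i ∈ B)
    (hli : LinearIndependent K fun i => φ.mapMatrix (b i)) {m : Matrix (Fin n) (Fin n) R}
    (hm : m ∈ B) : ∃ t : Fin d → R, m = ∑ i, t i • b i := by
  let N : Matrix (Fin d) (Fin d) R := Matrix.of fun i k => β.repr (b i) (Sum.inl k)
  have hN : ∀ i, b i = ∑ k, N i k • β (Sum.inl k) := fun i => h.eq_sum (hb i)
  -- If the determinant vanished in `K`, a vector killed by the reduction of `N` from the left would
  -- be a linear relation between the reductions of the `b i`.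
  have hdet : IsUnit N.det := by
    apply isUnit_of_map_unit φ
    rw [isUnit_iff_ne_zero, RingHom.map_det]
    intro h0
    obtain ⟨w, hw0, hw⟩ := Matrix.exists_vecMul_eq_zero_iff.2 h0
    refine hw0 (funext fun i => Fintype.linearIndependent_iff.1 hli w ?_ i)
    have : ∀ i, φ.mapMatrix (b i) = ∑ k, φ (N i k) • φ.mapMatrix (β (Sum.inl k)) := fun i => by
      conv_lhs => rw [hN, map_sum]
      simp only [mapMatrix_smul]
    simp only [this, Finset.smul_sum, smul_smul]
    rw [Finset.sum_comm]
    refine Finset.sum_eq_zero fun k _ => ?_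
    rw [← Finset.sum_smul]
    have hk := congrFun hw k
    change ∑ i, w i * φ (N i k) = 0 at hk
    rw [hk, zero_smul]
  have hβ : ∀ k, β (Sum.inl k) = ∑ i, N⁻¹ k i • b i := fun k => by
    simp only [hN, Finset.smul_sum, smul_smul]
    rw [Finset.sum_comm]
    simp_rw [← Finset.sum_smul, ← Matrix.mul_apply, Matrix.nonsing_inv_mul _ hdet, Matrix.one_apply]
    simp
  refine ⟨fun i => ∑ k, β.repr m (Sum.inl k) * N⁻¹ k i, ?_⟩
  conv_lhs => rw [h.eq_sum hm]
  simp only [hβ, Finset.smul_sum, Finset.sum_smul, smul_smul]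
  rw [Finset.sum_comm]

/-- A matrix with entries in an ideal. -/
def EntriesIn (I : Ideal R) (m : Matrix (Fin n) (Fin n) R) : Prop := ∀ p q, m p q ∈ I

namespace EntriesIn
variable {I : Ideal R} {m m' : Matrix (Fin n) (Fin n) R}

lemma add (h : EntriesIn I m) (h' : EntriesIn I m') : EntriesIn I (m + m') :=
  fun p q => add_mem (h p q) (h' p q)

lemma neg (h : EntriesIn I m) : EntriesIn I (-m) := fun p q => neg_mem (h p q)

lemma sub (h : EntriesIn I m) (h' : EntriesIn I m') : EntriesIn I (m - m') :=
  fun p q => sub_mem (h p q) (h' p q)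

lemma smul (h : EntriesIn I m) (r : R) : EntriesIn I (r • m) := fun p q => I.mul_mem_left r (h p q)

lemma sum {ι : Type*} [Fintype ι] {f : ι → Matrix (Fin n) (Fin n) R} (h : ∀ i, EntriesIn I (f i)) :
    EntriesIn I (∑ i, f i) := fun p q => by
  rw [Matrix.sum_apply]; exact Submodule.sum_mem _ fun i _ => h i p q

lemma mul_left (h : EntriesIn I m) (m' : Matrix (Fin n) (Fin n) R) : EntriesIn I (m' * m) :=
  fun p q => by
    rw [Matrix.mul_apply]; exact Submodule.sum_mem _ fun i _ => I.mul_mem_left _ (h i q)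

lemma mul_right (h : EntriesIn I m) (m' : Matrix (Fin n) (Fin n) R) : EntriesIn I (m * m') :=
  fun p q => by
    rw [Matrix.mul_apply]; exact Submodule.sum_mem _ fun i _ => I.mul_mem_right _ (h p i)

lemma repr_mem {ι : Type*} (h : EntriesIn I m)
    (β : Module.Basis ι R (Matrix (Fin n) (Fin n) R)) (i : ι) : β.repr m i ∈ I := by
  rw [Matrix.matrix_eq_sum_single m]
  simp only [map_sum, Finsupp.coe_finsetSum, Finset.sum_apply]
  refine Submodule.sum_mem _ fun p _ => Submodule.sum_mem _ fun q _ => ?_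
  rw [show Matrix.single p q (m p q) = m p q • Matrix.single p q (1 : R) by simp, map_smul]
  exact I.mul_mem_right _ (h p q)

lemma compl {v : κ → R} (h : ∀ j, v j ∈ I)
    (β : Module.Basis (Fin d ⊕ κ) R (Matrix (Fin n) (Fin n) R)) : EntriesIn I (compl β v) :=
  sum fun j _ _ => I.mul_mem_right _ (h j)

lemma mapMatrix_eq_zero {S : Type*} [CommRing S] {φ : R →+* S} (h : EntriesIn (RingHom.ker φ) m) :
    φ.mapMatrix m = 0 := by
  ext p q; exact h p q

lemma mono {J : Ideal R} (hJ : I ≤ J) (h : EntriesIn I m) : EntriesIn J m := fun p q => hJ (h p q)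

lemma smul_eq_zero (hI : I ^ 2 = ⊥) {r : R} (hr : r ∈ I) (h : EntriesIn I m) : r • m = 0 := by
  ext p q
  have : r * m p q ∈ I ^ 2 := by rw [pow_two]; exact Ideal.mul_mem_mul hr (h p q)
  rw [hI] at this
  exact this

lemma mul_eq_zero (hI : I ^ 2 = ⊥) (h : EntriesIn I m) (h' : EntriesIn I m') : m * m' = 0 := by
  ext p q
  rw [Matrix.mul_apply]
  refine Finset.sum_eq_zero fun i _ => ?_
  have : m p i * m' i q ∈ I ^ 2 := by rw [pow_two]; exact Ideal.mul_mem_mul (h p i) (h' i q)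
  rw [hI] at this
  exact this

end EntriesIn

variable {κ' : Type*} [Fintype κ']
  {α : Module.Basis (Fin d ⊕ κ') R (Matrix (Fin n) (Fin n) R)}
  {A : Subalgebra R (Matrix (Fin n) (Fin n) R)}

/-- If the cocycles of `A` with coefficients in a square zero ideal `I` are coboundaries, every
subalgebra `B` which agrees with `A` modulo `I` is conjugate to `A` by a matrix congruent to `1`. -/
theorem exists_conj_of_hasContraction [IsLocalRing R] [DecidableEq κ'] {I : Ideal R}
    (hI : I ^ 2 = ⊥) (hα : IsAdapted α A) (hc : HasContraction α) (hβ : IsAdapted β B)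
    (hAB : ∀ a ∈ A, ∀ j, complRepr β a j ∈ I) :
    ∃ X : Matrix (Fin n) (Fin n) R, EntriesIn I X ∧ ∀ m, m ∈ B ↔ (1 + X) * m * (1 - X) ∈ A := by
  -- A square zero ideal of a nontrivial ring is proper, hence vanishes in the residue field. Tuples
  -- congruent to `a` modulo `I` therefore stay linearly independent there.
  have hIm : I ≤ RingHom.ker (IsLocalRing.residue R) := by
    rw [IsLocalRing.ker_residue]
    refine IsLocalRing.le_maximalIdeal fun h => ?_
    rw [h, Ideal.top_pow] at hI
    exact top_ne_bot hI
  set a : Fin d → Matrix (Fin n) (Fin n) R := fun i => α (Sum.inl i) with ha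
  have haA : ∀ i, a i ∈ A := hα.inl_mem
  have hres : ∀ {b : Fin d → Matrix (Fin n) (Fin n) R}, (∀ i, EntriesIn I (b i - a i)) →
      LinearIndependent (IsLocalRing.ResidueField R)
        (fun i => (IsLocalRing.residue R).mapMatrix (b i)) := fun {b} hb => by
    have : (fun i => (IsLocalRing.residue R).mapMatrix (b i)) =
        fun i => basisMap (IsLocalRing.residue R) α (Sum.inl i) := funext fun i => by
      rw [basisMap_apply, ← sub_eq_zero, ← map_sub]
      exact ((hb i).mono hIm).mapMatrix_eq_zero
    rw [this]
    exact (Module.Basis.linearIndependent _).comp _ Sum.inl_injective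
  -- elements of `B` lifting the basis of `A`
  set b' : Fin d → Matrix (Fin n) (Fin n) R :=
    fun i => ∑ k, β.repr (a i) (Sum.inl k) • β (Sum.inl k) with hb'
  have hb'B : ∀ i, b' i ∈ B := fun i =>
    Subalgebra.sum_mem _ fun k _ => Subalgebra.smul_mem _ (hβ.inl_mem k) _
  -- `b' i` is the projection of `a i` to `B` along the complement given by `β`, and `x i` is the
  -- resulting error. It lies in `I` by `hAB`.
  set x : Fin d → Matrix (Fin n) (Fin n) R := fun i => -Mold.compl β (complRepr β (a i)) with hx
  have hxI : ∀ i, EntriesIn I (x i) := fun i => (EntriesIn.compl (hAB _ (haA i)) β).neg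
  have hb'x : ∀ i, b' i = a i + x i := fun i => by
    rw [hx, ← sub_eq_add_neg, eq_sub_iff_add_eq]
    exact (eq_sum_add_compl β (a i)).symm
  set f : Fin d × κ' → R := fun p => complRepr α (x p.1) p.2 with hf
  have hfI : ∀ p, f p ∈ I := fun p => (hxI p.1).repr_mem α _
  set F : Fin d → Matrix (Fin n) (Fin n) R := fun i => Mold.compl α (fun j => f (i, j)) with hF
  have hFI : ∀ i, EntriesIn I (F i) := fun i => EntriesIn.compl (fun j => hfI (i, j)) α
  -- To keep only the part `F i` of the error in the complement of `A`, the component of `x i` along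
  -- the `a k` must be removed while staying in `B`. Its coefficients lie in `I`, so `a k` may be
  -- replaced by `b' k`: the difference is a product of two elements of `I`.
  have hbB : ∀ i, a i + F i ∈ B := fun i => by
    have h1 := eq_sum_add_compl α (x i)
    have h2 : a i + F i = b' i - ∑ k, α.repr (x i) (Sum.inl k) • b' k := by
      have h3 : ∀ k, α.repr (x i) (Sum.inl k) • b' k = α.repr (x i) (Sum.inl k) • a k := fun k => by
        rw [hb'x, smul_add, EntriesIn.smul_eq_zero hI ((hxI i).repr_mem α _) (hxI k), add_zero]
      simp only [h3]
      rw [hb'x, add_sub_assoc, add_right_inj, eq_sub_iff_add_eq, add_comm]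
      exact h1.symm
    rw [h2]
    exact sub_mem (hb'B i) (Subalgebra.sum_mem _ fun k _ => Subalgebra.smul_mem _ (hb'B k) _)
  have hspan : ∀ m ∈ B, ∃ t : Fin d → R, m = ∑ i, t i • (a i + F i) := fun m hm =>
    hβ.exists_eq_sum (IsLocalRing.residue R) hbB (hres fun i => by simpa using hFI i) hm
  have hcoef : ∀ (t : Fin d → R), ∑ i, t i • (a i + F i) =
      ∑ i, t i • a i + Mold.compl α (∑ i, t i • fun j => f (i, j)) := fun t => by
    simp only [smul_add, Finset.sum_add_distrib, map_sum, map_smul, hF]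
  -- The complement of `A` meets `B` trivially: `B` is spanned by the `a i + F i`, and the
  -- coordinates along the `a i` already determine the coefficients.
  have hzero : ∀ y : κ' → R, Mold.compl α y ∈ B → y = 0 := fun y hy => by
    obtain ⟨t, ht⟩ := hspan _ hy
    rw [hcoef] at ht
    have ht0 : ∀ k, t k = 0 := fun k => by
      have := congrArg (fun m => α.repr m (Sum.inl k)) ht
      classical
      simpa [Mold.compl, ha, Finsupp.single_apply] using this.symm
    have := congrArg (complRepr α) ht
    rw [complRepr_compl] at this
    rw [this]
    simp [ht0]
  -- `I`-linear combinations of the `a i` lie in `B`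
  have hIB : ∀ c : Fin d → R, (∀ k, c k ∈ I) → ∑ k, c k • a k ∈ B := fun c hcI => by
    have : ∑ k, c k • a k = ∑ k, c k • (a k + F k) := by
      simp only [smul_add, EntriesIn.smul_eq_zero hI (hcI _) (hFI _), add_zero]
    rw [this]
    exact Subalgebra.sum_mem _ fun k _ => Subalgebra.smul_mem _ (hbB k) _
  -- The matrix `w` represents the coboundary. As `F i * F i' = 0`, it equals a product of two
  -- elements of `B` minus a combination of elements of `B`. Its `A`-component has coefficients in
  -- `I` and so lies in `B` as well. What remains is in the complement and in `B`, hence is zero.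
  have hcocycle : diffOne α f = 0 := by
    ext ⟨i, i', j⟩
    set w := a i * F i' - ∑ k, α.repr (a i * a i') (Sum.inl k) • F k + F i * a i' with hw
    have hwI : EntriesIn I w := (((hFI i').mul_left _).sub (EntriesIn.sum fun k => (hFI k).smul _)).add
      ((hFI i).mul_right _)
    have hwB : w ∈ B := by
      have h1 : w = (a i + F i) * (a i' + F i') -
          ∑ k, α.repr (a i * a i') (Sum.inl k) • (a k + F k) := by
        have h2 := hα.eq_sum (mul_mem (haA i) (haA i'))
        simp only [smul_add, Finset.sum_add_distrib]
        rw [add_mul, mul_add, mul_add, EntriesIn.mul_eq_zero hI (hFI i) (hFI i'), hw]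
        change a i * a i' = ∑ k, _ • a k at h2
        rw [← h2]
        abel
      rw [h1]
      exact sub_mem (mul_mem (hbB i) (hbB i'))
        (Subalgebra.sum_mem _ fun k _ => Subalgebra.smul_mem _ (hbB k) _)
    have h1 := hzero (complRepr α w) (by
      have h2 := eq_sum_add_compl α w
      rw [eq_comm, ← eq_sub_iff_add_eq'] at h2
      rw [h2]
      exact sub_mem hwB (hIB _ fun k => hwI.repr_mem α _))
    exact congrFun h1 j
  obtain ⟨v, hvI, hv⟩ := hc.exists_diffZero_eq hα I hfI hcocycle
  set X := Mold.compl α v with hX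
  have hXI : EntriesIn I X := EntriesIn.compl hvI α
  have hXX : X * X = 0 := EntriesIn.mul_eq_zero hI hXI hXI
  have h₁ : (1 - X) * (1 + X) = 1 := by
    rw [sub_mul, mul_add, mul_add, hXX]; simp
  have h₂ : (1 + X) * (1 - X) = 1 := by
    rw [add_mul, mul_sub, mul_sub, hXX]; simp
  have hg : ∀ i, (1 - X) * a i * (1 + X) = a i + (a i * X - X * a i) := fun i => by
    rw [sub_mul, sub_mul, mul_add, mul_add, one_mul, mul_one, mul_one,
      EntriesIn.mul_eq_zero hI (hXI.mul_right (a i)) hXI]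
    abel
  have hsI : ∀ i, EntriesIn I (a i * X - X * a i) := fun i =>
    (hXI.mul_left _).sub (hXI.mul_right _)
  -- Here the choice of `X` is used: `a i * X - X * a i` has complementary part `F i`, and its other
  -- part is an `I`-combination of the `a k`. Thus the conjugates of the `a i` lie in `B`, and being
  -- congruent to the `a i` modulo `I` they span it.
  have hgB : ∀ i, (1 - X) * a i * (1 + X) ∈ B := fun i => by
    have h1 : complRepr α (a i * X - X * a i) = fun j => f (i, j) :=
      funext fun j => congrFun hv (i, j)
    have h2 := eq_sum_add_compl α (a i * X - X * a i)
    rw [h1] at h2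
    rw [hg, h2, add_comm (∑ k, _), ← add_assoc]
    exact add_mem (hbB i) (hIB _ fun k => (hsI i).repr_mem α _)
  refine ⟨X, hXI, fun m => ⟨fun hm => ?_, fun hm => ?_⟩⟩
  · obtain ⟨t, rfl⟩ := hβ.exists_eq_sum (IsLocalRing.residue R) hgB
      (hres fun i => by rw [hg, add_sub_cancel_left]; exact hsI i) hm
    rw [Finset.mul_sum, Finset.sum_mul]
    refine Subalgebra.sum_mem _ fun i _ => ?_
    rw [Matrix.mul_smul, Matrix.smul_mul]
    refine Subalgebra.smul_mem _ ?_ _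
    have : (1 + X) * ((1 - X) * a i * (1 + X)) * (1 - X) = a i := by
      calc _ = ((1 + X) * (1 - X)) * a i * ((1 + X) * (1 - X)) := by simp only [mul_assoc]
        _ = _ := by rw [h₂, one_mul, mul_one]
    rw [this]
    exact haA i
  · have : m = (1 - X) * ((1 + X) * m * (1 - X)) * (1 + X) := by
      calc m = ((1 - X) * (1 + X)) * m * ((1 - X) * (1 + X)) := by rw [h₁, one_mul, mul_one]
        _ = _ := by simp only [mul_assoc]
    rw [this, hα.eq_sum hm, Finset.mul_sum, Finset.sum_mul]
    refine Subalgebra.sum_mem _ fun i _ => ?_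
    rw [Matrix.mul_smul, Matrix.smul_mul]
    exact Subalgebra.smul_mem _ (hgB i) _

end Deformation
end Mold

-- Generators of the coordinate ring of PGLₙ

attribute [local instance] MvPolynomial.gradedAlgebra

namespace PGL

section generation
variable {n : ℕ}

section eval
variable {R : Type*} [CommRing R]

/-- The evaluation of polynomials at the entries of a matrix. -/
noncomputable def evalPoly (P : Matrix (Fin n) (Fin n) R) : Poly.{u} n →+* R :=
  MvPolynomial.eval₂Hom ((Int.castRingHom R).comp ULift.ringEquiv.toRingHom) (fun t => P t.1 t.2)

lemma evalPoly_X (P : Matrix (Fin n) (Fin n) R) (t : Fin n × Fin n) :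
    evalPoly.{u} P (MvPolynomial.X t) = P t.1 t.2 := by
  simp [evalPoly]

lemma evalPoly_generic (P : Matrix (Fin n) (Fin n) R) :
    (evalPoly.{u} P).mapMatrix (generic.{u} n) = P := by
  ext i j
  simp [evalPoly, generic]

/-- The span of the entries of a matrix. -/
def entrySpan (P : Matrix (Fin n) (Fin n) R) : Submodule ℤ R :=
  Submodule.span ℤ (Set.range fun p : Fin n × Fin n => P p.1 p.2)

lemma prod_mem_pow_sum {ι : Type*} (N : Submodule ℤ R) (f : ι → R) (e : ι → ℕ)
    (h : ∀ i, f i ∈ N ^ e i) (s : Finset ι) : ∏ i ∈ s, f i ∈ N ^ ∑ i ∈ s, e i := by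
  classical
  induction s using Finset.induction_on with
  | empty =>
    rw [Finset.prod_empty, Finset.sum_empty, pow_zero]
    exact Submodule.mem_one.2 ⟨1, map_one _⟩
  | insert i s hi ih =>
    rw [Finset.prod_insert hi, Finset.sum_insert hi, pow_add]
    exact Submodule.mul_mem_mul (h i) ih

lemma evalPoly_mem_entrySpan_pow (P : Matrix (Fin n) (Fin n) R) {m : ℕ} {f : Poly.{u} n}
    (hf : f.IsHomogeneous m) : evalPoly P f ∈ entrySpan P ^ m := by
  rw [f.as_sum, map_sum]
  refine Submodule.sum_mem _ fun v hv => ?_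
  have hdeg : ∑ p ∈ v.support, v p = m := by
    have := hf (MvPolynomial.mem_support_iff.1 hv)
    rw [← this, Finsupp.weight_apply, Finsupp.sum]
    simp
  rw [MvPolynomial.monomial_eq, map_mul]
  have hC : evalPoly P (MvPolynomial.C (MvPolynomial.coeff v f)) =
      ((MvPolynomial.coeff v f).down : R) := by
    simp only [evalPoly, MvPolynomial.coe_eval₂Hom, MvPolynomial.eval₂_C]
    rfl
  rw [hC, ← zsmul_eq_mul]
  refine Submodule.smul_mem _ _ ?_
  rw [Finsupp.prod, map_prod, ← hdeg]
  refine prod_mem_pow_sum _ _ _ (fun p => ?_) _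
  rw [map_pow, evalPoly_X]
  exact Submodule.pow_mem_pow (entrySpan P) (Submodule.subset_span (Set.mem_range_self (f := fun p : Fin n × Fin n => P p.1 p.2) p)) _

lemma det_mem_entrySpan_pow (P : Matrix (Fin n) (Fin n) R) : P.det ∈ entrySpan P ^ n := by
  have h : ∀ σ : Equiv.Perm (Fin n), ∏ i, P (σ i) i ∈ entrySpan P ^ n := fun σ => by
    have := prod_mem_pow_sum (entrySpan P) (fun i => P (σ i) i) (fun _ => 1) (fun i => by
      rw [pow_one]
      exact Submodule.subset_span (Set.mem_range_self (f := fun p : Fin n × Fin n => P p.1 p.2) (σ i, i))) Finset.univ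
    simpa using this
  rw [Matrix.det_apply]
  exact Submodule.sum_mem _ fun σ _ => Submodule.smul_of_tower_mem _ _ (h σ)

/-- The value of `f` is a combination of products of `n * m` entries of `P`, and `Q.det ^ m` is one
of products of `n * m` entries of `Q`. The degrees match, so the factors can be paired into products
`P i k * Q l j`. -/
lemma evalPoly_mul_det_pow_mem {P Q : Matrix (Fin n) (Fin n) R} {T : Subring R}
    (hT : ∀ i k l j, P i k * Q l j ∈ T) {m : ℕ} {f : Poly.{u} n} (hf : f.IsHomogeneous (n * m)) :
    evalPoly P f * Q.det ^ m ∈ T := by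
  have hT' : entrySpan P * entrySpan Q ≤ Subalgebra.toSubmodule (subalgebraOfSubring T) := by
    rw [entrySpan, entrySpan, Submodule.span_mul_span, Submodule.span_le]
    rintro _ ⟨_, ⟨p, rfl⟩, _, ⟨q, rfl⟩, rfl⟩
    exact hT _ _ _ _
  have h2 := Submodule.pow_mem_pow _ (det_mem_entrySpan_pow Q) m
  have h3 := Submodule.mul_mem_mul (evalPoly_mem_entrySpan_pow P hf) h2
  rw [← npow_mul, ← mul_pow] at h3
  have h4 : ∀ k, (entrySpan P * entrySpan Q) ^ k ≤
      Subalgebra.toSubmodule (subalgebraOfSubring T) := fun k => by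
    induction k with
    | zero => rw [pow_zero, Submodule.one_le]; exact one_mem (subalgebraOfSubring T)
    | succ k ih =>
      rw [pow_succ, Submodule.mul_le]
      exact fun a ha b hb => mul_mem (S := Subalgebra ℤ _) (ih ha) (hT' hb)
  exact h4 _ h3

end eval

lemma evalPoly_locMat : evalPoly.{u} locMat.{u} =
    algebraMap (Poly.{u} n) (Localization.Away (generic.{u} n).det) :=
  MvPolynomial.ringHom_ext' (Mold.ulift_int_hom_ext _ _) fun t => by
    rw [evalPoly_X, locMat, Matrix.map_apply, generic, Matrix.mvPolynomialX_apply]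

/-- An element of degree zero is `f / det ^ m` with `f` homogeneous of degree `n * m`, that is, `f`
times the `m`-th power of the determinant of the inverse matrix. The pairing of factors in
`evalPoly_mul_det_pow_mem` applies. Consequently a point of PGLₙ is determined by its values on the
elements `entry`. -/
lemma closure_entry : Subring.closure
    (Set.range fun p : Fin n × Fin n × Fin n × Fin n => entry.{u} p.1 p.2.1 p.2.2.1 p.2.2.2) = ⊤ := by
  set T := Subring.closure
    (Set.range fun p : Fin n × Fin n × Fin n × Fin n => entry.{u} p.1 p.2.1 p.2.2.1 p.2.2.2)
  rw [eq_top_iff]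
  rintro z -
  obtain ⟨m, f, hf, rfl⟩ := HomogeneousLocalization.Away.mk_surjective _ det_mem.{u} z
  have hdet : (locInv.{u} (n := n)).det *
      algebraMap _ (Localization.Away (generic.{u} n).det) (generic.{u} n).det = 1 := by
    have := congrArg Matrix.det (locInv_mul_locMat.{u} (n := n))
    rw [Matrix.det_mul, Matrix.det_one] at this
    rw [RingHom.map_det]
    exact this
  have hval : HomogeneousLocalization.val (HomogeneousLocalization.Away.mk _ det_mem.{u} m f hf) =
      evalPoly.{u} locMat.{u} f * (locInv.{u} (n := n)).det ^ m := by
    rw [HomogeneousLocalization.Away.val_mk, Localization.mk_eq_mk', IsLocalization.mk'_eq_iff_eq_mul,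
      evalPoly_locMat]
    change _ = _ * algebraMap _ _ ((generic.{u} n).det ^ m)
    rw [map_pow, mul_assoc, ← mul_pow, hdet, one_pow, mul_one]
  -- The pairing of factors takes place in the full localization, where single entries of the matrix
  -- and of its inverse exist. `T'` is the image of `T` there, and injectivity of `val` brings the
  -- result back.
  let T' : Subring (Localization.Away (generic.{u} n).det) :=
    { carrier := {x | ∃ t ∈ T, HomogeneousLocalization.val t = x}
      mul_mem' := by
        rintro _ _ ⟨t, ht, rfl⟩ ⟨t', ht', rfl⟩
        exact ⟨t * t', mul_mem ht ht', HomogeneousLocalization.val_mul _ _⟩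
      one_mem' := ⟨1, one_mem _, HomogeneousLocalization.val_one⟩
      add_mem' := by
        rintro _ _ ⟨t, ht, rfl⟩ ⟨t', ht', rfl⟩
        exact ⟨t + t', add_mem ht ht', HomogeneousLocalization.val_add _ _⟩
      zero_mem' := ⟨0, zero_mem _, HomogeneousLocalization.val_zero⟩
      neg_mem' := by
        rintro _ ⟨t, ht, rfl⟩
        exact ⟨-t, neg_mem ht, HomogeneousLocalization.val_neg _⟩ }
  have h := evalPoly_mul_det_pow_mem.{u} (P := locMat.{u} (n := n)) (Q := locInv.{u}) (m := m) (f := f)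
    (T := T')
    (fun i k l j => by
      refine ⟨entry.{u} i k l j, Subring.subset_closure ⟨(i, k, l, j), rfl⟩, ?_⟩
      exact val_entry _ _ _ _)
    (by
      rw [mul_comm]
      exact (MvPolynomial.mem_homogeneousSubmodule _ _).1 hf)
  obtain ⟨t, ht, htv⟩ := h
  rw [← hval] at htv
  rwa [← HomogeneousLocalization.val_injective _ htv]

lemma coordRing_hom_ext {R : Type*} [CommRing R] {f g : CoordRing.{u} n →+* R}
    (h : ∀ i k l j, f (entry i k l j) = g (entry i k l j)) : f = g := by
  refine RingHom.eq_of_eqOn_set_dense closure_entry ?_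
  rintro _ ⟨p, rfl⟩
  exact h _ _ _ _

end generation

/-! ### Points of PGLₙ and invertible matrices -/

section points
variable {n : ℕ} {R S : Type*} [CommRing R] [CommRing S]

/-- The point of `PGLₙ` given by an invertible matrix. -/
noncomputable def ofMatrix (P Q : Matrix (Fin n) (Fin n) R) (h : P * Q = 1) :
    CoordRing.{u} n →+* R :=
  (IsLocalization.Away.lift (S := Localization.Away (generic.{u} n).det) (generic.{u} n).det
    (g := evalPoly.{u} P) (by
      rw [RingHom.map_det, evalPoly_generic]
      exact Matrix.isUnit_det_of_right_inverse h)).comp (algebraMap _ _)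

lemma ofMatrix_entry (P Q : Matrix (Fin n) (Fin n) R) (h : P * Q = 1) (i k l j : Fin n) :
    ofMatrix.{u} P Q h (entry i k l j) = P i k * Q l j := by
  set g := IsLocalization.Away.lift (S := Localization.Away (generic.{u} n).det) (generic.{u} n).det
    (g := evalPoly.{u} P) (by
      rw [RingHom.map_det, evalPoly_generic]
      exact Matrix.isUnit_det_of_right_inverse h) with hg
  have h1 : g.mapMatrix locMat.{u} = P := by
    ext i j
    rw [RingHom.mapMatrix_apply, Matrix.map_apply, locMat, Matrix.map_apply, hg,
      IsLocalization.Away.lift_eq]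
    exact congrFun (congrFun (evalPoly_generic P) i) j
  have h2 : g.mapMatrix locInv.{u} = Q := by
    have := congrArg g.mapMatrix (locInv_mul_locMat.{u} (n := n))
    rw [map_mul, map_one, h1] at this
    calc _ = g.mapMatrix locInv.{u} * (P * Q) := by rw [h, mul_one]
      _ = Q := by rw [← mul_assoc, this, one_mul]
  change g (entry i k l j).val = _
  rw [val_entry, map_mul]
  exact congrArg₂ (· * ·) (congrFun (congrFun h1 i) k) (congrFun (congrFun h2 l) j)

lemma comp_ofMatrix (P Q : Matrix (Fin n) (Fin n) R) (h : P * Q = 1) (φ : R →+* S) :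
    φ.comp (ofMatrix.{u} P Q h) = ofMatrix (φ.mapMatrix P) (φ.mapMatrix Q)
      (by rw [← map_mul, h, map_one]) :=
  coordRing_hom_ext fun i k l j => by
    rw [RingHom.comp_apply, ofMatrix_entry, ofMatrix_entry, map_mul]; rfl

lemma conjAlgEquiv_ofMatrix (P Q : Matrix (Fin n) (Fin n) R) (h : P * Q = 1)
    (m : Matrix (Fin n) (Fin n) R) : conjAlgEquiv (ofMatrix.{u} P Q h) m = P * m * Q := by
  ext i j
  change ∑ k, ∑ l, m k l * ofMatrix.{u} P Q h (entry i k l j) = _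
  simp only [ofMatrix_entry, Matrix.mul_apply, Finset.sum_mul]
  rw [Finset.sum_comm]
  exact Finset.sum_congr rfl fun l _ => Finset.sum_congr rfl fun k _ => by ring

/-- Both sides are the same product of two entries of the generic matrix and two of its inverse.
These relations allow a representing matrix to be recovered from its products with one entry of its
inverse. -/
lemma entry_mul_entry (i k l j i₀ k₀ : Fin n) :
    entry.{u} i k k₀ i₀ * entry i₀ k₀ l j = entry i k l j * entry i₀ k₀ k₀ i₀ := by
  apply HomogeneousLocalization.val_injective
  rw [HomogeneousLocalization.val_mul, HomogeneousLocalization.val_mul]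
  simp only [val_entry]
  ring

/-- A point of `PGLₙ` at which one of the diagonal entries is invertible comes from a matrix. -/
lemma exists_eq_ofMatrix (ψ : CoordRing.{u} n →+* R) (i₀ k₀ : Fin n)
    (hu : IsUnit (ψ (entry i₀ k₀ k₀ i₀))) :
    ∃ (Q : Matrix (Fin n) (Fin n) R) (h : Matrix.of (fun i k => ψ (entry i k k₀ i₀)) * Q = 1),
      ψ = ofMatrix _ Q h := by
  obtain ⟨c, hc⟩ := hu
  -- If `ψ` came from a matrix `M`, the first matrix would be `M` times the scalar `(M⁻¹)_{k₀ i₀}`.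
  -- The witness is `M⁻¹` divided by that scalar: the factor `M_{i₀ k₀}` cancels against `c = M_{i₀
  -- k₀} (M⁻¹)_{k₀ i₀}`.
  refine ⟨Matrix.of fun l j => ψ (entry i₀ k₀ l j) * ↑c⁻¹, ?_, ?_⟩
  · rw [mul_eq_one_comm]
    ext l k
    have := congrArg ψ (entry_mul.{u} i₀ k₀ l k k₀ i₀)
    rw [map_sum, apply_ite ψ, map_zero] at this
    simp only [map_mul] at this
    rw [Matrix.mul_apply, Matrix.one_apply]
    simp only [Matrix.of_apply, mul_right_comm _ _ (ψ _), ← Finset.sum_mul]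
    rw [this]
    split_ifs
    · rw [← hc, Units.mul_inv]
    · rw [zero_mul]
  · refine coordRing_hom_ext fun i k l j => ?_
    rw [ofMatrix_entry, Matrix.of_apply, Matrix.of_apply, ← mul_assoc, ← map_mul, entry_mul_entry,
      map_mul, ← hc, Units.mul_inv_cancel_right]

/-- The diagonal entry at `i₀` of the identity `M M⁻¹ = 1` writes `1` as the sum over `k` of the
values at `entry i₀ k k i₀`. In a local ring one of the summands is a unit. For `n = 0` there are no
entries and nothing to choose. -/
lemma exists_eq_ofMatrix_of_isLocalRing [IsLocalRing R] (ψ : CoordRing.{u} n →+* R) :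
    ∃ (P Q : Matrix (Fin n) (Fin n) R) (h : P * Q = 1), ψ = ofMatrix P Q h := by
  rcases isEmpty_or_nonempty (Fin n) with hn | ⟨⟨i₀⟩⟩
  · exact ⟨1, 1, mul_one 1, coordRing_hom_ext fun i => hn.elim i⟩
  · have h := congrArg ψ (entry_self.{u} i₀ i₀)
    rw [if_pos rfl, map_one, map_sum] at h
    obtain ⟨k₀, hk₀⟩ : ∃ k, IsUnit (ψ (entry i₀ k k i₀)) := by
      by_contra! hne
      have h1 : (1 : R) ∈ IsLocalRing.maximalIdeal R := by
        rw [← h]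
        exact Submodule.sum_mem _ fun k _ => (IsLocalRing.mem_maximalIdeal _).2 (hne k)
      exact (IsLocalRing.mem_maximalIdeal _).1 h1 isUnit_one
    obtain ⟨Q, hQ, e⟩ := exists_eq_ofMatrix ψ i₀ k₀ hk₀
    exact ⟨_, Q, hQ, e⟩

/-- Points of `PGLₙ` lift along surjective local homomorphisms of local rings, with matrices. -/
lemma exists_ofMatrix_lift [IsLocalRing S] (φ : R →+* S) [IsLocalHom φ]
    (hφ : Function.Surjective φ) (ψ : CoordRing.{u} n →+* S) :
    ∃ (P Q : Matrix (Fin n) (Fin n) R) (h : P * Q = 1), φ.comp (ofMatrix P Q h) = ψ := by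
  obtain ⟨P', Q', h, rfl⟩ := exists_eq_ofMatrix_of_isLocalRing ψ
  choose σ hσ using hφ
  have e : φ.mapMatrix (P'.map σ) = P' := by ext; simp [hσ]
  -- The entries of `P'` are lifted arbitrarily. Invertibility is automatic because `φ` is local.
  have hdet : IsUnit (P'.map σ).det := by
    apply isUnit_of_map_unit φ
    rw [RingHom.map_det, e]
    exact Matrix.isUnit_det_of_right_inverse h
  have h1 := Matrix.mul_nonsing_inv _ hdet
  refine ⟨_, _, h1, ?_⟩
  rw [comp_ofMatrix]
  refine coordRing_hom_ext fun i k l j => ?_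
  have e2 : φ.mapMatrix (P'.map σ)⁻¹ = Q' := by
    have := congrArg φ.mapMatrix (Matrix.nonsing_inv_mul _ hdet)
    rw [map_mul, map_one, e] at this
    calc _ = φ.mapMatrix (P'.map σ)⁻¹ * (P' * Q') := by rw [h, mul_one]
      _ = Q' := by rw [← mul_assoc, this, one_mul]
  rw [ofMatrix_entry, ofMatrix_entry, e, e2]

/-- Points of `PGLₙ` reducing to the identity come from matrices reducing to the identity. -/
lemma exists_ofMatrix_of_comp_eq_one (φ : R →+* S) [IsLocalHom φ]
    (ψ : CoordRing.{u} n →+* R) (h : φ.comp ψ = ofMatrix 1 1 (mul_one 1)) :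
    ∃ (P Q : Matrix (Fin n) (Fin n) R) (h : P * Q = 1), ψ = ofMatrix P Q h ∧
      φ.mapMatrix P = 1 := by
  rcases isEmpty_or_nonempty (Fin n) with hn | ⟨⟨i₀⟩⟩
  · exact ⟨1, 1, mul_one 1, coordRing_hom_ext fun i => hn.elim i, map_one _⟩
  · have h1 : ∀ i k, φ (ψ (entry i k i₀ i₀)) = (1 : Matrix (Fin n) (Fin n) S) i k := fun i k => by
      have := congrArg (fun f => f (entry i k i₀ i₀)) h
      simpa [ofMatrix_entry] using this
    -- Normalising at the diagonal position `(i₀, i₀)` makes the representing matrix reduce to the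
    -- identity itself, and not just to a scalar multiple.
    obtain ⟨Q, hQ, e⟩ := exists_eq_ofMatrix ψ i₀ i₀ (by
      apply isUnit_of_map_unit φ
      rw [h1, Matrix.one_apply_eq]
      exact isUnit_one)
    exact ⟨_, Q, hQ, e, by ext i k; exact h1 i k⟩

end points

/-! ### Finiteness of the coordinate rings -/

section finite
variable {n : ℕ}

/-- The finitely many elements `entry` generate the ring, and over the noetherian ring of integers
finite type implies finite presentation. -/
lemma finitePresentation_coordRing (f : ULift.{u} ℤ →+* CoordRing.{u} n) :
    f.FinitePresentation := by
  have : IsNoetherianRing (ULift.{u} ℤ) := isNoetherianRing_of_ringEquiv ℤ ULift.ringEquiv.symm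
  rw [← RingHom.FinitePresentation.of_finiteType]
  let g : MvPolynomial (Fin n × Fin n × Fin n × Fin n) (ULift.{u} ℤ) →+* CoordRing.{u} n :=
    MvPolynomial.eval₂Hom f fun p => entry.{u} p.1 p.2.1 p.2.2.1 p.2.2.2
  have hg : Function.Surjective g := by
    intro z
    have hz : z ∈ Subring.closure (Set.range fun p : Fin n × Fin n × Fin n × Fin n =>
        entry.{u} p.1 p.2.1 p.2.2.1 p.2.2.2) := closure_entry ▸ Subring.mem_top z
    induction hz using Subring.closure_induction with
    | mem z hz =>
      obtain ⟨p, rfl⟩ := hz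
      exact ⟨MvPolynomial.X p, MvPolynomial.eval₂Hom_X' _ _ _⟩
    | zero => exact ⟨0, map_zero g⟩
    | one => exact ⟨1, map_one g⟩
    | add x y _ _ hx hy =>
      obtain ⟨x, rfl⟩ := hx
      obtain ⟨y, rfl⟩ := hy
      exact ⟨x + y, map_add g x y⟩
    | neg x _ hx =>
      obtain ⟨x, rfl⟩ := hx
      exact ⟨-x, map_neg g x⟩
    | mul x y _ _ hx hy =>
      obtain ⟨x, rfl⟩ := hx
      obtain ⟨y, rfl⟩ := hy
      exact ⟨x * y, map_mul g x y⟩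
  have hfg : f = g.comp MvPolynomial.C := Mold.ulift_int_hom_ext _ _
  rw [hfg]
  refine RingHom.FiniteType.comp_surjective ?_ hg
  rw [← MvPolynomial.algebraMap_eq, RingHom.finiteType_algebraMap]
  infer_instance

end finite
end PGL

namespace Mold

lemma finiteType_chartRing {n d : ℕ} (I : Fin d ↪ Fin n × Fin n)
    (f : ULift.{u} ℤ →+* ChartRing.{u} I) : f.FiniteType := by
  have hfg : f = (chartMk I).comp MvPolynomial.C := ulift_int_hom_ext _ _
  rw [hfg]
  refine RingHom.FiniteType.comp_surjective ?_ Ideal.Quotient.mk_surjective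
  rw [← MvPolynomial.algebraMap_eq, RingHom.finiteType_algebraMap]
  infer_instance

end Mold

/-! ### Formal smoothness tested on local rings -/

section algebra

/-- A localization at a prime of an algebra with the infinitesimal lifting property for local rings
is formally smooth, if it is a quotient of a formally smooth local algebra. -/
theorem Algebra.FormallySmooth.localization_of_lift {C B Q : Type u} [CommRing C] [CommRing B]
    [CommRing Q] [IsLocalRing Q] [Algebra C B] [Algebra C Q] [Algebra.FormallySmooth C Q]
    (p : Ideal B) [p.IsPrime] (F : Q →ₐ[C] Localization.AtPrime p) (hF : Function.Surjective F)
    (H : ∀ (R T : Type u) [CommRing R] [CommRing T] [IsLocalRing R] [IsLocalRing T] (φ : R →+* T)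
      (c : C →+* R) (b : B →+* T), Function.Surjective φ → RingHom.ker φ ^ 2 = ⊥ →
      φ.comp c = b.comp (algebraMap C B) →
      ∃ g : B →+* R, φ.comp g = b ∧ g.comp (algebraMap C B) = c) :
    Algebra.FormallySmooth C (Localization.AtPrime p) := by
  have hker : RingHom.ker F.toRingHom ≠ ⊤ := RingHom.ker_ne_top _
  have : Nontrivial (Q ⧸ RingHom.ker F.toRingHom ^ 2) := Ideal.Quotient.nontrivial_iff.2 fun h =>
    hker (top_le_iff.1 (h ▸ Ideal.pow_le_self two_ne_zero))
  have : IsLocalRing (Q ⧸ RingHom.ker F.toRingHom ^ 2) :=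
    .of_surjective' (Ideal.Quotient.mk (RingHom.ker F.toRingHom ^ 2)) Ideal.Quotient.mk_surjective
  have hφ : Function.Surjective F.kerSquareLift :=
    Ideal.Quotient.lift_surjective_of_surjective _ _ hF
  have hφ2 : RingHom.ker F.kerSquareLift.toRingHom ^ 2 = ⊥ := by
    have := AlgHom.ker_kerSquareLift F
    rw [show RingHom.ker F.kerSquareLift.toRingHom = _ from this,
      Ideal.cotangentIdeal_square]
  -- The test is applied to the universal square zero thickening, the quotient of `Q` by the square
  -- of the kernel of `F`, over the localization. Both rings are local.
  obtain ⟨g, hg, hgc⟩ := H _ _ F.kerSquareLift.toRingHom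
    (algebraMap C _) (algebraMap B _) hφ hφ2 (by
      rw [← IsScalarTower.algebraMap_eq]
      exact F.kerSquareLift.comp_algebraMap)
  -- Locality lets `g` extend to the localization. The extension `G` splits the thickening, which
  -- amounts to formal smoothness as `Q` is formally smooth.
  have hloc : IsLocalHom F.kerSquareLift.toRingHom := hφ.isLocalHom _
  have hunit : ∀ s : p.primeCompl, IsUnit (g s) := fun s => by
    apply isUnit_of_map_unit F.kerSquareLift.toRingHom
    rw [← RingHom.comp_apply, hg]
    exact IsLocalization.map_units _ s
  let G : Localization.AtPrime p →ₐ[C] Q ⧸ RingHom.ker F.toRingHom ^ 2 :=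
    { IsLocalization.lift (S := Localization.AtPrime p) hunit with
      commutes' := fun r => by
        change IsLocalization.lift (S := Localization.AtPrime p) hunit (algebraMap C _ r) = _
        rw [IsScalarTower.algebraMap_apply C B (Localization.AtPrime p), IsLocalization.lift_eq]
        exact RingHom.congr_fun hgc r }
  refine Algebra.FormallySmooth.of_split F G ?_
  have : F.kerSquareLift.toRingHom.comp
      (G : Localization.AtPrime p →+* _) = RingHom.id _ := by
    refine IsLocalization.ringHom_ext p.primeCompl (RingHom.ext fun b => ?_)
    change F.kerSquareLift (IsLocalization.lift (S := Localization.AtPrime p) hunit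
      (algebraMap B _ b)) = _
    rw [IsLocalization.lift_eq]
    exact RingHom.congr_fun hg b
  exact AlgHom.ext fun z => RingHom.congr_fun this z

/-- A finitely presented algebra with the infinitesimal lifting property for local rings is formally
smooth. -/
theorem Algebra.FormallySmooth.of_isLocalRing_lift {C B : Type u} [CommRing C] [CommRing B]
    [Algebra C B] [Algebra.FinitePresentation C B]
    (H : ∀ (R T : Type u) [CommRing R] [CommRing T] [IsLocalRing R] [IsLocalRing T] (φ : R →+* T)
      (c : C →+* R) (b : B →+* T), Function.Surjective φ → RingHom.ker φ ^ 2 = ⊥ →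
      φ.comp c = b.comp (algebraMap C B) →
      ∃ g : B →+* R, φ.comp g = b ∧ g.comp (algebraMap C B) = c) :
    Algebra.FormallySmooth C B := by
  rw [← Algebra.smoothLocus_eq_univ_iff, Set.eq_univ_iff_forall]
  intro p
  -- One variable for each element of `B`: surjectivity is then immediate. Localizing at the
  -- preimage of `p` gives a formally smooth local algebra that surjects onto the localization of
  -- `B`.
  let π : MvPolynomial B C →ₐ[C] B := MvPolynomial.aeval fun b : B => b
  have hπ : Function.Surjective π := fun b => ⟨MvPolynomial.X b, by simp [π]⟩
  let q : Ideal (MvPolynomial B C) := p.asIdeal.comap π.toRingHom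
  have hq : q.IsPrime := inferInstance
  let F : Localization.AtPrime q →ₐ[C] Localization.AtPrime p.asIdeal :=
    Localization.localAlgHom q p.asIdeal π rfl
  have hF : Function.Surjective F := by
    intro z
    obtain ⟨b, s, rfl⟩ := IsLocalization.exists_mk'_eq p.asIdeal.primeCompl z
    obtain ⟨b, rfl⟩ := hπ b
    obtain ⟨s, hs⟩ := s
    obtain ⟨s, rfl⟩ := hπ s
    refine ⟨IsLocalization.mk' _ b (⟨s, hs⟩ : q.primeCompl), ?_⟩
    exact Localization.localRingHom_mk' q p.asIdeal π.toRingHom rfl b ⟨s, hs⟩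
  have hP : Algebra.FormallySmooth C (Localization.AtPrime q) := by
    have : Algebra.FormallySmooth (MvPolynomial B C) (Localization.AtPrime q) :=
      .of_isLocalization q.primeCompl
    exact .comp C (MvPolynomial B C) _
  exact Algebra.FormallySmooth.localization_of_lift p.asIdeal F hF H

end algebra

/-! ### Smooth morphisms and local lifting -/

namespace AlgebraicGeometry
variable {X Y Z : Scheme.{u}}

/-- The infinitesimal lifting property for square zero thickenings of spectra of local rings. -/
def HasLocalLifts (f : X ⟶ Y) : Prop :=
  ∀ (R T : CommRingCat.{u}) [IsLocalRing R] [IsLocalRing T] (φ : R ⟶ T),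
    Function.Surjective φ.hom → RingHom.ker φ.hom ^ 2 = ⊥ →
    ∀ (y : Spec R ⟶ Y) (x : Spec T ⟶ X), x ≫ f = Spec.map φ ≫ y →
      ∃ z : Spec R ⟶ X, Spec.map φ ≫ z = x ∧ z ≫ f = y

/-- Every point of the spectrum of a local ring specialises to the closed point, so an open set
whose preimage contains the closed point contains the whole image. Lifting problems over local rings
thus become problems about rings. -/
lemma IsAffineOpen.exists_SpecMap_fromSpec {R : CommRingCat.{u}} [IsLocalRing R] {U : X.Opens}
    (hU : IsAffineOpen U) (x : Spec R ⟶ X) (hx : x (IsLocalRing.closedPoint R) ∈ U) :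
    ∃ g : Γ(X, U) ⟶ R, x = Spec.map g ≫ hU.fromSpec := by
  have h1 : Set.range x ⊆ Set.range hU.fromSpec := by
    rw [hU.range_fromSpec]
    rintro _ ⟨p, rfl⟩
    have : p ∈ x ⁻¹ᵁ U := by rw [Scheme.preimage_eq_top_of_closedPoint_mem x hx]; trivial
    exact this
  obtain ⟨g, hg⟩ := Spec.map_surjective (IsOpenImmersion.lift hU.fromSpec x h1)
  exact ⟨g, by rw [hg, IsOpenImmersion.lift_fac]⟩

lemma SpecMap_closedPoint_of_surjective {R T : CommRingCat.{u}} [IsLocalRing R] [IsLocalRing T]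
    (φ : R ⟶ T) (hφ : Function.Surjective φ.hom) :
    Spec.map φ (IsLocalRing.closedPoint T) = IsLocalRing.closedPoint R := by
  have : IsLocalHom φ.hom := hφ.isLocalHom _
  exact Spec_closedPoint

/-- The source and its thickening have the same closed point, so one pair of affine opens `V ≤ f ⁻¹ᵁ
U` contains the whole problem. The smooth ring map between their sections is formally smooth and
provides the lift. -/
theorem Smooth.hasLocalLifts (f : X ⟶ Y) [Smooth f] : HasLocalLifts f := by
  intro R T _ _ φ hφ hker y x hxy
  set pt := x (IsLocalRing.closedPoint T)
  obtain ⟨_, ⟨U, hU, rfl⟩, hptU, -⟩ := Y.isBasis_affineOpens.exists_subset_of_mem_open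
    (Set.mem_univ (f pt)) isOpen_univ
  obtain ⟨_, ⟨V, hV, rfl⟩, hptV, hVU⟩ := X.isBasis_affineOpens.exists_subset_of_mem_open
    (show pt ∈ f ⁻¹ᵁ U from hptU) (f ⁻¹ᵁ U).2
  have hVU' : V ≤ f ⁻¹ᵁ U := hVU
  have hU' : IsAffineOpen U := hU
  have hV' : IsAffineOpen V := hV
  obtain ⟨b, hb⟩ := hV'.exists_SpecMap_fromSpec x hptV
  obtain ⟨c, hc⟩ := hU'.exists_SpecMap_fromSpec y (by
    rw [← SpecMap_closedPoint_of_surjective φ hφ]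
    change (Spec.map φ ≫ y) (IsLocalRing.closedPoint T) ∈ U
    rw [← hxy]
    exact hptU)
  have hcomm : f.appLE U V hVU' ≫ b = c ≫ φ := by
    apply Spec.map_injective
    rw [← cancel_mono hU'.fromSpec, Spec.map_comp, Spec.map_comp, Category.assoc, Category.assoc,
      ← hc, ← hxy, hb, IsAffineOpen.SpecMap_appLE_fromSpec f hU' hV' hVU', Category.assoc]
  have hs := (f.smooth_appLE hU' hV' hVU').formallySmooth
  algebraize [(f.appLE U V hVU').hom, c.hom, (c ≫ φ).hom]
  let b' : Γ(X, V) →ₐ[Γ(Y, U)] T :=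
    { b.hom with commutes' := fun r => RingHom.congr_fun (congrArg CommRingCat.Hom.hom hcomm) r }
  let φ' : R →ₐ[Γ(Y, U)] T := { φ.hom with commutes' := fun r => rfl }
  let g := Algebra.FormallySmooth.liftOfSurjective b' φ' hφ ⟨2, hker⟩
  have hg : φ'.comp g = b' := Algebra.FormallySmooth.comp_liftOfSurjective b' φ' hφ ⟨2, hker⟩
  let G : Γ(X, V) ⟶ R := CommRingCat.ofHom g.toRingHom
  have hG : G ≫ φ = b := by
    ext r; exact AlgHom.congr_fun hg r
  have hGc : f.appLE U V hVU' ≫ G = c := by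
    ext r; exact g.commutes r
  refine ⟨Spec.map G ≫ hV'.fromSpec, ?_, ?_⟩
  · rw [← Category.assoc, ← Spec.map_comp, hG, hb]
  · rw [Category.assoc, ← IsAffineOpen.SpecMap_appLE_fromSpec f hU' hV' hVU', ← Category.assoc, ← Spec.map_comp,
      hGc, hc]

/-- On affine opens finite presentation is given, so formal smoothness remains, and it may be tested
on local rings by `Algebra.FormallySmooth.of_isLocalRing_lift`. -/
theorem Smooth.of_hasLocalLifts (f : X ⟶ Y) [LocallyOfFinitePresentation f]
    (h : HasLocalLifts f) : Smooth f := by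
  refine ⟨fun {U} hU {V} hV e => ?_⟩
  have hfp : (f.appLE U V e).hom.FinitePresentation :=
    HasRingHomProperty.appLE (P := @LocallyOfFinitePresentation) f inferInstance ⟨U, hU⟩ ⟨V, hV⟩ e
  refine RingHom.smooth_def.2 ⟨?_, hfp⟩
  algebraize [(f.appLE U V e).hom]
  refine Algebra.FormallySmooth.of_isLocalRing_lift fun R T _ _ _ _ φ c b hφ hker hcb => ?_
  have : IsLocalRing (CommRingCat.of R) := ‹IsLocalRing R›
  have : IsLocalRing (CommRingCat.of T) := ‹IsLocalRing T›
  have hcomm : f.appLE U V e ≫ CommRingCat.ofHom b = CommRingCat.ofHom c ≫ CommRingCat.ofHom φ := by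
    ext r; exact (RingHom.congr_fun hcb r).symm
  obtain ⟨z, hz, hzf⟩ := h (.of R) (.of T) (CommRingCat.ofHom φ) hφ hker
    (Spec.map (CommRingCat.ofHom c) ≫ hU.fromSpec) (Spec.map (CommRingCat.ofHom b) ≫ hV.fromSpec) (by
      rw [Category.assoc, ← IsAffineOpen.SpecMap_appLE_fromSpec f hU hV e, ← Category.assoc, ← Spec.map_comp,
        hcomm, Spec.map_comp, Category.assoc])
  -- The lift `z` a priori maps to `X`. It sends the closed point into `V` because it restricts to a
  -- map through `V` on `Spec T`, which has the same closed point.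
  obtain ⟨g, hg⟩ := hV.exists_SpecMap_fromSpec z (by
    rw [← SpecMap_closedPoint_of_surjective (CommRingCat.ofHom φ) hφ]
    change (Spec.map (CommRingCat.ofHom φ) ≫ z) (IsLocalRing.closedPoint T) ∈ (V : Set X)
    rw [hz, ← hV.range_fromSpec]
    exact ⟨_, rfl⟩)
  refine ⟨g.hom, ?_, ?_⟩
  · have : g ≫ CommRingCat.ofHom φ = CommRingCat.ofHom b := by
      apply Spec.map_injective
      rw [← cancel_mono hV.fromSpec, Spec.map_comp, Category.assoc, ← hg, hz]
    exact congrArg CommRingCat.Hom.hom this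
  · have : f.appLE U V e ≫ g = CommRingCat.ofHom c := by
      apply Spec.map_injective
      rw [← cancel_mono hU.fromSpec, Spec.map_comp, Category.assoc, IsAffineOpen.SpecMap_appLE_fromSpec f hU hV e,
        ← Category.assoc, ← hg, hzf]
    exact congrArg CommRingCat.Hom.hom this

lemma LocallyOfFinitePresentation.of_comp (f : X ⟶ Y) (g : Y ⟶ Z)
    [LocallyOfFinitePresentation (f ≫ g)] [LocallyOfFiniteType g] :
    LocallyOfFinitePresentation f := by
  rw [HasRingHomProperty.iff_exists_appLE (P := @LocallyOfFinitePresentation)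
    (RingHom.finitePresentation_stableUnderComposition.stableUnderCompositionWithLocalizationAway
      RingHom.finitePresentation_holdsForLocalizationAway).1]
  intro x
  obtain ⟨_, ⟨W, hW, rfl⟩, hxW, -⟩ := Z.isBasis_affineOpens.exists_subset_of_mem_open
    (Set.mem_univ (g (f x))) isOpen_univ
  obtain ⟨_, ⟨U, hU, rfl⟩, hxU, hUW⟩ := Y.isBasis_affineOpens.exists_subset_of_mem_open
    (show f x ∈ g ⁻¹ᵁ W from hxW) (g ⁻¹ᵁ W).2
  obtain ⟨_, ⟨V, hV, rfl⟩, hxV, hVU⟩ := X.isBasis_affineOpens.exists_subset_of_mem_open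
    (show x ∈ f ⁻¹ᵁ U from hxU) (f ⁻¹ᵁ U).2
  have hUW' : U ≤ g ⁻¹ᵁ W := hUW
  have hVU' : V ≤ f ⁻¹ᵁ U := hVU
  refine ⟨⟨U, hU⟩, ⟨V, hV⟩, hxV, hVU', ?_⟩
  have h1 : (g.appLE W U hUW').hom.FiniteType :=
    HasRingHomProperty.appLE (P := @LocallyOfFiniteType) g inferInstance ⟨W, hW⟩ ⟨U, hU⟩ hUW'
  have h2 : ((f ≫ g).appLE W V (hVU'.trans (f.preimage_mono hUW'))).hom.FinitePresentation :=
    HasRingHomProperty.appLE (P := @LocallyOfFinitePresentation) (f ≫ g) inferInstance ⟨W, hW⟩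
      ⟨V, hV⟩ _
  rw [← Scheme.Hom.appLE_comp_appLE f g W U V hUW' hVU', CommRingCat.hom_comp] at h2
  exact RingHom.FinitePresentation.of_comp_finiteType _ h2 h1

end AlgebraicGeometry

/-! ### The universal mold and finiteness of the orbit map -/

namespace Mold
variable {n d : ℕ}

/-- The universal mold. -/
noncomputable def univ (n d : ℕ) : Mold n d (MoldScheme.{u} n d) :=
  (moldRepresentableBy n d).homEquiv (𝟙 _)

lemma homEquiv_eq_pull {X : Scheme.{u}} (f : X ⟶ MoldScheme.{u} n d) :
    (moldRepresentableBy n d).homEquiv f = pull f (univ n d) :=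
  (moldRepresentableBy n d).homEquiv_eq f

lemma classify_pull_univ {X : Scheme.{u}} (f : X ⟶ MoldScheme.{u} n d) :
    (pull f (univ n d)).classify = f := by
  rw [← homEquiv_eq_pull]
  exact Equiv.symm_apply_apply _ f

lemma pull_classify {X : Scheme.{u}} (A : Mold n d X) : pull A.classify (univ n d) = A := by
  rw [← homEquiv_eq_pull]
  exact Equiv.apply_symm_apply (moldRepresentableBy n d).homEquiv A

/-- Both schemes represent molds with a global normalised basis: one as an open part of the moduli
scheme, the other by construction. The two classifying maps are mutually inverse. This turns finite
type of the chart rings into local finite type of the moduli scheme. -/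
lemma exists_chartLocus_iso (I : Fin d ↪ Fin n × Fin n) :
    Nonempty ((chartLocus I (univ.{u} n d)).toScheme ≅ chartScheme.{u} I) := by
  obtain ⟨φ, hφ⟩ := exists_chartHom I (univ.{u} n d)
  have hr : Set.range (univChart.{u} I).classify ⊆
      Set.range (chartLocus I (univ.{u} n d)).ι := by
    rw [Scheme.Opens.range_ι]
    rintro _ ⟨t, rfl⟩
    exact mem_chartLocus_of_pull _ (isChart_univTuple I) (pull_classify _) t
  refine ⟨⟨φ, IsOpenImmersion.lift _ _ hr, ?_, ?_⟩⟩
  · rw [← cancel_mono (chartLocus I (univ.{u} n d)).ι, Category.assoc, IsOpenImmersion.lift_fac,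
      comp_classify, hφ, classify_pull_univ, Category.id_comp]
  · refine chart_mono ?_
    rw [pull_comp, hφ, ← pull_comp, IsOpenImmersion.lift_fac, pull_classify, pull_id]

end Mold

lemma terminal_from_Spec (R : CommRingCat.{u}) :
    ∃ (f : CommRingCat.of (ULift.{u} ℤ) ⟶ R) (e : Spec (.of (ULift.{u} ℤ)) ≅ ⊤_ Scheme.{u}),
      terminal.from (Spec R) = Spec.map f ≫ e.hom :=
  ⟨CommRingCat.ofHom ((Int.castRingHom R).comp (ULift.ringEquiv : ULift.{u} ℤ ≃+* ℤ).toRingHom),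
    (specULiftZIsTerminal.{u}).uniqueUpToIso terminalIsTerminal, terminal.hom_ext _ _⟩

instance locallyOfFiniteType_chartScheme {n d : ℕ} (I : Fin d ↪ Fin n × Fin n) :
    LocallyOfFiniteType (terminal.from (Mold.chartScheme.{u} I)) := by
  obtain ⟨f, e, h⟩ := terminal_from_Spec (.of (Mold.ChartRing.{u} I))
  have : LocallyOfFiniteType (Spec.map f) :=
    (HasRingHomProperty.Spec_iff (P := @LocallyOfFiniteType)).2 (Mold.finiteType_chartRing I f.hom)
  rw [h]
  infer_instance

instance locallyOfFinitePresentation_PGL (n : ℕ) :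
    LocallyOfFinitePresentation (terminal.from (PGL.scheme.{u} n)) := by
  obtain ⟨f, e, h⟩ := terminal_from_Spec (.of (PGL.CoordRing.{u} n))
  have : LocallyOfFinitePresentation (Spec.map f) :=
    (HasRingHomProperty.Spec_iff (P := @LocallyOfFinitePresentation)).2
      (PGL.finitePresentation_coordRing f.hom)
  rw [h]
  infer_instance

instance locallyOfFiniteType_moldScheme (n d : ℕ) :
    LocallyOfFiniteType (terminal.from (MoldScheme.{u} n d)) := by
  have hU : IsOpenCover (fun I : Fin d ↪ Fin n × Fin n => Mold.chartLocus I (Mold.univ.{u} n d)) := by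
    refine IsOpenCover.mk (top_le_iff.1 fun x _ => ?_)
    rw [Opens.mem_iSup]
    exact Mold.exists_mem_chartLocus _ x
  have : IsZariskiLocalAtSource @LocallyOfFiniteType.{u} :=
    HasRingHomProperty.instIsZariskiLocalAtSource (Q := RingHom.FiniteType)
  rw [IsZariskiLocalAtSource.iff_of_openCover (P := @LocallyOfFiniteType)
    ((MoldScheme.{u} n d).openCoverOfIsOpenCover _ hU)]
  intro I
  obtain ⟨e⟩ := Mold.exists_chartLocus_iso.{u} (n := n) (d := d) I
  have : ((MoldScheme.{u} n d).openCoverOfIsOpenCover _ hU).f I ≫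
      terminal.from (MoldScheme.{u} n d) = e.hom ≫ terminal.from (Mold.chartScheme.{u} I) :=
    terminal.hom_ext _ _
  rw [this]
  exact MorphismProperty.comp_mem _ _ _ inferInstance (locallyOfFiniteType_chartScheme I)

/-- PGLₙ is of finite presentation over `S` and the moduli scheme is locally of finite type over
`S`, so the `S`-morphism between them is locally of finite presentation. -/
instance locallyOfFinitePresentation_orbitMap {n d : ℕ} {S : Scheme.{u}} (A : Mold n d S) :
    LocallyOfFinitePresentation (orbitMap A) := by
  have h : orbitMap A ≫ pullback.snd _ _ = pullback.snd _ _ := pullback.lift_snd _ _ _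
  have : LocallyOfFinitePresentation (orbitMap A ≫ pullback.snd (terminal.from (MoldScheme.{u} n d))
      (terminal.from S)) := by
    rw [h]; infer_instance
  exact LocallyOfFinitePresentation.of_comp _ (pullback.snd (terminal.from (MoldScheme.{u} n d))
      (terminal.from S))

/-! ### The first Hochschild cohomology in coordinates -/

namespace Hochschild
variable {R A M : Type*} [CommRing R] [Ring A] [Algebra R A] [AddCommGroup M] [Module R M]
  [Module A M] [Module Aᵐᵒᵖ M] [IsScalarTower R A M] [IsScalarTower R Aᵐᵒᵖ M]

lemma coboundary_zero_apply (f : Cochain R A M 0) (a : Fin 1 → A) :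
    coboundary R A M 0 f a = a 0 • f Fin.elim0 - MulOpposite.op (a 0) • f Fin.elim0 := by
  have h1 : Fin.tail a = Fin.elim0 := Subsingleton.elim _ _
  have h2 : Fin.init a = Fin.elim0 := Subsingleton.elim _ _
  have h3 : coboundary R A M 0 f = leftTerm f + ∑ i : Fin 0, (-1 : R) ^ ((i : ℕ) + 1) • midTerm i f +
    (-1 : R) ^ 1 • rightTerm f := rfl
  rw [h3, Finset.univ_eq_empty, Finset.sum_empty, add_zero, pow_one, neg_smul, one_smul,
    ← sub_eq_add_neg, sub_apply, leftTerm_apply, rightTerm_apply, h1, h2]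
  rfl

lemma coboundary_one_apply (f : Cochain R A M 1) (a : Fin 2 → A) :
    coboundary R A M 1 f a = a 0 • f (fun _ => a 1) - f (fun _ => a 0 * a 1) +
      MulOpposite.op (a 1) • f (fun _ => a 0) := by
  have h1 : Fin.tail a = fun _ => a 1 := funext fun i => by
    rw [Subsingleton.elim i 0]; rfl
  have h2 : Fin.init a = fun _ => a 0 := funext fun i => by
    rw [Subsingleton.elim i 0]; rfl
  have h3 : contract (0 : Fin 1) a = fun _ => a 0 * a 1 := funext fun i => by
    rw [Subsingleton.elim i 0]; rfl
  have h4 : coboundary R A M 1 f = leftTerm f + ∑ i : Fin 1, (-1 : R) ^ ((i : ℕ) + 1) • midTerm i f +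
    (-1 : R) ^ 2 • rightTerm f := rfl
  rw [h4, Fin.sum_univ_one, Fin.val_zero, zero_add, pow_one, neg_smul, one_smul, ← sub_eq_add_neg,
    Even.neg_one_pow (by decide), one_smul, add_apply, sub_apply, leftTerm_apply, midTerm_apply,
    rightTerm_apply, h1, h2, h3]
  rfl

lemma subsingleton_cohomology_one_iff :
    Subsingleton (Cohomology R A M 1) ↔ ∀ f : Cochain R A M 1, coboundary R A M 1 f = 0 →
      ∃ g : Cochain R A M 0, coboundary R A M 0 g = f := by
  rw [Submodule.Quotient.subsingleton_iff, Submodule.submoduleOf_eq_top]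
  rfl

end Hochschild

namespace Mold
open Hochschild
variable {n d : ℕ} {κ R : Type*} [Fintype κ] [CommRing R]
  {β : Module.Basis (Fin d ⊕ κ) R (Matrix (Fin n) (Fin n) R)}
  {A : Subalgebra R (Matrix (Fin n) (Fin n) R)}

lemma IsAdapted.mk_compl_complRepr (h : IsAdapted β A) (m : Matrix (Fin n) (Fin n) R) :
    BimodQuot.mk (A := A) (compl β (complRepr β m)) = BimodQuot.mk m := by
  rw [← sub_eq_zero, ← map_sub, BimodQuot.mk_eq_zero, h, map_sub, complRepr_compl, sub_self]

omit [Fintype κ] in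
lemma IsAdapted.mk_eq_mk_iff (h : IsAdapted β A) (m m' : Matrix (Fin n) (Fin n) R) :
    BimodQuot.mk (A := A) m = BimodQuot.mk m' ↔ complRepr β m = complRepr β m' := by
  rw [← sub_eq_zero, ← map_sub, BimodQuot.mk_eq_zero, h, map_sub, sub_eq_zero]

/-- The linear map on matrices with given complementary values on the first members of a basis. -/
noncomputable def cochainMap (β : Module.Basis (Fin d ⊕ κ) R (Matrix (Fin n) (Fin n) R))
    (F : Fin d × κ → R) : Matrix (Fin n) (Fin n) R →ₗ[R] Matrix (Fin n) (Fin n) R :=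
  β.constr R (Sum.elim (fun i => compl β fun j => F (i, j)) 0)

lemma cochainMap_inl (F : Fin d × κ → R) (i : Fin d) :
    cochainMap β F (β (Sum.inl i)) = compl β fun j => F (i, j) :=
  β.constr_basis R _ _

lemma diffOne_eq_cochainMap (h : IsAdapted β A) (F : Fin d × κ → R) (i i' : Fin d) :
    (fun j => diffOne β F (i, i', j)) = complRepr β (β (Sum.inl i) * cochainMap β F (β (Sum.inl i'))
      - cochainMap β F (β (Sum.inl i) * β (Sum.inl i'))
      + cochainMap β F (β (Sum.inl i)) * β (Sum.inl i')) := by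
  have : cochainMap β F (β (Sum.inl i) * β (Sum.inl i')) =
      ∑ k, β.repr (β (Sum.inl i) * β (Sum.inl i')) (Sum.inl k) • compl β fun j => F (k, j) := by
    conv_lhs => rw [h.eq_sum (mul_mem (h.inl_mem i) (h.inl_mem i')), map_sum]
    simp only [map_smul, cochainMap_inl]
  rw [this, cochainMap_inl, cochainMap_inl]
  rfl

/-- The expression is bilinear in `a` and `a'`, so it suffices that it vanish on the basis of `A`,
where it is `diffOne`. -/
lemma IsAdapted.cocycle_of_diffOne_eq_zero (h : IsAdapted β A) {F : Fin d × κ → R}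
    (hF : diffOne β F = 0) {a a' : Matrix (Fin n) (Fin n) R} (ha : a ∈ A) (ha' : a' ∈ A) :
    complRepr β (a * cochainMap β F a' - cochainMap β F (a * a') + cochainMap β F a * a') = 0 := by
  let D : Matrix (Fin n) (Fin n) R →ₗ[R] Matrix (Fin n) (Fin n) R →ₗ[R] (κ → R) :=
    LinearMap.mk₂ R (fun a a' => complRepr β
      (a * cochainMap β F a' - cochainMap β F (a * a') + cochainMap β F a * a'))
      (fun a b c => by simp only [add_mul, map_add, map_sub]; abel)
      (fun r a c => by simp only [Matrix.smul_mul, map_smul, ← smul_sub, ← smul_add])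
      (fun a b c => by simp only [mul_add, map_add, map_sub]; abel)
      (fun r a c => by simp only [Matrix.mul_smul, map_smul, ← smul_sub, ← smul_add])
  change D a a' = 0
  have hD : ∀ i i', D (β (Sum.inl i)) (β (Sum.inl i')) = 0 := fun i i' => by
    have := diffOne_eq_cochainMap h F i i'
    rw [hF] at this
    exact this.symm
  rw [h.eq_sum ha, h.eq_sum ha']
  simp only [map_sum, map_smul, LinearMap.sum_apply, LinearMap.smul_apply, hD, smul_zero,
    Finset.sum_const_zero]

/-- A 1-cochain is a linear map `A → Mₙ/A`, determined by its values on the basis of `A`. Taking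
complementary coordinates of these values identifies the Hochschild complex, in the degrees
concerned, with `diffZero` and `diffOne`. -/
theorem IsAdapted.subsingleton_cohomology_iff (h : IsAdapted β A) :
    Subsingleton (Cohomology R A (BimodQuot A) 1) ↔
      Function.Exact (diffZero β) (diffOne β) := by
  rw [subsingleton_cohomology_one_iff]
  let b : Fin d → A := fun i => ⟨β (Sum.inl i), h.inl_mem i⟩
  have hspan : ∀ a : A, a = ∑ i, β.repr (a : Matrix (Fin n) (Fin n) R) (Sum.inl i) • b i := fun a =>
    Subtype.ext <| by
      rw [AddSubmonoidClass.coe_finsetSum]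
      exact h.eq_sum a.2
  constructor
  · intro H F
    refine ⟨fun hF => ?_, ?_⟩
    · let f : Cochain R A (BimodQuot A) 1 := MultilinearMap.ofSubsingleton R A (BimodQuot A) 0
        ((BimodQuot.mk (A := A)) ∘ₗ cochainMap β F ∘ₗ A.val.toLinearMap)
      have hf : ∀ a, f a = BimodQuot.mk (A := A) (cochainMap β F (a 0)) := fun a => rfl
      obtain ⟨g, hg⟩ := H f (MultilinearMap.ext fun a => by
        rw [coboundary_one_apply, hf, hf, hf, BimodQuot.smul_mk, BimodQuot.op_smul_mk, ← map_sub,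
          ← map_add, zero_apply, BimodQuot.mk_eq_zero, h]
        exact h.cocycle_of_diffOne_eq_zero hF (a 0).2 (a 1).2)
      obtain ⟨t, ht⟩ := BimodQuot.mk_surjective A (g Fin.elim0)
      refine ⟨complRepr β t, funext fun ⟨i, j⟩ => ?_⟩
      have := congrArg (fun f => f fun _ => b i) hg
      simp only [coboundary_zero_apply, hf, ← ht, BimodQuot.smul_mk, BimodQuot.op_smul_mk, ← map_sub]
        at this
      rw [h.mk_eq_mk_iff, cochainMap_inl, complRepr_compl] at this
      rw [diffZero_apply, map_sub, h.complRepr_mul_compl (h.inl_mem i),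
        h.complRepr_compl_mul (h.inl_mem i), ← map_sub]
      exact congrFun this j
    · rintro ⟨v, rfl⟩
      exact h.diffOne_diffZero v
  · intro H f hf
    have ext_b : ∀ L L' : A →ₗ[R] BimodQuot A, (∀ i, L (b i) = L' (b i)) → L = L' :=
      fun L L' hLL => LinearMap.ext fun a => by
        rw [hspan a]
        simp only [map_sum, map_smul, hLL]
    -- The cochain `f` is written as the class of `cochainMap β F`, with `F` read off from
    -- representatives `t i` of its values on the basis.
    choose t ht using fun i => BimodQuot.mk_surjective A (f fun _ => b i)
    let F : Fin d × κ → R := fun p => complRepr β (t p.1) p.2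
    have hb : ∀ i, BimodQuot.mk (A := A) (cochainMap β F (β (Sum.inl i))) = f fun _ => b i :=
      fun i => by
        rw [cochainMap_inl, ← ht]
        exact h.mk_compl_complRepr (t i)
    have hf' : ∀ a : A, f (fun _ => a) =
        BimodQuot.mk (A := A) (cochainMap β F (a : Matrix (Fin n) (Fin n) R)) := fun a =>
      LinearMap.congr_fun (ext_b
        ((MultilinearMap.ofSubsingleton R A (BimodQuot A) (0 : Fin 1)).symm f)
        ((BimodQuot.mk (A := A)) ∘ₗ cochainMap β F ∘ₗ A.val.toLinearMap) fun i => (hb i).symm) a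
    obtain ⟨v, hv⟩ := (H F).1 (funext fun ⟨i, i', j⟩ => by
      have := congrArg (fun f => f ![b i, b i']) hf
      simp only [coboundary_one_apply, hf', BimodQuot.smul_mk, BimodQuot.op_smul_mk, ← map_sub,
        ← map_add, zero_apply, BimodQuot.mk_eq_zero] at this
      rw [h] at this
      exact (congrFun (diffOne_eq_cochainMap h F i i') j).trans (congrFun this j))
    refine ⟨MultilinearMap.constOfIsEmpty R _ (BimodQuot.mk (compl β v)), ?_⟩
    refine (MultilinearMap.ofSubsingleton R A (BimodQuot A) (0 : Fin 1)).symm.injective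
      (ext_b _ _ fun i => ?_)
    change coboundary R A (BimodQuot A) 0 _ (fun _ => b i) = f fun _ => b i
    rw [coboundary_zero_apply, ← ht, MultilinearMap.constOfIsEmpty_apply, Function.const_apply,
      BimodQuot.smul_mk,
      BimodQuot.op_smul_mk, ← map_sub, h.mk_eq_mk_iff]
    exact funext fun j => congrFun hv (i, j)

end Mold

/-! ### Molds over local rings and at points -/

namespace PGL
variable {n : ℕ} {X Y : Scheme.{u}}

lemma hom_ext {P P' : X ⟶ scheme.{u} n} (h : sectionHom P ⊤ = sectionHom P' ⊤) : P = P' := by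
  have : IsAffine (scheme.{u} n) := inferInstanceAs (IsAffine (Spec _))
  refine ext_of_isAffine ?_
  rw [← cancel_epi (Scheme.ΓSpecIso (CommRingCat.of (CoordRing.{u} n))).inv]
  have h1 : P.appTop = P.appLE ⊤ ⊤ le_top := Scheme.Hom.app_eq_appLE _
  have h2 : P'.appTop = P'.appLE ⊤ ⊤ le_top := Scheme.Hom.app_eq_appLE _
  rw [h1, h2]
  ext1
  exact h

lemma exists_sectionHom_eq (ψ : CoordRing.{u} n →+* Γ(X, ⊤)) :
    ∃ P : X ⟶ scheme.{u} n, sectionHom P ⊤ = ψ := by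
  let P : X ⟶ scheme.{u} n := X.toSpecΓ ≫ Spec.map (CommRingCat.ofHom ψ)
  refine ⟨P, ?_⟩
  have h1 : P.appLE ⊤ ⊤ le_top = P.appTop := (Scheme.Hom.app_eq_appLE _).symm
  rw [sectionHom, h1, Scheme.Hom.comp_appTop]
  simp

end PGL

namespace Mold
variable {n d : ℕ} {X Y : Scheme.{u}}

lemma IsFrame.isAdapted {κ : Type} [Fintype κ] {A : Mold n d X} {U : X.Opens}
    {β : Module.Basis (Fin d ⊕ κ) Γ(X, U) (MatSec n X U)} (h : IsFrame A.sec U β) :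
    IsAdapted β (A.sec U) := fun m => by
  rw [h.mem_iff, funext_iff]
  rfl

/-- On an open set with a frame, a mold is generated by its sections over that set. Over a local
ring it is therefore determined by its global sections. -/
lemma sec_le_of_sec_le {A B : Mold n d X} {U : X.Opens} {e : ℕ}
    {α : Module.Basis (Fin d ⊕ Fin e) Γ(X, U) (MatSec n X U)} (hα : IsFrame A.sec U α)
    (h : A.sec U ≤ B.sec U) {V : X.Opens} (hV : V ≤ U) : A.sec V ≤ B.sec V := by
  intro m hm
  rw [eq_sum_of_repr _ ((hα V hV m).1 hm)]
  refine Subalgebra.sum_mem _ fun i _ => Subalgebra.smul_mem _ ?_ _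
  rw [basisMap_apply]
  exact B.res_mem hV (h (hα.isAdapted.inl_mem i))

lemma exists_frame_top {R : CommRingCat.{u}} [IsLocalRing R] (A : Mold n d (Spec R)) :
    ∃ (e : ℕ) (β : Module.Basis (Fin d ⊕ Fin e) Γ(Spec R, ⊤) (MatSec n (Spec R) ⊤)),
      IsFrame A.sec ⊤ β := by
  obtain ⟨U, hx, e, β, hβ⟩ := A.exists_frame (IsLocalRing.closedPoint R)
  obtain rfl : U = ⊤ := Scheme.preimage_eq_top_of_closedPoint_mem (𝟙 (Spec R)) hx
  exact ⟨e, β, hβ⟩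

lemma ext_top {R : CommRingCat.{u}} [IsLocalRing R] {A B : Mold n d (Spec R)}
    (h : ∀ m, m ∈ A.sec ⊤ ↔ m ∈ B.sec ⊤) : A = B := by
  obtain ⟨e, α, hα⟩ := A.exists_frame_top
  obtain ⟨e', β, hβ⟩ := B.exists_frame_top
  exact ext_sec fun V m => ⟨fun hm => sec_le_of_sec_le hα (fun m => (h m).1) le_top hm,
    fun hm => sec_le_of_sec_le hβ (fun m => (h m).2) le_top hm⟩

lemma evaluation_comp_res {U V : X.Opens} (h : V ≤ U) {x : X} (hx : x ∈ V) :
    (X.evaluation V x hx).hom.comp (X.presheaf.map (homOfLE h).op).hom =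
      (X.evaluation U x (h hx)).hom := by
  rw [← CommRingCat.hom_comp, ← Scheme.germ_residue, ← Scheme.germ_residue, ← Category.assoc,
    TopCat.Presheaf.germ_res]

/-- The values at `x` of the first members of a frame lie in the fibre, and conversely the values at
`x` of all sections of `A` near `x` have zero complementary coordinates. So the coordinate complex
of the frame, evaluated at `x`, computes the cohomology of the fibre. -/
lemma isAdapted_fiber {κ : Type} [Fintype κ] {A : Mold n d X} {U : X.Opens}
    {β : Module.Basis (Fin d ⊕ κ) Γ(X, U) (MatSec n X U)} (h : IsFrame A.sec U β) {x : X}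
    (hx : x ∈ U) : IsAdapted (basisMap (X.evaluation U x hx).hom β) (A.fiber x) := by
  intro m
  constructor
  · intro hm
    change m ∈ Submodule.span _ _ at hm
    induction hm using Submodule.span_induction with
    | mem m hm =>
      obtain ⟨V, hV, s, hs, rfl⟩ := hm
      have hs' := A.res_mem (inf_le_right : U ⊓ V ≤ V) hs
      rw [← evalMat_res (inf_le_right : U ⊓ V ≤ V) ⟨hx, hV⟩,
        ← evaluation_comp_res (inf_le_left : U ⊓ V ≤ U) ⟨hx, hV⟩, ← basisMap_comp]
      refine (complRepr_mapMatrix _ _ _).trans ?_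
      ext j
      rw [((h.restrict (inf_le_left : U ⊓ V ≤ U)).isAdapted _).1 hs']
      exact map_zero _
    | zero => exact map_zero _
    | add m m' _ _ hm hm' => rw [map_add, hm, hm', add_zero]
    | smul r m _ hm => rw [map_smul, hm, smul_zero]
  · intro hm
    rw [eq_sum_of_repr (basisMap (X.evaluation U x hx).hom β) (m := m) (fun j => congrFun hm j)]
    refine Subalgebra.sum_mem _ fun i _ => Subalgebra.smul_mem _ (Submodule.subset_span ?_) _
    exact ⟨U, hx, β (Sum.inl i), h.isAdapted.inl_mem i, (basisMap_apply _ _ _).symm⟩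

/-- With `x` the image of the closed point, `s` factors through the local ring at `x`. The
contraction is constructed over that ring, where the residue field is `k(x)`, and then carried to
`R`. The residue field of `R` may be larger, but no base change of cohomology is needed. -/
lemma hasContraction_of_cohomology {A : Mold n d X} {R : CommRingCat.{u}} [IsLocalRing R]
    (s : Spec R ⟶ X) {U : X.Opens} (hU : s (IsLocalRing.closedPoint R) ∈ U) {e : ℕ}
    {β : Module.Basis (Fin d ⊕ Fin e) Γ(X, U) (MatSec n X U)} (h : IsFrame A.sec U β)
    (hx : Subsingleton (Hochschild.Cohomology (X.residueField (s (IsLocalRing.closedPoint R)))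
      (A.fiber (s (IsLocalRing.closedPoint R)))
      (BimodQuot (A.fiber (s (IsLocalRing.closedPoint R)))) 1))
    (hle : ⊤ ≤ s ⁻¹ᵁ U) : HasContraction (basisMap (s.appLE U ⊤ hle).hom β) := by
  set x := s (IsLocalRing.closedPoint R)
  have h1 : HasContraction (basisMap (X.presheaf.germ U x hU).hom β) := by
    have : IsLocalHom (X.residue x).hom := Function.Surjective.isLocalHom _ (X.residue_surjective x)
    refine hasContraction_of_exact (X.residue x).hom (X.residue_surjective x) ?_
    rw [basisMap_comp, ← CommRingCat.hom_comp, Scheme.germ_residue]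
    exact (isAdapted_fiber h hU).subsingleton_cohomology_iff.1 hx
  have h2 := h1.map (Scheme.stalkClosedPointTo s ≫ (Scheme.ΓSpecIso R).inv).hom
  rw [basisMap_comp, ← CommRingCat.hom_comp, ← Category.assoc,
    Scheme.germ_stalkClosedPointTo] at h2
  have : (s.app U ≫ ((Spec R).presheaf.mapIso
      (eqToIso (Scheme.preimage_eq_top_of_closedPoint_mem s hU).symm).op ≪≫
        Scheme.ΓSpecIso R).hom) ≫ (Scheme.ΓSpecIso R).inv = s.appLE U ⊤ hle := by
    rw [Iso.trans_hom, Category.assoc, Category.assoc, Iso.hom_inv_id, Category.comp_id]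
    rfl
  rwa [this] at h2

end Mold

/-! ### Global sections of spectra -/

namespace AlgebraicGeometry
variable {R T : CommRingCat.{u}} (φ : R ⟶ T)

/-- The homomorphism on global sections given by a morphism of affine schemes. -/
noncomputable abbrev specTop : Γ(Spec R, ⊤) →+* Γ(Spec T, ⊤) := ((Spec.map φ).appLE ⊤ ⊤ le_top).hom

lemma specTop_ΓSpecIso_inv (r : R) : specTop φ ((Scheme.ΓSpecIso R).inv.hom r) =
    (Scheme.ΓSpecIso T).inv.hom (φ.hom r) := by
  have h1 : (Spec.map φ).appLE ⊤ ⊤ le_top = (Spec.map φ).appTop := (Scheme.Hom.app_eq_appLE _).symm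
  rw [specTop, h1]
  exact (congrArg (fun f => f.hom r) (Scheme.ΓSpecIso_inv_naturality φ)).symm

lemma ΓSpecIso_inv_bijective (R : CommRingCat.{u}) :
    Function.Bijective (Scheme.ΓSpecIso R).inv.hom :=
  ConcreteCategory.bijective_of_isIso (Scheme.ΓSpecIso R).inv

lemma isLocalRing_ΓSpec (R : CommRingCat.{u}) [IsLocalRing R] : IsLocalRing Γ(Spec R, ⊤) :=
  have := (ΓSpecIso_inv_bijective R).1.nontrivial
  .of_surjective' (Scheme.ΓSpecIso R).inv.hom (ΓSpecIso_inv_bijective R).2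

lemma specTop_surjective (hφ : Function.Surjective φ.hom) : Function.Surjective (specTop φ) := by
  intro t
  obtain ⟨t, rfl⟩ := (ΓSpecIso_inv_bijective T).2 t
  obtain ⟨r, rfl⟩ := hφ t
  exact ⟨_, specTop_ΓSpecIso_inv φ r⟩

lemma ker_specTop_sq (h : RingHom.ker φ.hom ^ 2 = ⊥) : RingHom.ker (specTop φ) ^ 2 = ⊥ := by
  rw [pow_two, eq_bot_iff, Ideal.mul_le]
  intro a ha b hb
  obtain ⟨a, rfl⟩ := (ΓSpecIso_inv_bijective R).2 a
  obtain ⟨b, rfl⟩ := (ΓSpecIso_inv_bijective R).2 b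
  have key : ∀ a, (Scheme.ΓSpecIso R).inv.hom a ∈ RingHom.ker (specTop φ) → a ∈ RingHom.ker φ.hom := by
    intro a ha
    rw [RingHom.mem_ker, specTop_ΓSpecIso_inv] at ha
    exact (ΓSpecIso_inv_bijective T).1 (ha.trans (map_zero _).symm)
  have hab : a * b ∈ RingHom.ker φ.hom ^ 2 := by
    rw [pow_two]; exact Ideal.mul_mem_mul (key a ha) (key b hb)
  rw [h, Ideal.mem_bot] at hab
  rw [← map_mul, hab, map_zero]
  exact zero_mem _

end AlgebraicGeometry

/-! ### The lifting property of the orbit map in terms of molds -/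

namespace Mold
variable {n d : ℕ} {S : Scheme.{u}}

/-- The lifting property for `orbitMap A`, in terms of molds. -/
theorem hasLocalLifts_orbitMap_iff (A : Mold n d S) : HasLocalLifts (orbitMap A) ↔
    ∀ (R T : CommRingCat.{u}) [IsLocalRing R] [IsLocalRing T] (φ : R ⟶ T),
      Function.Surjective φ.hom → RingHom.ker φ.hom ^ 2 = ⊥ →
      ∀ (s : Spec R ⟶ S) (B : Mold n d (Spec R)) (P : Spec T ⟶ PGL.scheme.{u} n),
        pull (Spec.map φ) B = conj P (pull (Spec.map φ ≫ s) A) →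
        ∃ Q : Spec R ⟶ PGL.scheme.{u} n, Spec.map φ ≫ Q = P ∧ conj Q (pull s A) = B := by
  constructor
  · intro H R T _ _ φ hφ hker s B P hB
    obtain ⟨z, hz, hzy⟩ := H R T φ hφ hker
      (pullback.lift B.classify s (terminal.hom_ext _ _))
      (pullback.lift P (Spec.map φ ≫ s) (terminal.hom_ext _ _)) (by
        rw [lift_orbitMap, ← hB, ← comp_classify]
        ext1
        · exact (pullback.lift_fst _ _ _).trans (((congrArg (Spec.map φ ≫ ·)
            (pullback.lift_fst _ _ _)).symm).trans (Category.assoc _ _ _).symm)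
        · exact (pullback.lift_snd _ _ _).trans (((congrArg (Spec.map φ ≫ ·)
            (pullback.lift_snd _ _ _)).symm).trans (Category.assoc _ _ _).symm))
    have hsnd : z ≫ pullback.snd _ _ = s := by
      have := congrArg (· ≫ pullback.snd _ _) hzy
      simp only [Category.assoc, pullback.lift_snd] at this
      rw [← this]
      congr 1
      exact (pullback.lift_snd _ _ _).symm
    refine ⟨z ≫ pullback.fst _ _, ?_, ?_⟩
    · rw [← Category.assoc, hz, pullback.lift_fst]
    -- A point of PGLₙ over `S` is a pair of a point of PGLₙ and a map to `S`. In this form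
    -- `lift_orbitMap` computes its image, and the universal mold recovers the equality of molds
    -- from that of classifying maps.
    · have hlift : z = pullback.lift (z ≫ pullback.fst _ _) s (terminal.hom_ext _ _) := by
        ext1
        · rw [pullback.lift_fst]
        · rw [pullback.lift_snd, hsnd]
      rw [hlift, lift_orbitMap] at hzy
      have := congrArg (· ≫ pullback.fst _ _) hzy
      simp only [pullback.lift_fst] at this
      rw [← pull_classify (conj _ _), this, pull_classify]
  · intro H R T _ _ φ hφ hker y x hxy
    have hx2 : x ≫ pullback.snd _ _ = Spec.map φ ≫ y ≫ pullback.snd _ _ := by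
      rw [← Category.assoc, ← hxy, Category.assoc]
      congr 1
      exact (pullback.lift_snd _ _ _).symm
    have hlift : x = pullback.lift (x ≫ pullback.fst _ _) (Spec.map φ ≫ y ≫ pullback.snd _ _)
        (terminal.hom_ext _ _) := by
      ext1
      · rw [pullback.lift_fst]
      · rw [pullback.lift_snd, hx2]
    obtain ⟨Q, hQ, hQB⟩ := H R T φ hφ hker (y ≫ pullback.snd _ _)
      (pull (y ≫ pullback.fst _ _) (univ n d)) (x ≫ pullback.fst _ _) (by
        rw [hlift, lift_orbitMap] at hxy
        have := congrArg (· ≫ pullback.fst _ _) hxy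
        simp only [pullback.lift_fst, Category.assoc] at this
        rw [← pull_comp, ← this, pull_classify])
    refine ⟨pullback.lift Q (y ≫ pullback.snd _ _) (terminal.hom_ext _ _), ?_, ?_⟩
    · rw [hlift]
      ext1
      · rw [Category.assoc, pullback.lift_fst, pullback.lift_fst, hQ]
      · rw [Category.assoc, pullback.lift_snd, pullback.lift_snd]
    · rw [lift_orbitMap, hQB, classify_pull_univ]
      ext1
      · rw [pullback.lift_fst]
      · rw [pullback.lift_snd]

end Mold

/-! ### Vanishing cohomology gives lifts -/

namespace Mold
variable {n d : ℕ} {S : Scheme.{u}}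

lemma IsAdapted.map_conj {κ R : Type*} [Fintype κ] [CommRing R]
    {β : Module.Basis (Fin d ⊕ κ) R (Matrix (Fin n) (Fin n) R)}
    {B : Subalgebra R (Matrix (Fin n) (Fin n) R)} (h : IsAdapted β B)
    (c : Matrix (Fin n) (Fin n) R ≃ₐ[R] Matrix (Fin n) (Fin n) R) :
    IsAdapted (β.map c.toLinearEquiv) (B.comap c.symm.toAlgHom) :=
  fun m => h (c.symm m)

/-- Lifting of points of `PGLₙ` conjugating one subalgebra to another along a square zero extension of
local rings. -/
theorem exists_lift_of_hasContraction {R T : Type*} [CommRing R] [CommRing T] [IsLocalRing R]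
    [IsLocalRing T] {φ : R →+* T} (hφ : Function.Surjective φ) (hker : RingHom.ker φ ^ 2 = ⊥)
    {κ κ' : Type*} [Fintype κ] [Fintype κ'] [DecidableEq κ]
    {α : Module.Basis (Fin d ⊕ κ) R (Matrix (Fin n) (Fin n) R)}
    {γ : Module.Basis (Fin d ⊕ κ') R (Matrix (Fin n) (Fin n) R)}
    {A B : Subalgebra R (Matrix (Fin n) (Fin n) R)} (hα : IsAdapted α A) (hc : HasContraction α)
    (hγ : IsAdapted γ B) (ψ : PGL.CoordRing.{u} n →+* T)
    (h : ∀ a ∈ A, ∀ m, PGL.conjAlgEquiv ψ m = φ.mapMatrix a → complRepr (basisMap φ γ) m = 0) :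
    ∃ ψ' : PGL.CoordRing.{u} n →+* R, φ.comp ψ' = ψ ∧
      ∀ m, PGL.conjAlgEquiv ψ' m ∈ A ↔ m ∈ B := by
  have hloc : IsLocalHom φ := hφ.isLocalHom _
  obtain ⟨P₀, Q₀, hPQ, hP₀⟩ := PGL.exists_ofMatrix_lift φ hφ ψ
  set c := PGL.conjAlgEquiv (PGL.ofMatrix.{u} P₀ Q₀ hPQ) with hcdef
  have hcm : ∀ m, c m = P₀ * m * Q₀ := PGL.conjAlgEquiv_ofMatrix P₀ Q₀ hPQ
  -- The algebra compared with `A` is the conjugate `P₀ B Q₀`, to which the transported basis `γ.map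
  -- c` is adapted. The hypothesis `h` says that it contains `A` modulo the kernel of `φ`.
  have hAB : ∀ a ∈ A, ∀ j, complRepr (γ.map c.toLinearEquiv) a j ∈ RingHom.ker φ := by
    intro a ha j
    have h1 := h a ha (φ.mapMatrix (c.symm a)) (by
      rw [← hP₀, ← PGL.mapMatrix_conjAlgEquiv, ← hcdef, AlgEquiv.apply_symm_apply])
    rw [complRepr_mapMatrix] at h1
    exact congrFun h1 j
  obtain ⟨X, hX, hXB⟩ := exists_conj_of_hasContraction hker hα hc (hγ.map_conj c) hAB
  have hXX : X * X = 0 := hX.mul_eq_zero hker hX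
  have hone : (1 + X) * P₀ * (Q₀ * (1 - X)) = 1 := by
    rw [mul_assoc, ← mul_assoc P₀, hPQ, one_mul, add_mul, mul_sub, mul_sub, hXX]
    noncomm_ring
  -- The first lift is corrected by `1 + X`, which reduces to the identity and so does not change
  -- the reduction `ψ`.
  refine ⟨PGL.ofMatrix.{u} _ _ hone, ?_, fun m => ?_⟩
  · rw [← hP₀, PGL.comp_ofMatrix, PGL.comp_ofMatrix]
    have hX0 : φ.mapMatrix X = 0 := hX.mapMatrix_eq_zero
    refine PGL.coordRing_hom_ext fun i k l j => ?_
    rw [PGL.ofMatrix_entry, PGL.ofMatrix_entry]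
    congr 2
    · rw [map_mul, map_add, hX0, map_one, add_zero, one_mul]
    · rw [map_mul, map_sub, hX0, map_one, sub_zero, mul_one]
  · rw [PGL.conjAlgEquiv_ofMatrix]
    have h1 := hXB (c m)
    rw [hcm] at h1
    have h2 : (1 + X) * P₀ * m * (Q₀ * (1 - X)) = (1 + X) * (P₀ * m * Q₀) * (1 - X) := by
      noncomm_ring
    rw [h2, ← h1, ← hcm]
    change c.symm (c m) ∈ B ↔ _
    rw [AlgEquiv.symm_apply_apply]

lemma mem_sec_conj_top (P : S ⟶ PGL.scheme.{u} n) (A : Mold n d S) (m : MatSec n S ⊤) :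
    m ∈ (conj P A).sec ⊤ ↔ PGL.conjAlgEquiv (PGL.sectionHom P ⊤) m ∈ A.sec ⊤ := Iff.rfl

/-- Lifting of conjugating matrices along a square zero thickening. -/
theorem exists_conj_lift (A : Mold n d S)
    (hA : ∀ x : S, Subsingleton
      (Hochschild.Cohomology (S.residueField x) (A.fiber x) (BimodQuot (A.fiber x)) 1))
    {R T : CommRingCat.{u}} [IsLocalRing R] [IsLocalRing T] (φ : R ⟶ T)
    (hφ : Function.Surjective φ.hom) (hker : RingHom.ker φ.hom ^ 2 = ⊥) (s : Spec R ⟶ S)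
    (B : Mold n d (Spec R)) (P : Spec T ⟶ PGL.scheme.{u} n)
    (hB : pull (Spec.map φ) B = conj P (pull (Spec.map φ ≫ s) A)) :
    ∃ Q : Spec R ⟶ PGL.scheme.{u} n, Spec.map φ ≫ Q = P ∧ conj Q (pull s A) = B := by
  have := isLocalRing_ΓSpec R
  have := isLocalRing_ΓSpec T
  obtain ⟨U, hU, e, β, hβ⟩ := A.exists_frame (s (IsLocalRing.closedPoint R))
  have hle : ⊤ ≤ s ⁻¹ᵁ U := (Scheme.preimage_eq_top_of_closedPoint_mem s hU).ge
  have hc := hasContraction_of_cohomology s hU hβ (hA _) hle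
  have hα := (isFrame_pull s A hle hβ).isAdapted
  obtain ⟨e', γ, hγ⟩ := B.exists_frame_top
  obtain ⟨ψ, hψ, hψB⟩ := exists_lift_of_hasContraction (specTop_surjective φ hφ)
    (ker_specTop_sq φ hker) hα hc hγ.isAdapted (PGL.sectionHom P ⊤) (fun a ha m hm => by
      have h1 : m ∈ (pull (Spec.map φ) B).sec ⊤ := by
        rw [hB, mem_sec_conj_top, hm, pull_comp]
        exact pull_mem (Spec.map φ) (pull s A) le_top ha
      exact ((isFrame_pull (Spec.map φ) B le_top hγ).isAdapted m).1 h1)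
  obtain ⟨Q, hQ⟩ := PGL.exists_sectionHom_eq (X := Spec R) ψ
  refine ⟨Q, PGL.hom_ext ?_, ext_top fun m => ?_⟩
  · rw [← PGL.sectionHom_comp (Spec.map φ) Q ⊤ ⊤ le_top, hQ, hψ]
  · rw [mem_sec_conj_top, hQ, hψB]

end Mold

/-! ### Deformations over the dual numbers -/

namespace Mold
variable {n d : ℕ}

/-- `R` is the ring of dual numbers `K[ε]`, with projection `φ` and inclusion `ι`. -/
structure IsDualNumbers {R K : Type*} [CommRing R] [CommRing K] (φ : R →+* K) (ι : K →+* R) (ε : R) :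
    Prop where
  map_incl : ∀ t, φ (ι t) = t
  map_eps : φ ε = 0
  eps_mul_eps : ε * ε = 0
  exists_eq : ∀ r, φ r = 0 → ∃ t, r = ε * ι t
  eq_zero : ∀ t, ε * ι t = 0 → t = 0

section chart
variable {R : Type*} [CommRing R] {I : Fin d ↪ Fin n × Fin n} {a : Fin d → Matrix (Fin n) (Fin n) R}

lemma IsChart.isAdapted (h : IsChart I a) : IsAdapted (chartBasis h) h.subalg := fun m => by
  rw [mem_subalg_iff_repr, funext_iff]
  rfl

lemma chartBasis_repr_inl (h : IsChart I a) (m : Matrix (Fin n) (Fin n) R) (k : Fin d) :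
    (chartBasis h).repr m (Sum.inl k) = m (I k).1 (I k).2 := rfl

lemma cochainMap_apply {κ : Type*} [Fintype κ]
    (β : Module.Basis (Fin d ⊕ κ) R (Matrix (Fin n) (Fin n) R)) (F : Fin d × κ → R)
    (m : Matrix (Fin n) (Fin n) R) : cochainMap β F m =
      ∑ k, β.repr m (Sum.inl k) • compl β fun j => F (k, j) := by
  rw [cochainMap, Module.Basis.constr_apply_fintype, Fintype.sum_sum_type]
  simp [Module.Basis.equivFun_apply]

/-- Values of `cochainMap` lie in the complement of a normalised basis, which consists of matrices
vanishing at the positions in `I`. Adding them to the basis preserves the normalisation. -/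
lemma cochainMap_chartBasis_apply (h : IsChart I a) (F) (m : Matrix (Fin n) (Fin n) R) (k : Fin d) :
    cochainMap (chartBasis h) F m (I k).1 (I k).2 = 0 := by
  refine (chartBasis_repr_inl h _ k).symm.trans ?_
  rw [cochainMap_apply]
  simp [compl]

end chart

namespace IsDualNumbers
variable {R K : Type*} [CommRing R] [CommRing K] {φ : R →+* K} {ι : K →+* R} {ε : R}
  {I : Fin d ↪ Fin n × Fin n} {a : Fin d → Matrix (Fin n) (Fin n) K}

lemma map_deform (hε : IsDualNumbers φ ι ε) (u w : Matrix (Fin n) (Fin n) K) :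
    φ.mapMatrix (ι.mapMatrix u + ε • ι.mapMatrix w) = u := by
  ext p q
  simp [hε.map_incl, hε.map_eps]

lemma deform_mul (hε : IsDualNumbers φ ι ε) (u w u' w' : Matrix (Fin n) (Fin n) K) :
    (ι.mapMatrix u + ε • ι.mapMatrix w) * (ι.mapMatrix u' + ε • ι.mapMatrix w') =
      ι.mapMatrix (u * u') + ε • ι.mapMatrix (u * w' + w * u') := by
  rw [add_mul, mul_add, mul_add, smul_mul_smul_comm, hε.eps_mul_eps, zero_smul, add_zero,
    Matrix.mul_smul, Matrix.smul_mul, map_add, map_mul, map_mul, map_mul, smul_add, add_assoc]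

/-- With `L` the cochain, `u + ε w` lies in the span of the `a k + ε L (a k)` when `u` is in `A` and
`w` agrees with `L u` modulo `A`. The normalisation forces the coefficients to be the entries at the
positions in `I`. -/
lemma deform_eq_sum (hε : IsDualNumbers φ ι ε) (h : IsChart I a) (F)
    {u w : Matrix (Fin n) (Fin n) K} (hu : u ∈ h.subalg)
    (hw : w - cochainMap (chartBasis h) F u ∈ h.subalg) :
    ι.mapMatrix u + ε • ι.mapMatrix w = ∑ k,
      (ι.mapMatrix u + ε • ι.mapMatrix w) (I k).1 (I k).2 •
        (ι.mapMatrix (a k) + ε • ι.mapMatrix (cochainMap (chartBasis h) F (a k))) := by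
  set L := cochainMap (chartBasis h) F with hL
  rw [IsChart.mem_subalg] at hu hw
  have hw' : w = L u + ∑ k, w (I k).1 (I k).2 • a k := by
    simp only [Matrix.sub_apply, hL, cochainMap_chartBasis_apply, sub_zero] at hw
    exact sub_eq_iff_eq_add'.1 hw
  have hLu : L u = ∑ k, u (I k).1 (I k).2 • L (a k) := by
    conv_lhs => rw [hu, map_sum]
    simp only [map_smul]
  have key : ∀ k, (ι.mapMatrix u + ε • ι.mapMatrix w) (I k).1 (I k).2 •
        (ι.mapMatrix (a k) + ε • ι.mapMatrix (L (a k))) =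
      ι.mapMatrix (u (I k).1 (I k).2 • a k) +
        ε • ι.mapMatrix (u (I k).1 (I k).2 • L (a k) + w (I k).1 (I k).2 • a k) := by
    intro k
    ext p q
    simp only [Matrix.add_apply, Matrix.smul_apply, RingHom.mapMatrix_apply, Matrix.map_apply,
      smul_eq_mul, map_add, map_mul]
    linear_combination (ι (w (I k).1 (I k).2) * ι (L (a k) p q)) * hε.eps_mul_eps
  simp only [key]
  rw [Finset.sum_add_distrib, ← map_sum, ← Finset.smul_sum, ← map_sum, Finset.sum_add_distrib,
    ← hLu, ← hw', ← hu]

/-- The `ε`-part of a product of deformed elements is `a * L a' + L a * a'`. It is congruent to `L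
(a * a')` modulo `A` by the cocycle condition, whence closure under multiplication. The same
condition for the pair `(1, 1)` gives `L 1 ∈ A`, whence the unit. -/
lemma isChart_deform (hε : IsDualNumbers φ ι ε) (h : IsChart I a) {F}
    (hF : diffOne (chartBasis h) F = 0) : IsChart I fun i =>
      ι.mapMatrix (a i) + ε • ι.mapMatrix (cochainMap (chartBasis h) F (a i)) where
  norm i j := by
    change ι (a i _ _) + ε * ι (cochainMap (chartBasis h) F (a i) _ _) = _
    rw [cochainMap_chartBasis_apply, map_zero, mul_zero, add_zero, h.norm]
    split_ifs <;> simp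
  one := by
    have := hε.deform_eq_sum h F (one_mem _) (w := 0) (by
      rw [h.isAdapted, zero_sub, map_neg, neg_eq_zero]
      have := h.isAdapted.cocycle_of_diffOne_eq_zero hF (one_mem _) (one_mem _)
      simpa using this)
    simpa only [map_one, map_zero, smul_zero, add_zero] using this
  mul i j := by
    rw [hε.deform_mul]
    refine hε.deform_eq_sum h F (mul_mem (h.self_mem i) (h.self_mem j)) ?_
    rw [h.isAdapted, ← h.isAdapted.cocycle_of_diffOne_eq_zero hF (h.self_mem i) (h.self_mem j)]
    congr 1
    abel

lemma exists_diffZero_eq (hε : IsDualNumbers φ ι ε) [IsLocalHom φ] (h : IsChart I a) {F}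
    (ψ : PGL.CoordRing.{u} n →+* R) (hψ : φ.comp ψ = PGL.ofMatrix 1 1 (mul_one 1))
    (H : ∀ i, complRepr (basisMap ι (chartBasis h)) (PGL.conjAlgEquiv ψ
      (ι.mapMatrix (a i) + ε • ι.mapMatrix (cochainMap (chartBasis h) F (a i)))) = 0) :
    ∃ v, diffZero (chartBasis h) v = F := by
  set β := chartBasis h with hβ
  obtain ⟨P, Q, hPQ, rfl, hP⟩ := PGL.exists_ofMatrix_of_comp_eq_one φ ψ hψ
  choose Y hY using fun p q => hε.exists_eq (P p q - (1 : Matrix (Fin n) (Fin n) R) p q) (by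
    rw [map_sub, sub_eq_zero]
    have := congrFun (congrFun hP p) q
    refine this.trans ?_
    rw [Matrix.one_apply, Matrix.one_apply]
    split_ifs <;> simp)
  -- A matrix reducing to the identity is `1 + ε Y`, and its inverse is `1 - ε Y`.
  have hPY : P = ι.mapMatrix 1 + ε • ι.mapMatrix (Matrix.of Y) := by
    rw [map_one]
    ext p q
    exact sub_eq_iff_eq_add'.1 (hY p q)
  have hQY : Q = ι.mapMatrix 1 + ε • ι.mapMatrix (-Matrix.of Y) := by
    have h1 : (ι.mapMatrix 1 + ε • ι.mapMatrix (-Matrix.of Y)) * P = 1 := by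
      rw [hPY, hε.deform_mul]
      simp
    calc Q = (ι.mapMatrix 1 + ε • ι.mapMatrix (-Matrix.of Y)) * P * Q := by rw [h1, one_mul]
      _ = _ := by rw [mul_assoc, hPQ, mul_one]
  refine ⟨complRepr β (Matrix.of Y), funext fun ⟨i, j⟩ => ?_⟩
  have h1 := congrFun (H i) j
  rw [PGL.conjAlgEquiv_ofMatrix, hPY, hQY, hε.deform_mul, hε.deform_mul, map_add, map_smul,
    complRepr_mapMatrix, complRepr_mapMatrix, one_mul, mul_one, mul_one, one_mul,
    (h.isAdapted _).1 (h.self_mem i)] at h1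
  -- The coefficient of `ε` in `P (a i + ε L (a i)) Q` is `L (a i) + Y a i - a i Y`. Its vanishing
  -- modulo `A` says that `F` is the coboundary of the class of `Y`.
  have h2 := hε.eq_zero _ (by
    simpa only [Pi.add_apply, Pi.smul_apply, Pi.zero_apply, map_zero, zero_add, smul_eq_mul]
      using h1)
  have h3 : complRepr β (cochainMap β F (a i)) j = F (i, j) := by
    rw [← chartBasis_inl h, ← hβ, cochainMap_inl, complRepr_compl]
  rw [diffZero_apply, map_sub, h.isAdapted.complRepr_mul_compl (h.isAdapted.inl_mem i),
    h.isAdapted.complRepr_compl_mul (h.isAdapted.inl_mem i), chartBasis_inl, ← h3]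
  simp only [map_add, map_neg, mul_neg, Pi.add_apply, Pi.sub_apply, Pi.neg_apply] at h2 ⊢
  linear_combination -h2

end IsDualNumbers
end Mold

/-! ### Lifts force the cohomology to vanish -/

namespace Mold
variable {n d : ℕ} {S : Scheme.{u}}

/-- The projection from the dual numbers over a field. -/
noncomputable abbrev dualFst (K : Type u) [Field K] : CommRingCat.of (DualNumber K) ⟶ .of K :=
  CommRingCat.ofHom (TrivSqZeroExt.fstHom K K K).toRingHom

/-- The inclusion of a field into the dual numbers. -/
noncomputable abbrev dualInl (K : Type u) [Field K] : CommRingCat.of K ⟶ .of (DualNumber K) :=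
  CommRingCat.ofHom (TrivSqZeroExt.inlHom K K)

lemma dualInl_dualFst (K : Type u) [Field K] : dualInl K ≫ dualFst K = 𝟙 _ := by
  ext t; rfl

/-- Global sections of the spectrum are only isomorphic to the dual numbers. The axioms of
`IsDualNumbers` hold on both sides of this isomorphism and spare a transport of the matrix
computations. -/
lemma isDualNumbers_specTop (K : Type u) [Field K] :
    IsDualNumbers (specTop (dualFst K)) (specTop (dualInl K))
      ((Scheme.ΓSpecIso (.of (DualNumber K))).inv.hom DualNumber.eps) := by
  have hR := ΓSpecIso_inv_bijective (.of (DualNumber K))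
  have hK := ΓSpecIso_inv_bijective (.of K)
  refine ⟨fun t => ?_, ?_, ?_, fun r hr => ?_, fun t ht => ?_⟩
  · obtain ⟨t, rfl⟩ := hK.2 t
    rw [specTop_ΓSpecIso_inv, specTop_ΓSpecIso_inv]
    rfl
  · rw [specTop_ΓSpecIso_inv]
    exact map_zero _
  · rw [← map_mul, DualNumber.eps_mul_eps, map_zero]
  · obtain ⟨r, rfl⟩ := hR.2 r
    rw [specTop_ΓSpecIso_inv] at hr
    have hr' : TrivSqZeroExt.fst r = 0 := hK.1 (hr.trans (map_zero _).symm)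
    refine ⟨(Scheme.ΓSpecIso (.of K)).inv.hom (TrivSqZeroExt.snd r), ?_⟩
    rw [specTop_ΓSpecIso_inv, ← map_mul]
    congr 1
    change r = DualNumber.eps * TrivSqZeroExt.inl (TrivSqZeroExt.snd r)
    ext
    · simp [hr']
    · simp
  · obtain ⟨t, rfl⟩ := hK.2 t
    rw [specTop_ΓSpecIso_inv, ← map_mul] at ht
    have h1 : (DualNumber.eps : DualNumber K) * TrivSqZeroExt.inl t = 0 :=
      hR.1 (ht.trans (map_zero _).symm)
    have h2 := congrArg TrivSqZeroExt.snd h1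
    simp at h2
    rw [h2, map_zero]

lemma ker_dualFst_sq (K : Type u) [Field K] : RingHom.ker (dualFst K).hom ^ 2 = ⊥ := by
  rw [pow_two, eq_bot_iff, Ideal.mul_le]
  intro a ha b hb
  have ha' : TrivSqZeroExt.fst a = 0 := ha
  have hb' : TrivSqZeroExt.fst b = 0 := hb
  rw [Ideal.mem_bot]
  change (a : DualNumber K) * b = 0
  ext
  · simp [ha']
  · simp [ha', hb']

/-- Pulling a section back to the spectrum of `k(x)` is the same as evaluating it at `x`. This
relates the pulled back mold to the fibre. -/
lemma fromSpecResidueField_appLE (x : S) {U : S.Opens} (hx : x ∈ U)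
    (hle : ⊤ ≤ S.fromSpecResidueField x ⁻¹ᵁ U) :
    (S.fromSpecResidueField x).appLE U ⊤ hle ≫ (Scheme.ΓSpecIso _).hom = S.evaluation U x hx := by
  have h1 : ⊤ ≤ S.fromSpecStalk x ⁻¹ᵁ U := by
    refine (Scheme.preimage_eq_top_of_closedPoint_mem (S.fromSpecStalk x) ?_).ge
    rwa [Scheme.fromSpecStalk_closedPoint]
  have h2 : (S.fromSpecStalk x).appLE U ⊤ h1 =
      S.presheaf.germ U x hx ≫ (Scheme.ΓSpecIso _).inv := by
    rw [Scheme.Hom.appLE, Scheme.fromSpecStalk_app hx, Category.assoc, Category.assoc,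
      ← Functor.map_comp]
    have : ((homOfLE (le_top : S.fromSpecStalk x ⁻¹ᵁ U ≤ ⊤)).op ≫ (homOfLE h1).op) = 𝟙 _ := rfl
    rw [this]
    simp
  have h3 : (Spec.map (S.residue x)).appLE ⊤ ⊤ le_top = (Spec.map (S.residue x)).appTop :=
    (Scheme.Hom.app_eq_appLE _).symm
  have h4 := Scheme.Hom.appLE_comp_appLE (Spec.map (S.residue x)) (S.fromSpecStalk x) U ⊤ ⊤ h1 le_top
  have h5 : (S.fromSpecResidueField x).appLE U ⊤ hle =
    (Spec.map (S.residue x) ≫ S.fromSpecStalk x).appLE U ⊤ hle := rfl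
  rw [h5, ← h4, h2, h3, Category.assoc, Category.assoc, Scheme.ΓSpecIso_naturality,
    Iso.inv_hom_id_assoc, Scheme.germ_residue]

lemma exists_diffZero_of_injective {κ R K : Type*} [Fintype κ] [CommRing R] [CommRing K]
    (β : Module.Basis (Fin d ⊕ κ) R (Matrix (Fin n) (Fin n) R)) (φ : R →+* K)
    (hφ : Function.Bijective φ) (h : ∀ F, diffOne β F = 0 → ∃ v, diffZero β v = F)
    {F : Fin d × κ → K} (hF : diffOne (basisMap φ β) F = 0) :
    ∃ v, diffZero (basisMap φ β) v = F := by
  choose G hG using fun p => hφ.2 (F p)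
  obtain rfl : (fun p => φ (G p)) = F := funext hG
  rw [diffOne_map] at hF
  obtain ⟨v, rfl⟩ := h G (funext fun p => hφ.1 ((congrFun hF p).trans (map_zero φ).symm))
  exact ⟨_, diffZero_map β φ v⟩

lemma self_mem_ofChart {X : Scheme.{u}} {I : Fin d ↪ Fin n × Fin n} (a : Fin d → MatSec n X ⊤)
    (h : IsChart I a) (i : Fin d) : a i ∈ (ofChart a h).sec ⊤ := by
  rw [ofChart_mem]
  simp [h.norm]

/-- Lifting of conjugating matrices along the dual numbers makes cocycles coboundaries. -/
theorem exists_diffZero_of_lifts {K : Type u} [Field K] {I : Fin d ↪ Fin n × Fin n}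
    {a : Fin d → MatSec n (Spec (.of K)) ⊤} (h : IsChart I a)
    (H : ∀ (B : Mold n d (Spec (.of (DualNumber K)))) (P : Spec (.of K) ⟶ PGL.scheme.{u} n),
      pull (Spec.map (dualFst K)) B = conj P (ofChart a h) →
      ∃ Q : Spec (.of (DualNumber K)) ⟶ PGL.scheme.{u} n,
        Spec.map (dualFst K) ≫ Q = P ∧ conj Q (pull (Spec.map (dualInl K)) (ofChart a h)) = B)
    {F} (hF : diffOne (chartBasis h) F = 0) : ∃ v, diffZero (chartBasis h) v = F := by
  have hε := isDualNumbers_specTop K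
  have := isLocalRing_ΓSpec (.of (DualNumber K))
  have := isLocalRing_ΓSpec (.of K)
  have hloc : IsLocalHom (specTop (dualFst K)) :=
    Function.Surjective.isLocalHom _ fun t => ⟨_, hε.map_incl t⟩
  have hb := hε.isChart_deform h hF
  obtain ⟨P, hP⟩ := PGL.exists_sectionHom_eq (X := Spec (.of K)) (PGL.ofMatrix.{u} 1 1 (mul_one 1))
  -- The lifting problem is posed for the mold deformed by the cocycle and for the identity of PGLₙ.
  -- It is well posed because setting `ε = 0` returns the original basis.
  obtain ⟨Q, hQP, hQ⟩ := H (ofChart _ hb) P (ext_top fun m => by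
    rw [mem_sec_conj_top, hP, PGL.conjAlgEquiv_ofMatrix, one_mul, mul_one, pull_ofChart]
    have e : ∀ i, pullMat (Spec.map (dualFst K)) ⊤ ⊤ le_top _ = a i := fun i =>
      hε.map_deform (a i) (cochainMap (chartBasis h) F (a i))
    simp only [e])
  refine hε.exists_diffZero_eq h (PGL.sectionHom Q ⊤) ?_ fun i => ?_
  · rw [PGL.sectionHom_comp (Spec.map (dualFst K)) Q ⊤ ⊤ le_top, hQP, hP]
  · refine ((isFrame_pull (Spec.map (dualInl K)) _ le_top (isFrame_ofChart a h)).isAdapted _).1 ?_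
    rw [← mem_sec_conj_top, hQ]
    exact self_mem_ofChart _ hb i

/-- The lifting property is used only for the dual numbers over `k(x)`, mapped to `S` through `Spec
k(x)`. A normalised frame near `x` restricts to a chart of the fibre, which is the form in which
deformations are written down. -/
theorem subsingleton_cohomology_of_hasLocalLifts (A : Mold n d S) (hA : HasLocalLifts (orbitMap A)) (x : S) :
    Subsingleton
      (Hochschild.Cohomology (S.residueField x) (A.fiber x) (BimodQuot (A.fiber x)) 1) := by
  rw [hasLocalLifts_orbitMap_iff] at hA
  obtain ⟨I, hx⟩ := A.exists_mem_chartLocus x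
  obtain ⟨a, ha⟩ := exists_isGood_chartLocus (I := I) (A := A)
  have hle : ⊤ ≤ S.fromSpecResidueField x ⁻¹ᵁ chartLocus I A := fun p _ => by
    change S.fromSpecResidueField x p ∈ chartLocus I A
    rwa [Scheme.fromSpecResidueField_apply]
  have hadapt := isAdapted_fiber ha.isFrame hx
  rw [hadapt.subsingleton_cohomology_iff]
  set ρ := ((S.fromSpecResidueField x).appLE _ ⊤ hle).hom with hρ
  have hpull : pull (S.fromSpecResidueField x) A = ofChart _ (ha.chart.map ρ) := by
    refine ext_frame fun x => ⟨⊤, trivial, _, _, isFrame_pull _ A hle ha.isFrame, ?_⟩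
    rw [basisMap_chartBasis]
    exact isFrame_ofChart _ _
  have key : ∀ F, diffOne (chartBasis (ha.chart.map ρ)) F = 0 →
      ∃ v, diffZero (chartBasis (ha.chart.map ρ)) v = F := fun F hF => by
    refine exists_diffZero_of_lifts (K := S.residueField x) (ha.chart.map ρ) (fun B P hB => ?_) hF
    have hid : Spec.map (dualFst (S.residueField x)) ≫ Spec.map (dualInl (S.residueField x)) =
        𝟙 _ := by
      rw [← Spec.map_comp, dualInl_dualFst, Spec.map_id]
    have : IsLocalRing (CommRingCat.of (DualNumber (S.residueField x))) :=
      inferInstanceAs (IsLocalRing (DualNumber (S.residueField x)))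
    have : IsLocalRing (CommRingCat.of (S.residueField x)) :=
      inferInstanceAs (IsLocalRing (S.residueField x))
    obtain ⟨Q, hQ, hQB⟩ := hA _ _ (dualFst (S.residueField x)) (fun t => ⟨TrivSqZeroExt.inl t, rfl⟩)
      (ker_dualFst_sq _) (Spec.map (dualInl (S.residueField x)) ≫ S.fromSpecResidueField x) B P (by
        rw [hB, ← Category.assoc, hid, Category.id_comp, hpull])
    refine ⟨Q, hQ, ?_⟩
    rw [← hQB, pull_comp, hpull]
  intro F
  refine ⟨fun hF => ?_, ?_⟩
  -- The chart basis occurs twice, evaluated in `k(x)` and pulled back to the global sections of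
  -- `Spec k(x)`. The two agree along an isomorphism of rings.
  · have e : basisMap (S.evaluation _ x hx).hom (chartBasis ha.chart) =
        basisMap (Scheme.ΓSpecIso (S.residueField x)).hom.hom (chartBasis (ha.chart.map ρ)) := by
      rw [← basisMap_chartBasis, basisMap_comp, hρ, ← CommRingCat.hom_comp,
        fromSpecResidueField_appLE x hx hle]
    rw [e] at hF ⊢
    exact exists_diffZero_of_injective _ _
      (ConcreteCategory.bijective_of_isIso (Scheme.ΓSpecIso (S.residueField x)).hom) key hF
  · rintro ⟨v, rfl⟩
    exact hadapt.diffOne_diffZero v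

end Mold

/-! ### The smoothness criterion -/

theorem theorem3p22 (n d : ℕ) (S : Scheme.{u}) [IsLocallyNoetherian S] (A : Mold n d S) :
    Smooth (orbitMap A) ↔
      ∀ x : S, Subsingleton
        (Hochschild.Cohomology (S.residueField x) (A.fiber x) (BimodQuot (A.fiber x)) 1) := by
  refine ⟨fun h => A.subsingleton_cohomology_of_hasLocalLifts (Smooth.hasLocalLifts _), fun h => ?_⟩
  refine Smooth.of_hasLocalLifts _ ((Mold.hasLocalLifts_orbitMap_iff A).2 ?_)
  intro R T _ _ φ hφ hker s B P hB
  exact A.exists_conj_lift h φ hφ hker s B P hB
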